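/- Let $G=(V,E)$ be a finite connected graph. A \emph{local antimagic labeling} of $G$ is a bijection $f:E\to\{1,\dots,|E|\}$ such that the induced vertex labels $f^+(x)=\sum_{e\ni x}f(e)$ satisfy $f^+(x)\neq f^+(y)$ for every pair of adjacent vertices $x,y$. Let $c(f)$ be the number of distinct values of $f^+$ on $V$; the \emph{local antimagic chromatic number} $\chi_{la}(G)$ is the minimum of $c(f)$ over all local antimagic labelings $f$ of $G$. For integers $a,b,c\ge 1$, the \emph{spider} $Sp(a,b,c)$ is the tree obtained from three paths of lengths (numbers of edges) $a$, $b$ and $c$ by identifying one end-vertex of each to a single vertex. \textbf{Theorem.} Let $a,b,c\ge 2$ be integers with $a$ even and $b$ odd. Then $\chi_{la}(Sp(a,b,c))=4$. -/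

import Mathlib

section LocalAntimagic

variable {V : Type*} [Fintype V] [DecidableEq V]

/-- The induced vertex label `f⁺(x)`: the sum of `f e` over all edges `e` of `G` incident to `x`. -/
def inducedLabel (G : SimpleGraph V) [DecidableRel G.Adj] (f : Sym2 V → ℕ) (x : V) : ℕ :=
  ∑ e ∈ G.incidenceFinset x, f e

/-- `f` is a local antimagic labeling of `G`: it restricts to a bijection from the edge set of `G`
onto `{1, …, |E|}` (its values off the edge set play no role), and adjacent vertices get distinct
induced labels. -/
structure IsLocalAntimagic (G : SimpleGraph V) [DecidableRel G.Adj] (f : Sym2 V → ℕ) : Prop where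
  bijOn : Set.BijOn f G.edgeSet (Set.Icc 1 G.edgeFinset.card)
  ne_of_adj : ∀ x y : V, G.Adj x y → inducedLabel G f x ≠ inducedLabel G f y

/-- The color number `c(f)`: the number of distinct induced vertex labels. -/
def colorNumber (G : SimpleGraph V) [DecidableRel G.Adj] (f : Sym2 V → ℕ) : ℕ :=
  (Finset.univ.image (inducedLabel G f)).card

/-- The local antimagic chromatic number `χ_la(G)`: the minimum of `c(f)` over all local antimagic
labelings `f` of `G` (with value `0` if there is none, which no labeling of a nonempty graph
attains). -/
noncomputable def localAntimagicChromaticNumber (G : SimpleGraph V) [DecidableRel G.Adj] : ℕ :=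
  sInf {k | ∃ f : Sym2 V → ℕ, IsLocalAntimagic G f ∧ colorNumber G f = k}

end LocalAntimagic

/-- Vertices of the spider with `d` legs of lengths `y 0, …, y (d - 1)`: `none` is the core, and
`some ⟨i, j⟩` is the vertex of leg `i` at distance `j + 1` from the core. -/
abbrev SpiderVertex {d : ℕ} (y : Fin d → ℕ) : Type := Option (Σ i : Fin d, Fin (y i))

/-- `SpiderStep y v w`: the vertex `w` comes right after `v` on a leg, going away from the core. -/
def SpiderStep {d : ℕ} (y : Fin d → ℕ) : SpiderVertex y → SpiderVertex y → Prop
  | none, some w => w.2.val = 0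
  | some v, some w => v.1 = w.1 ∧ w.2.val = v.2.val + 1
  | _, none => False

instance {d : ℕ} (y : Fin d → ℕ) : DecidableRel (SpiderStep y)
  | none, some w => inferInstanceAs (Decidable (w.2.val = 0))
  | some v, some w => inferInstanceAs (Decidable (v.1 = w.1 ∧ w.2.val = v.2.val + 1))
  | none, none => isFalse (fun h => h)
  | some _, none => isFalse (fun h => h)

/-- The spider `Sp(y 0, …, y (d - 1))`: paths of lengths `y i` with one end-vertex of each
identified to a single vertex, the core. -/
def spider {d : ℕ} (y : Fin d → ℕ) : SimpleGraph (SpiderVertex y) where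
  Adj v w := SpiderStep y v w ∨ SpiderStep y w v
  symm := ⟨fun _ _ h => h.symm⟩
  loopless := ⟨fun v h => by
    rcases v with _ | v <;> simp [SpiderStep] at h⟩

instance {d : ℕ} (y : Fin d → ℕ) : DecidableRel (spider y).Adj :=
  fun v w => inferInstanceAs (Decidable (SpiderStep y v w ∨ SpiderStep y w v))

/-! Write q for the number of edges. Four colours are necessary: the leaves carry three distinct
labels, all at most q, while the core-side end of the edge labelled q is not a leaf, so its induced
label exceeds q (`four_le_colorNumber`).

For the converse it suffices to list the labels of each leg from the core outwards so that all
vertex labels lie in a set of four colours (`FourColorable`). Being proper is then nearly automatic: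
neighbouring inner vertices share an edge and their sums differ because labels are distinct, and a
leaf differs from its neighbour because labels are positive. Only the core must be compared with its
neighbours (`FourColorable.exists_labeling`).

The families use the colours K, K - A, K - B and one free leaf label, where K = q + A, B = A + 1 and
A is 2 or 3, chosen so that K is odd. Two of the leaves are labelled K - A = q and K - B = q - 1.
Putting v = 2 * label - K turns the labels into the odd integers from -m to m - 2 * (A - 1), with m
= K - 2, and the allowed sums of consecutive labels into 0, -2 * A and -2 * B. Insert these values
by increasing absolute value, m and -m together at level m. In every allowed pair the value of
larger absolute value can be taken to be negative, so each adjacency arises when some -m is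
inserted, and its partner is m, m - 2 * A or m - 2 * B. A partial labeling is thus a set of strands
of which only the ends matter, and these are described by their offsets from m.

Such a description does not mention m. A sequence of levels that returns to its starting state can
therefore be repeated at will, each repetition adding a fixed vector to the three leg lengths. One
path with loops yields colourings for a base vector plus the whole additive monoid generated by the
loop vectors (`Built.loop`, `Pumped.execParts`, `Family.valid`). At the core, two legs begin with
values of sum -2 * (d + i) and the third begins with the label i, so the core receives the colour K
- d, which is one of K, K - A, K - B (`Built.fourColorable`).

It remains to cover all lengths. Up to permuting the legs there is either one odd leg with two even
ones or one even leg with two odd ones, and each case splits into sectors with three parameters.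
Beyond certain thresholds a sector is periodic, and its periods lie in the monoids of the families
used there, so a finite table of families settles it (`Sector.Periodic.fourColorable`). Further
small lengths are supplied by explicit labelings. The tables are verified by computation. -/

/-! ### Edges of the spider and their induced labels -/

/-- The neighbour of `some p` on the core side. -/
def SpiderVertex.parent {d : ℕ} {y : Fin d → ℕ} (p : Σ i : Fin d, Fin (y i)) : SpiderVertex y :=
  if p.2.val = 0 then none else some ⟨p.1, ⟨p.2.val - 1, by omega⟩⟩

/-- The edge joining `some p` to its parent. -/
def spiderEdge {d : ℕ} (y : Fin d → ℕ) (p : Σ i : Fin d, Fin (y i)) : Sym2 (SpiderVertex y) :=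
  s(SpiderVertex.parent p, some p)

section

variable {d : ℕ} {y : Fin d → ℕ}

open SpiderVertex

/-- The spider is a tree rooted at the core, so every other vertex has a unique predecessor. This
lets edges be indexed by their outer ends. -/
theorem spiderStep_iff_eq_parent (v : SpiderVertex y) (p : Σ i : Fin d, Fin (y i)) :
    SpiderStep y v (some p) ↔ v = parent p := by
  rcases p with ⟨i, j⟩
  rcases v with _ | ⟨i', j'⟩
  · simp only [SpiderStep, parent]
    split_ifs with h <;> simp [h]
  · simp only [SpiderStep, parent]
    split_ifs with h
    · exact ⟨fun h2 => absurd (h ▸ h2.2 : (0 : ℕ) = j'.val + 1) (by omega), fun h2 => by simp at h2⟩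
    · rw [Option.some.injEq, Sigma.mk.injEq]
      constructor
      · rintro ⟨rfl, h2⟩
        refine ⟨rfl, heq_of_eq (Fin.ext ?_)⟩
        have h3 : j.val = j'.val + 1 := h2
        have h4 : ¬ j.val = 0 := h
        show j'.val = j.val - 1
        omega
      · rintro ⟨rfl, h2⟩
        have := congrArg Fin.val (eq_of_heq h2)
        simp only at this
        exact ⟨rfl, by omega⟩

theorem not_spiderStep_none (v : SpiderVertex y) : ¬ SpiderStep y v none := by
  rcases v with _ | v <;> simp [SpiderStep]

theorem spider_adj_iff (v w : SpiderVertex y) :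
    (spider y).Adj v w ↔ ∃ p, spiderEdge y p = s(v, w) := by
  have key : ∀ v w : SpiderVertex y,
      SpiderStep y v w ↔ ∃ p, w = some p ∧ v = parent p := by
    intro v w
    rcases w with _ | p
    · simp [not_spiderStep_none]
    · rw [spiderStep_iff_eq_parent]; simp
  simp only [spider, key, spiderEdge, Sym2.eq_iff]
  constructor
  · rintro (⟨p, rfl, rfl⟩ | ⟨p, rfl, rfl⟩)
    · exact ⟨p, Or.inl ⟨rfl, rfl⟩⟩
    · exact ⟨p, Or.inr ⟨rfl, rfl⟩⟩
  · rintro ⟨p, ⟨h1, h2⟩ | ⟨h1, h2⟩⟩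
    · exact Or.inl ⟨p, h2.symm, h1.symm⟩
    · exact Or.inr ⟨p, h2.symm, h1.symm⟩

/-- If two such edges agreed crosswise, each outer end would be the parent of the other, which the
distances to the core exclude. -/
theorem spiderEdge_injective : Function.Injective (spiderEdge y) := by
  rintro ⟨i, j⟩ ⟨i', j'⟩ h
  rw [spiderEdge, spiderEdge, Sym2.eq_iff] at h
  rcases h with ⟨-, h⟩ | ⟨h1, h2⟩
  · exact Option.some.inj h
  · exfalso
    have h2 := h2.symm
    simp only [parent] at h1 h2
    split_ifs at h1 h2 with h3 h4
    rw [Option.some.injEq, Sigma.mk.injEq] at h1 h2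
    obtain ⟨rfl, h1⟩ := h1
    have e1 := congrArg Fin.val (eq_of_heq h1)
    have e2 := congrArg Fin.val (eq_of_heq h2.2)
    simp only at e1 e2
    omega

theorem spider_edgeSet : (spider y).edgeSet = Set.range (spiderEdge y) := by
  ext e
  induction e with
  | h v w => rw [SimpleGraph.mem_edgeSet, spider_adj_iff]; simp

theorem spider_edgeFinset :
    (spider y).edgeFinset = Finset.univ.image (spiderEdge y) := by
  ext e
  rw [SimpleGraph.mem_edgeFinset, spider_edgeSet]
  simp

theorem card_spider_edgeFinset : (spider y).edgeFinset.card = ∑ i, y i := by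
  rw [spider_edgeFinset, Finset.card_image_of_injective _ spiderEdge_injective]
  simp

/-- Reindexing by outer ends makes every induced label a sum over one fixed finite type, from which
the core, leaf and inner cases are extracted. -/
theorem inducedLabel_spider (f : Sym2 (SpiderVertex y) → ℕ) (x : SpiderVertex y) :
    inducedLabel (spider y) f x =
      ∑ p : (Σ i : Fin d, Fin (y i)), if x ∈ spiderEdge y p then f (spiderEdge y p) else 0 := by
  have : (spider y).incidenceFinset x =
      (Finset.univ.filter fun p => x ∈ spiderEdge y p).image (spiderEdge y) := by
    ext e
    rw [SimpleGraph.mem_incidenceFinset, SimpleGraph.incidenceSet, Set.mem_ofPred_eq,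
      spider_edgeSet]
    simp only [Finset.mem_image, Finset.mem_filter, Finset.mem_univ, true_and, Set.mem_range]
    constructor
    · rintro ⟨⟨p, rfl⟩, h⟩; exact ⟨p, h, rfl⟩
    · rintro ⟨p, h, rfl⟩; exact ⟨⟨p, rfl⟩, h⟩
  rw [inducedLabel, this, Finset.sum_image (fun a _ b _ h => spiderEdge_injective h),
    Finset.sum_filter]

theorem inducedLabel_spider_core (f : Sym2 (SpiderVertex y) → ℕ) (hy : ∀ i, 0 < y i) :
    inducedLabel (spider y) f none = ∑ i, f (spiderEdge y ⟨i, ⟨0, hy i⟩⟩) := by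
  rw [inducedLabel_spider, Fintype.sum_sigma]
  refine Finset.sum_congr rfl fun i _ => ?_
  rw [Finset.sum_eq_single (⟨0, hy i⟩ : Fin (y i))]
  · simp [spiderEdge, parent]
  · intro j _ hj
    have : j.val ≠ 0 := fun h => hj (Fin.ext h)
    simp [spiderEdge, parent, this]
  · simp

theorem mem_spiderEdge_some_iff (i : Fin d) (j : Fin (y i)) (p : Σ i : Fin d, Fin (y i)) :
    some ⟨i, j⟩ ∈ spiderEdge y p ↔ p = ⟨i, j⟩ ∨ (p.1 = i ∧ p.2.val = j.val + 1) := by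
  rw [spiderEdge, Sym2.mem_iff, ← spiderStep_iff_eq_parent, or_comm, Option.some.injEq, eq_comm]
  simp only [SpiderStep]
  exact or_congr Iff.rfl (and_congr eq_comm Iff.rfl)

theorem inducedLabel_spider_leaf (f : Sym2 (SpiderVertex y) → ℕ) (i : Fin d) (j : Fin (y i))
    (h : j.val + 1 = y i) :
    inducedLabel (spider y) f (some ⟨i, j⟩) = f (spiderEdge y ⟨i, j⟩) := by
  rw [inducedLabel_spider, Finset.sum_eq_single (⟨i, j⟩ : Σ i : Fin d, Fin (y i))]
  · rw [if_pos ((mem_spiderEdge_some_iff i j _).2 (Or.inl rfl))]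
  · rintro ⟨i', j'⟩ - hne
    rw [if_neg]
    rw [mem_spiderEdge_some_iff]
    rintro (h1 | ⟨rfl, h1⟩)
    · exact hne h1
    · have := j'.2; dsimp only at h1 this h; omega
  · simp

theorem inducedLabel_spider_inner (f : Sym2 (SpiderVertex y) → ℕ) (i : Fin d) (j : Fin (y i))
    (h : j.val + 1 < y i) :
    inducedLabel (spider y) f (some ⟨i, j⟩) =
      f (spiderEdge y ⟨i, j⟩) + f (spiderEdge y ⟨i, ⟨j.val + 1, h⟩⟩) := by
  have hne : (⟨i, j⟩ : Σ i : Fin d, Fin (y i)) ≠ ⟨i, ⟨j.val + 1, h⟩⟩ := by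
    intro e
    rw [Sigma.mk.injEq] at e
    have := congrArg Fin.val (eq_of_heq e.2)
    simp only at this
    omega
  rw [inducedLabel_spider, ← Finset.sum_subset (Finset.subset_univ
    {(⟨i, j⟩ : Σ i : Fin d, Fin (y i)), ⟨i, ⟨j.val + 1, h⟩⟩}), Finset.sum_pair hne]
  · rw [if_pos ((mem_spiderEdge_some_iff i j _).2 (Or.inl rfl)),
      if_pos ((mem_spiderEdge_some_iff i j _).2 (Or.inr ⟨rfl, rfl⟩))]
  · rintro ⟨i', j'⟩ - hne
    rw [if_neg]
    rw [mem_spiderEdge_some_iff]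
    simp only [Finset.mem_insert, Finset.mem_singleton, not_or] at hne
    rintro (h1 | ⟨rfl, h1⟩)
    · exact hne.1 h1
    · exact hne.2 (by rw [Sigma.mk.injEq]; exact ⟨rfl, heq_of_eq (Fin.ext h1)⟩)

/-! ### The lower bound: four colours are always needed. -/

/-- The core together with three leaves and an inner end of the edge with the largest label
carry four different colours. -/
theorem four_le_colorNumber {y : Fin 3 → ℕ} (hy : ∀ i, 2 ≤ y i)
    {f : Sym2 (SpiderVertex y) → ℕ} (hf : IsLocalAntimagic (spider y) f) :
    4 ≤ colorNumber (spider y) f := by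
  set q := (spider y).edgeFinset.card with hq
  have hmem : ∀ p, f (spiderEdge y p) ∈ Set.Icc 1 q := fun p =>
    hf.bijOn.mapsTo (by rw [spider_edgeSet]; exact ⟨p, rfl⟩)
  let leaf : Fin 3 → (Σ i : Fin 3, Fin (y i)) := fun i => ⟨i, ⟨y i - 1, by have := hy i; omega⟩⟩
  have hleaf : ∀ i, inducedLabel (spider y) f (some (leaf i)) = f (spiderEdge y (leaf i)) :=
    fun i => inducedLabel_spider_leaf f i _ (by have := hy i; simp only; omega)
  have hinj : Function.Injective fun i => f (spiderEdge y (leaf i)) := by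
    intro i i' h
    have h1 := hf.bijOn.injOn (by rw [spider_edgeSet]; exact ⟨_, rfl⟩)
      (by rw [spider_edgeSet]; exact ⟨_, rfl⟩) h
    have h2 := spiderEdge_injective h1
    exact congrArg Sigma.fst h2
  have hqpos : 1 ≤ q := by
    have := hmem (leaf 0); exact this.1.trans this.2
  obtain ⟨e, he, hfe⟩ := hf.bijOn.surjOn (show q ∈ Set.Icc 1 q from ⟨hqpos, le_rfl⟩)
  rw [spider_edgeSet] at he
  obtain ⟨⟨i, j⟩, rfl⟩ := he
  -- Take the core-side end of the edge labelled q. It is the core or an inner vertex, hence meets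
  -- another edge, whose label is at least 1.
  obtain ⟨x, hx⟩ : ∃ x, q < inducedLabel (spider y) f x := by
    by_cases hj : j.val = 0
    · refine ⟨none, ?_⟩
      have hy0 : ∀ i, 0 < y i := fun i => by have := hy i; omega
      rw [inducedLabel_spider_core f hy0, Fin.sum_univ_three]
      have h0 := (hmem ⟨0, ⟨0, hy0 0⟩⟩).1
      have h1 := (hmem ⟨1, ⟨0, hy0 1⟩⟩).1
      have h2 := (hmem ⟨2, ⟨0, hy0 2⟩⟩).1
      have hj' : j = ⟨0, hy0 i⟩ := Fin.ext hj
      rw [hj'] at hfe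
      fin_cases i <;> simp only [Fin.reduceFinMk, Fin.mk_one, Fin.zero_eta] at hfe <;> omega
    · refine ⟨some ⟨i, ⟨j.val - 1, by omega⟩⟩, ?_⟩
      have hlt : j.val - 1 + 1 < y i := by have := j.2; omega
      rw [inducedLabel_spider_inner f i ⟨j.val - 1, by omega⟩ hlt]
      have h1 := (hmem ⟨i, ⟨j.val - 1, by omega⟩⟩).1
      have hj' : (⟨j.val - 1 + 1, hlt⟩ : Fin (y i)) = j := Fin.ext (by simp only; omega)
      rw [hj']
      omega
  rw [colorNumber]
  have hsub : insert (inducedLabel (spider y) f x)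
      (Finset.univ.image fun i => f (spiderEdge y (leaf i))) ⊆
      Finset.univ.image (inducedLabel (spider y) f) := by
    intro n hn
    rw [Finset.mem_insert] at hn
    rcases hn with rfl | hn
    · exact Finset.mem_image_of_mem _ (Finset.mem_univ _)
    · obtain ⟨i, -, rfl⟩ := Finset.mem_image.1 hn
      rw [← hleaf]
      exact Finset.mem_image_of_mem _ (Finset.mem_univ _)
  refine le_trans ?_ (Finset.card_le_card hsub)
  rw [Finset.card_insert_of_notMem, Finset.card_image_of_injective _ hinj]
  · simp
  · intro h
    obtain ⟨i, -, hi⟩ := Finset.mem_image.1 h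
    have := (hmem (leaf i)).2
    omega

end

/-! ### Labelings of three-legged spiders given by lists -/

/-- The labels of a leg, listed from the core outwards: consecutive sums and the leaf label are
colours from `S`, and the first sum differs from the core label `s`. -/
def LegLabels (S : Finset ℕ) (s : ℕ) (l : List ℕ) : Prop :=
  2 ≤ l.length ∧ l.IsChain (fun u v => u + v ∈ S) ∧ l.getLastD 0 ∈ S ∧
    l.getD 0 0 + l.getD 1 0 ≠ s

/-- There is a local antimagic labeling of `Sp(a, b, c)` with at most four colours. -/
def FourColorable (a b c : ℕ) : Prop :=
  ∃ (S : Finset ℕ) (x y z : List ℕ), S.card ≤ 4 ∧ x.length = a ∧ y.length = b ∧ z.length = c ∧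
    x.getD 0 0 + y.getD 0 0 + z.getD 0 0 ∈ S ∧
    LegLabels S (x.getD 0 0 + y.getD 0 0 + z.getD 0 0) x ∧
    LegLabels S (x.getD 0 0 + y.getD 0 0 + z.getD 0 0) y ∧
    LegLabels S (x.getD 0 0 + y.getD 0 0 + z.getD 0 0) z ∧
    ∀ n, 1 ≤ n → n ≤ a + b + c → n ∈ x ∨ n ∈ y ∨ n ∈ z

/-- Together with the other transposition this generates all permutations of the legs, so the leg
carrying the free leaf may be any of the three. -/
theorem FourColorable.swap_left {a b c : ℕ} (h : FourColorable a b c) : FourColorable b a c := by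
  obtain ⟨S, x, y, z, hS, rfl, rfl, rfl, hs, hx, hy, hz, hn⟩ := h
  refine ⟨S, y, x, z, hS, rfl, rfl, rfl, ?_⟩
  rw [Nat.add_comm (y.getD 0 0)]
  refine ⟨hs, hy, hx, hz, fun n h1 h2 => ?_⟩
  rcases hn n h1 (by omega) with h | h | h <;> simp [h]

theorem FourColorable.swap_right {a b c : ℕ} (h : FourColorable a b c) : FourColorable a c b := by
  obtain ⟨S, x, y, z, hS, rfl, rfl, rfl, hs, hx, hy, hz, hn⟩ := h
  refine ⟨S, x, z, y, hS, rfl, rfl, rfl, ?_⟩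
  rw [Nat.add_right_comm]
  refine ⟨hs, hx, hz, hy, fun n h1 h2 => ?_⟩
  rcases hn n h1 (by omega) with h | h | h <;> simp [h]

-- The lists contain exactly as many entries as there are labels to cover, so covering already
-- forces a bijection. Positivity and injectivity then separate all adjacent vertices except at the
-- core, where the last clause of `LegLabels` is used.
open SpiderVertex in
theorem FourColorable.exists_labeling {y : Fin 3 → ℕ} (h : FourColorable (y 0) (y 1) (y 2)) :
    ∃ f, IsLocalAntimagic (spider y) f ∧ colorNumber (spider y) f ≤ 4 := by
  obtain ⟨S, l0, l1, l2, hS, h0, h1, h2, hs, hL0, hL1, hL2, hn⟩ := h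
  obtain ⟨L, rfl, rfl, rfl⟩ : ∃ L : Fin 3 → List ℕ, L 0 = l0 ∧ L 1 = l1 ∧ L 2 = l2 :=
    ⟨![l0, l1, l2], rfl, rfl, rfl⟩
  set s := (L 0).getD 0 0 + (L 1).getD 0 0 + (L 2).getD 0 0 with hsdef
  have hlen : ∀ i, (L i).length = y i := by intro i; fin_cases i <;> assumption
  have hL : ∀ i, LegLabels S s (L i) := by intro i; fin_cases i <;> assumption
  have hy : ∀ i, 2 ≤ y i := fun i => hlen i ▸ (hL i).1
  have hy0 : ∀ i, 0 < y i := fun i => by have := hy i; omega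
  let g : (Σ i : Fin 3, Fin (y i)) → ℕ := fun p => (L p.1).getD p.2.val 0
  have hq : (spider y).edgeFinset.card = y 0 + y 1 + y 2 := by
    rw [card_spider_edgeFinset, Fin.sum_univ_three]
  set q := y 0 + y 1 + y 2 with hqdef
  have hcover : Finset.Icc 1 q ⊆ Finset.univ.image g := by
    intro n hn'
    rw [Finset.mem_Icc] at hn'
    have key : ∀ i, n ∈ L i → n ∈ Finset.univ.image g := by
      intro i hi
      obtain ⟨j, hj, rfl⟩ := List.mem_iff_getElem.1 hi
      refine Finset.mem_image.2 ⟨⟨i, ⟨j, hlen i ▸ hj⟩⟩, Finset.mem_univ _, ?_⟩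
      simp [g, hj]
    rcases hn n hn'.1 hn'.2 with h | h | h
    · exact key 0 h
    · exact key 1 h
    · exact key 2 h
  have hcardσ : Fintype.card (Σ i : Fin 3, Fin (y i)) = q := by
    simp [Fin.sum_univ_three, hqdef]
  -- A set of at most q labels that contains 1, …, q equals it. The same count gives injectivity
  -- below.
  have himg : Finset.Icc 1 q = Finset.univ.image g := by
    refine Finset.eq_of_subset_of_card_le hcover ?_
    refine Finset.card_image_le.trans ?_
    rw [Finset.card_univ, hcardσ, Nat.card_Icc]; omega
  have hginj : Function.Injective g := by
    have h1 : (Finset.univ.image g).card =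
        (Finset.univ : Finset (Σ i : Fin 3, Fin (y i))).card := by
      rw [← himg, Finset.card_univ, hcardσ, Nat.card_Icc]; omega
    have h2 := Finset.card_image_iff.1 h1
    exact fun a b hab => h2 (Finset.mem_coe.2 (Finset.mem_univ _))
      (Finset.mem_coe.2 (Finset.mem_univ _)) hab
  have hgpos : ∀ p, 1 ≤ g p := fun p => by
    have : g p ∈ Finset.Icc 1 q := himg ▸ Finset.mem_image_of_mem _ (Finset.mem_univ _)
    exact (Finset.mem_Icc.1 this).1
  -- The value 0 off the edge set is irrelevant.
  let f : Sym2 (SpiderVertex y) → ℕ := Function.extend (spiderEdge y) g 0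
  have hf : ∀ p, f (spiderEdge y p) = g p := fun p => spiderEdge_injective.extend_apply _ _ _
  have hcore : inducedLabel (spider y) f none = s := by
    rw [inducedLabel_spider_core f hy0, Fin.sum_univ_three, hf, hf, hf]
  have hleaf : ∀ i (j : Fin (y i)), j.val + 1 = y i →
      inducedLabel (spider y) f (some ⟨i, j⟩) = g ⟨i, j⟩ := fun i j h => by
    rw [inducedLabel_spider_leaf f i j h, hf]
  have hinner : ∀ i (j : Fin (y i)) (h : j.val + 1 < y i),
      inducedLabel (spider y) f (some ⟨i, j⟩) = g ⟨i, j⟩ + g ⟨i, ⟨j.val + 1, h⟩⟩ :=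
    fun i j h => by rw [inducedLabel_spider_inner f i j h, hf, hf]
  -- Every edge joins a vertex to its parent, so it is enough to compare these two labels.
  have hparent : ∀ p, inducedLabel (spider y) f (parent p) ≠
      inducedLabel (spider y) f (some p) := by
    rintro ⟨i, j⟩
    by_cases hj : j.val = 0
    · have hp : parent (⟨i, j⟩ : Σ i : Fin 3, Fin (y i)) = none := by simp [parent, hj]
      have h1 : j.val + 1 < y i := by have := hy i; omega
      rw [hp, hcore, hinner i j h1]
      have := (hL i).2.2.2
      intro h
      apply this
      rw [h]
      simp [g, hj]
    · have h1 : j.val - 1 < y i := by have := j.2; omega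
      have h2 : j.val - 1 + 1 < y i := by have := j.2; omega
      have hp : parent (⟨i, j⟩ : Σ i : Fin 3, Fin (y i)) = some ⟨i, ⟨j.val - 1, h1⟩⟩ := by
        simp [parent, hj]
      have h3 : (⟨j.val - 1 + 1, h2⟩ : Fin (y i)) = j := Fin.ext (by dsimp only; omega)
      rw [hp, hinner i ⟨j.val - 1, h1⟩ h2, h3]
      have hpos := hgpos ⟨i, ⟨j.val - 1, h1⟩⟩
      by_cases hl : j.val + 1 = y i
      · rw [hleaf i j hl]; omega
      · have hl' : j.val + 1 < y i := by have := j.2; omega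
        rw [hinner i j hl']
        intro h
        -- Cancelling the label of the shared edge would identify the labels of two distinct edges
        -- of the leg.
        have h4 : g ⟨i, ⟨j.val - 1, h1⟩⟩ = g ⟨i, ⟨j.val + 1, hl'⟩⟩ := by omega
        have h5 := hginj h4
        rw [Sigma.mk.injEq] at h5
        have h6 : j.val - 1 = j.val + 1 := congrArg Fin.val (eq_of_heq h5.2)
        omega
  refine ⟨f, ⟨?_, ?_⟩, ?_⟩
  · have hgs : g '' Set.univ = Set.Icc 1 q := by
      rw [← Finset.coe_Icc, himg, Finset.coe_image, Finset.coe_univ]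
    rw [hq, spider_edgeSet, ← Set.image_univ, ← hgs]
    refine ⟨?_, ?_, ?_⟩
    · rintro _ ⟨p, -, rfl⟩
      exact ⟨p, trivial, (hf p).symm⟩
    · rintro _ ⟨p, -, rfl⟩ _ ⟨p', -, rfl⟩ h
      rw [hf, hf] at h
      rw [hginj h]
    · rintro _ ⟨p, -, rfl⟩
      exact ⟨_, ⟨p, trivial, rfl⟩, hf p⟩
  · intro v w hvw
    obtain ⟨p, hp⟩ := (spider_adj_iff v w).1 hvw
    rw [spiderEdge, Sym2.eq_iff] at hp
    rcases hp with ⟨rfl, rfl⟩ | ⟨rfl, rfl⟩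
    · exact hparent p
    · exact (hparent p).symm
  · refine le_trans (Finset.card_le_card ?_) hS
    intro n hn
    obtain ⟨v, -, rfl⟩ := Finset.mem_image.1 hn
    rcases v with _ | ⟨i, j⟩
    · rw [hcore]; exact hs
    · obtain ⟨-, h2, h3, -⟩ := hL i
      by_cases hl : j.val + 1 = y i
      · rw [hleaf i j hl]
        have : g ⟨i, j⟩ = (L i).getLastD 0 := by
          have e : j.val = (L i).length - 1 := by rw [hlen]; omega
          simp [g, e, List.getLastD_eq_getLast?, List.getLast?_eq_getElem?]
        rw [this]; exact h3
      · have hl' : j.val + 1 < y i := by have := j.2; omega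
        rw [hinner i j hl']
        have := List.isChain_iff_getElem.1 h2 j.val (by rw [hlen]; exact hl')
        simpa [g, hlen, hl'] using this

theorem localAntimagicChromaticNumber_spider_eq_four {a b c : ℕ} (ha : 2 ≤ a) (hb : 2 ≤ b)
    (hc : 2 ≤ c) (h : FourColorable a b c) :
    localAntimagicChromaticNumber (spider ![a, b, c]) = 4 := by
  have hy : ∀ i, 2 ≤ (![a, b, c] : Fin 3 → ℕ) i := by
    intro i; fin_cases i <;> assumption
  obtain ⟨f, hf, hcol⟩ := FourColorable.exists_labeling (y := ![a, b, c]) h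
  have heq := le_antisymm hcol (four_le_colorNumber hy hf)
  refine le_antisymm (Nat.sInf_le ⟨f, hf, heq⟩) (le_csInf ⟨4, f, hf, heq⟩ ?_)
  rintro k ⟨f', hf', rfl⟩
  exact four_le_colorNumber hy hf'

/-! ### A transfer machine for three-legged labelings

Labels are replaced by odd integers `v = 2 * label - K`, so that the colours `K`, `K - A`, `K - B`
become the sums `0`, `-2 * A`, `-2 * B`. At level `m` the values `m` and `-m` are added to partial
legs ("strands"), whose ends are described relative to `m`. -/

namespace Spider

/-- The kind of an end of a strand: `opn j` has value `m - 2 * j` and may be extended;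
`small j τ` has value `-(m - 2 * j)`; `head τ` is the core end of its leg. In the last two cases
`τ` records the sum `-2 * τ` of the two outermost values. Nothing is recorded for a `free` end. -/
inductive Tip
  | opn (j : ℕ)
  | small (j τ : ℕ)
  | head (τ : Option ℕ)
  | free

/-- A partial leg: the index of the leg and its two ends. -/
structure Strand where
  leg : ℕ
  left : Tip
  right : Tip

/-- The heads recorded so far: the first head lies on leg `p` and has value `m - 2 * j`, or
the heads of `p` and `q` are complete. -/
inductive Heads
  | none
  | one (p j : ℕ)
  | two (p q : ℕ)

/-- A state of the machine. -/
structure State where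
  strands : List Strand
  heads : Heads

/-- One level: the legs and the roles of the new values `m` (`0` absent, `1` inner, `2` head,
`3` free end) and `-m` (`0` inner, `1` extendable, `2` head, `3` free end, `4` small end), and the
previous values the latter is linked to. A positive `mu` asserts `m = mu`. -/
structure Op where
  bigLeg : ℕ
  bigKind : ℕ
  smallLeg : ℕ
  smallKind : ℕ
  link0 : Bool
  linkA : Bool
  linkB : Bool
  mu : ℕ

/-! ### The data of a state. Comparisons are Boolean functions, so that long runs can be evaluated
by reduction. -/

namespace Tip

/-- Passing from level m to m + 2 leaves the values alone and increases offsets by one, since m - 2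
* j = (m + 2) - 2 * (j + 1). -/
def shift : Tip → Tip
  | opn j => opn (j + 1)
  | small j τ => small (j + 1) τ
  | t => t

/-- The end of a strand after something with sum `-2 * τ` is joined to the other end. -/
def touch (τ : ℕ) : Tip → Tip
  | head none => head (some τ)
  | t => t

def isHead : Tip → Bool
  | head _ => true
  | _ => false

def isOpn (j : ℕ) : Tip → Bool
  | opn i => i.beq j
  | _ => false

def beq : Tip → Tip → Bool
  | opn i, opn j => i.beq j
  | small i σ, small j τ => i.beq j && σ.beq τ
  | head none, head none => true
  | head (some σ), head (some τ) => σ.beq τ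
  | free, free => true
  | _, _ => false

theorem eq_of_beq {s t : Tip} (h : s.beq t = true) : s = t := by
  unfold beq at h
  split at h <;> simp_all

theorem eq_of_isOpn {j : ℕ} {t : Tip} (h : t.isOpn j = true) : t = opn j := by
  unfold isOpn at h
  split at h <;> simp_all

end Tip

namespace Strand

def shift (s : Strand) : Strand := ⟨s.leg, s.left.shift, s.right.shift⟩

def flip (s : Strand) : Strand := ⟨s.leg, s.right, s.left⟩

def hasHead (s : Strand) : Bool := s.left.isHead || s.right.isHead

def beq (s t : Strand) : Bool := s.leg.beq t.leg && s.left.beq t.left && s.right.beq t.right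

theorem eq_of_beq {s t : Strand} (h : s.beq t = true) : s = t := by
  rcases s with ⟨l, a, b⟩
  rcases t with ⟨l', a', b'⟩
  simp only [beq, Bool.and_eq_true, Nat.beq_eq] at h
  rw [h.1.1, Tip.eq_of_beq h.1.2, Tip.eq_of_beq h.2]

/-- Joining always happens at the right end; `takeStrand` supplies the reversed strand when needed.
-/
def endsAt (leg j : ℕ) (s : Strand) : Bool := s.leg.beq leg && s.right.isOpn j

end Strand

namespace Heads

def shift : Heads → Heads
  | one p j => one p (j + 1)
  | h => h

/-- No head has been recorded on leg `leg`. -/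
def avoids (leg : ℕ) : Heads → Bool
  | none => true
  | one p _ => !p.beq leg
  | two p q => !p.beq leg && !q.beq leg

def beq : Heads → Heads → Bool
  | none, none => true
  | one p i, one q j => p.beq q && i.beq j
  | two p q, two p' q' => p.beq p' && q.beq q'
  | _, _ => false

theorem eq_of_beq {s t : Heads} (h : s.beq t = true) : s = t := by
  unfold beq at h
  split at h <;> simp_all

end Heads

/-! ### The transition performed by one level. -/

/-- Remove the first strand which satisfies `P` in one of its two orientations. -/
def takeStrand (P : Strand → Bool) : List Strand → Option (Strand × List Strand)
  | [] => none
  | s :: t =>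
    bif P s then some (s, t) else
    bif P s.flip then some (s.flip, t) else
    match takeStrand P t with
    | none => none
    | some (x, r) => some (x, s :: r)

/-- The two lists of strands agree up to order and orientation. -/
def sameStrands : List Strand → List Strand → Bool
  | [], t => t.isEmpty
  | s :: l, t =>
    match takeStrand (fun x => x.beq s) t with
    | none => false
    | some (_, r) => sameStrands l r

/-- A new head may be placed on `leg`. -/
def headAllowed (leg : ℕ) (l : List Strand) (h : Heads) : Bool :=
  h.avoids leg && l.all fun s => !(s.leg.beq leg && s.hasHead)

def addBig (op : Op) (st : State) : Option State :=
  match op.bigKind with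
  | 0 => some st
  | 1 => some ⟨⟨op.bigLeg, .opn 0, .opn 0⟩ :: st.strands, st.heads⟩
  | 2 =>
    match st.heads with
    | .none =>
      bif headAllowed op.bigLeg st.strands st.heads then
        some ⟨⟨op.bigLeg, .head none, .opn 0⟩ :: st.strands, .one op.bigLeg 0⟩
      else none
    | _ => none
  | _ => some ⟨⟨op.bigLeg, .free, .opn 0⟩ :: st.strands, st.heads⟩

/-- A first head of value -m has offset `mu` because -m = m - 2 * m, which requires m to be known. A
second head is admitted only when the first has offset D, so that their values add up to -2 * D. -/
def addHead (D : ℕ) (op : Op) (st : State) : Option State :=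
  match op.smallKind with
  | 2 =>
    bif headAllowed op.smallLeg st.strands st.heads then
      match st.heads with
      | .none => bif op.mu.beq 0 then none else some ⟨st.strands, .one op.smallLeg op.mu⟩
      | .one p j => bif j.beq D then some ⟨st.strands, .two p op.smallLeg⟩ else none
      | .two _ _ => none
    else none
  | _ => some st

/-- The value -m with a link j is adjacent to m - 2 * j, so these offsets correspond to the sums 0,
-2 * A and -2 * B. -/
def links (A B : ℕ) (op : Op) : List ℕ :=
  (bif op.link0 then [0] else []) ++ (bif op.linkA then [A] else []) ++
    (bif op.linkB then [B] else [])

/-- The end formed by the new value `-m`; `τ` describes its link. -/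
def smallTip (op : Op) (τ : Option ℕ) : Option Tip :=
  match op.smallKind with
  | 1 => bif op.mu.beq 0 then none else some (.opn op.mu)
  | 2 => some (.head τ)
  | 3 => some .free
  | 4 =>
    match τ with
    | none => none
    | some t => some (.small 0 t)
  | _ => none

/-- With no link, -m starts a strand whose right end stays open at offset `mu`, which is possible
only while m is known: a later, more negative value joins it there. One link extends a strand, and
two links merge two different strands. Taking the second strand from the remainder rules out cycles.
-/
def addSmall (A B : ℕ) (op : Op) (l : List Strand) : Option (List Strand) :=
  match links A B op with
  | [] =>
    bif op.mu.beq 0 then none else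
    match smallTip op none with
    | none => none
    | some t => some (⟨op.smallLeg, t, .opn op.mu⟩ :: l)
  | [j] =>
    match takeStrand (Strand.endsAt op.smallLeg j) l, smallTip op (some j) with
    | some (s, r), some t => some (⟨op.smallLeg, s.left.touch j, t⟩ :: r)
    | _, _ => none
  | [i, j] =>
    match takeStrand (Strand.endsAt op.smallLeg i) l with
    | none => none
    | some (s, r) =>
      match takeStrand (Strand.endsAt op.smallLeg j) r with
      | none => none
      | some (s', r') =>
        bif op.smallKind.beq 0 then
          some (⟨op.smallLeg, s.left.touch i, s'.left.touch j⟩ :: r')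
        else none
  | _ => none

/-- The value m is inserted before -m, since -m may be linked to it with sum 0. -/
def step (A B D : ℕ) (op : Op) (st : State) : Option State :=
  match addBig op ⟨st.strands.map Strand.shift, st.heads.shift⟩ with
  | none => none
  | some st₁ =>
    match addHead D op st₁ with
    | none => none
    | some st₂ =>
      match addSmall A B op st₂.strands with
      | none => none
      | some l => some ⟨l, st₂.heads⟩

/-! ### Soundness of the machine -/

/-- A strand together with the values on it. -/
abbrev Filled := Strand × List ℤ

/-- Ends are read from the front of the list; the right end of a strand is read from the reversed
list. The function H holds the value at the core end of each leg, which is not relative to m. A head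
with no recorded sum is still alone on its strand. -/
def TipOK (H : ℕ → ℤ) (m : ℤ) (leg : ℕ) : Tip → List ℤ → Prop
  | .opn j, l => l.head? = some (m - 2 * j)
  | .small j τ, l => ∃ u t, l = -(m - 2 * j) :: u :: t ∧ -(m - 2 * j) + u = -(2 * τ)
  | .head none, l => l = [H leg]
  | .head (some τ), l => ∃ u t, l = H leg :: u :: t ∧ H leg + u = -(2 * τ)
  | .free, _ => True

def SumOK (A B : ℕ) (u v : ℤ) : Prop := u + v = 0 ∨ u + v = -(2 * A) ∨ u + v = -(2 * B)

theorem SumOK.symm {A B : ℕ} {u v : ℤ} (h : SumOK A B u v) : SumOK A B v u := by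
  unfold SumOK at *; omega

def StrandOK (A B : ℕ) (H : ℕ → ℤ) (m : ℤ) (p : Filled) : Prop :=
  p.2.IsChain (SumOK A B) ∧ TipOK H m p.1.leg p.1.left p.2 ∧
    TipOK H m p.1.leg p.1.right p.2.reverse

def HeadsOK (D : ℕ) (H : ℕ → ℤ) (m : ℤ) : Heads → Prop
  | .none => True
  | .one p j => H p = m - 2 * j
  | .two p q => H p + H q = -(2 * D)

/-- All values, tagged with their legs. -/
def values (R : List Filled) : List (ℕ × ℤ) := R.flatMap fun p => p.2.map (Prod.mk p.1.leg)

structure Realizes (A B D : ℕ) (H : ℕ → ℤ) (m : ℤ) (st : State) (R : List Filled) : Prop where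
  strands : R.map Prod.fst = st.strands
  ok : ∀ p ∈ R, StrandOK A B H m p
  heads : HeadsOK D H m st.heads

theorem StrandOK.flip {A B : ℕ} {H : ℕ → ℤ} {m : ℤ} {s : Strand} {l : List ℤ}
    (h : StrandOK A B H m (s, l)) : StrandOK A B H m (s.flip, l.reverse) := by
  obtain ⟨h1, h2, h3⟩ := h
  refine ⟨?_, h3, ?_⟩
  · rw [List.isChain_reverse]
    exact h1.imp fun _ _ h => h.symm
  · change TipOK H m s.leg s.left l.reverse.reverse
    rwa [List.reverse_reverse]

theorem TipOK.shift {H : ℕ → ℤ} {m : ℤ} {leg : ℕ} {t : Tip} {l : List ℤ}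
    (h : TipOK H m leg t l) : TipOK H (m + 2) leg t.shift l := by
  have e : ∀ j : ℕ, m + 2 - 2 * ((j + 1 : ℕ) : ℤ) = m - 2 * j := fun j => by push_cast; ring
  rcases t with j | ⟨j, τ⟩ | (_ | τ) | _ <;> simp only [TipOK, Tip.shift, e] at * <;> exact h

theorem Realizes.shift {A B D : ℕ} {H : ℕ → ℤ} {m : ℤ} {st : State} {R : List Filled}
    (h : Realizes A B D H m st R) :
    Realizes A B D H (m + 2) ⟨st.strands.map Strand.shift, st.heads.shift⟩
      (R.map fun p => (p.1.shift, p.2)) := by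
  refine ⟨?_, ?_, ?_⟩
  · simp [← h.strands]
  · intro p hp
    obtain ⟨p₀, hp₀, rfl⟩ := List.mem_map.1 hp
    obtain ⟨h1, h2, h3⟩ := h.ok p₀ hp₀
    exact ⟨h1, h2.shift, h3.shift⟩
  · have := h.heads
    rcases st with ⟨_, (_ | ⟨p, j⟩ | ⟨p, q⟩)⟩ <;> simp only [HeadsOK, Heads.shift] at *
    · push_cast; linarith
    · exact this

theorem values_shift (R : List Filled) :
    values (R.map fun p => (p.1.shift, p.2)) = values R := by
  simp [values, List.flatMap_map, Strand.shift]

/-- Reversing a strand preserves its validity because allowed sums are symmetric. The multiset of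
tagged values does not change, and later arguments need nothing else. -/
theorem takeStrand_spec {A B : ℕ} {H : ℕ → ℤ} {m : ℤ} {P : Strand → Bool} {l r : List Strand}
    {s : Strand} (h : takeStrand P l = some (s, r)) {R : List Filled}
    (hR : R.map Prod.fst = l) (hok : ∀ p ∈ R, StrandOK A B H m p) :
    P s = true ∧ ∃ w R', R'.map Prod.fst = r ∧ (∀ p ∈ R', StrandOK A B H m p) ∧
      StrandOK A B H m (s, w) ∧ (values R).Perm (w.map (Prod.mk s.leg) ++ values R') := by
  induction l generalizing r R with
  | nil => simp [takeStrand] at h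
  | cons s₀ t ih =>
    obtain ⟨⟨s₁, w₀⟩, R₀, rfl, rfl, hR₀⟩ := List.map_eq_cons_iff.1 hR
    have hok₀ := hok _ (List.mem_cons_self ..)
    have hokR : ∀ p ∈ R₀, StrandOK A B H m p := fun p hp => hok _ (List.mem_cons_of_mem _ hp)
    simp only [takeStrand, cond_eq_ite] at h
    split_ifs at h with h1 h2
    · obtain ⟨rfl, rfl⟩ := Prod.mk.inj (Option.some.inj h)
      exact ⟨h1, w₀, R₀, hR₀, hokR, hok₀, by simp [values]⟩
    · obtain ⟨rfl, rfl⟩ := Prod.mk.inj (Option.some.inj h)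
      refine ⟨h2, w₀.reverse, R₀, hR₀, hokR, hok₀.flip, ?_⟩
      simp only [values, List.flatMap_cons, Strand.flip, List.map_reverse]
      exact (List.reverse_perm _).symm.append_right _
    · split at h
      · simp at h
      · rename_i x r' hx
        obtain ⟨rfl, rfl⟩ := Prod.mk.inj (Option.some.inj h)
        obtain ⟨hP, w, R', e1, e2, e3, e4⟩ := ih hx hR₀ hokR
        refine ⟨hP, w, (s₁, w₀) :: R', by simp [e1], ?_, e3, ?_⟩
        · intro p hp
          rcases List.mem_cons.1 hp with rfl | hp
          · exact hok₀
          · exact e2 p hp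
        · simp only [values, List.flatMap_cons] at e4 ⊢
          exact (e4.append_left _).trans (by
            rw [← List.append_assoc, ← List.append_assoc]
            exact List.perm_append_comm.append_right _)

/-- The lists of values may be reordered and reversed to match the target state. This is what allows
a loop to close up to order and orientation. -/
theorem sameStrands_spec {A B D : ℕ} {H : ℕ → ℤ} {m : ℤ} {l t : List Strand} {h : Heads}
    (hs : sameStrands l t = true) {R : List Filled} (hR : Realizes A B D H m ⟨t, h⟩ R) :
    ∃ R', Realizes A B D H m ⟨l, h⟩ R' ∧ (values R).Perm (values R') := by
  induction l generalizing t R with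
  | nil =>
    rw [sameStrands, List.isEmpty_iff] at hs
    subst hs
    exact ⟨R, hR, List.Perm.refl _⟩
  | cons s l ih =>
    rw [sameStrands] at hs
    split at hs
    · simp at hs
    · rename_i x r hx
      obtain ⟨hP, w, R', e1, e2, e3, e4⟩ := takeStrand_spec hx hR.strands hR.ok
      obtain rfl := Strand.eq_of_beq hP
      obtain ⟨R'', f1, f2⟩ := ih hs (R := R') ⟨e1, e2, hR.heads⟩
      refine ⟨(x, w) :: R'', ⟨by simp [f1.strands], ?_, hR.heads⟩, ?_⟩
      · intro p hp
        rcases List.mem_cons.1 hp with rfl | hp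
        · exact e3
        · exact f1.ok p hp
      · simp only [values, List.flatMap_cons] at e4 f2 ⊢
        exact e4.trans (f2.append_left _)

theorem TipOK.getLast?_eq {H : ℕ → ℤ} {m : ℤ} {leg j : ℕ} {w : List ℤ}
    (h : TipOK H m leg (.opn j) w.reverse) : w.getLast? = some (m - 2 * j) := by
  simpa [TipOK] using h

/-- Appending at the far end can affect the near end only if the strand is a lone head, whose first
sum then becomes known. -/
theorem TipOK.touch {H : ℕ → ℤ} {m : ℤ} {leg τ : ℕ} {t : Tip} {w r : List ℤ} {x y : ℤ}
    (h : TipOK H m leg t w) (hy : w.getLast? = some y) (hx : y + x = -(2 * τ)) :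
    TipOK H m leg (t.touch τ) (w ++ x :: r) := by
  rcases t with j | ⟨j, σ⟩ | (_ | σ) | _
  · simp only [TipOK, Tip.touch] at h ⊢
    simp [h]
  · obtain ⟨u, t, rfl, e⟩ := h
    exact ⟨u, t ++ x :: r, rfl, e⟩
  · obtain rfl : w = [H leg] := h
    obtain rfl : H leg = y := by simpa using hy
    exact ⟨x, r, rfl, hx⟩
  · obtain ⟨u, t, rfl, e⟩ := h
    exact ⟨u, t ++ x :: r, rfl, e⟩
  · trivial

/-- Only head tips of leg p depend on H p. The test `headAllowed` guarantees that there are none, so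
recording a new head does not disturb the existing strands. -/
theorem TipOK.update {H : ℕ → ℤ} {m v : ℤ} {leg p : ℕ} {t : Tip} {w : List ℤ}
    (h : TipOK H m leg t w) (hp : leg ≠ p ∨ t.isHead = false) :
    TipOK (Function.update H p v) m leg t w := by
  rcases t with j | ⟨j, σ⟩ | (_ | σ) | _ <;> simp only [TipOK, Tip.isHead] at h hp ⊢
  · exact h
  · exact h
  · rw [Function.update_of_ne (by simpa using hp)]; exact h
  · rw [Function.update_of_ne (by simpa using hp)]; exact h

theorem headAllowed_spec {leg : ℕ} {l : List Strand} {h : Heads}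
    (ha : headAllowed leg l h = true) : h.avoids leg = true ∧
      ∀ s ∈ l, s.leg ≠ leg ∨ (s.left.isHead = false ∧ s.right.isHead = false) := by
  simp only [headAllowed, Strand.hasHead, Bool.and_eq_true, List.all_eq_true] at ha
  refine ⟨ha.1, fun s hs => ?_⟩
  have := ha.2 s hs
  by_cases e : s.leg = leg
  · subst e
    simpa [Nat.beq_refl] using this
  · exact Or.inl e

theorem StrandOK.update {A B leg : ℕ} {H : ℕ → ℤ} {m v : ℤ} {st : List Strand} {hd : Heads}
    {R : List Filled} (ha : headAllowed leg st hd = true) (hR : R.map Prod.fst = st)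
    (h : ∀ p ∈ R, StrandOK A B H m p) :
    ∀ p ∈ R, StrandOK A B (Function.update H leg v) m p := by
  intro p hp
  obtain ⟨h1, h2, h3⟩ := h p hp
  have := (headAllowed_spec ha).2 p.1 (hR ▸ List.mem_map_of_mem hp)
  exact ⟨h1, h2.update (this.imp id And.left), h3.update (this.imp id And.right)⟩

/-- The value added by the first half of a level. -/
def bigValues (op : Op) (m : ℤ) : List (ℕ × ℤ) :=
  bif op.bigKind.beq 0 then [] else [(op.bigLeg, m)]

theorem addBig_spec {A B D : ℕ} {H : ℕ → ℤ} {m : ℤ} {op : Op} {st st' : State} {R : List Filled}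
    (h : Realizes A B D H m st R) (hs : addBig op st = some st') :
    ∃ H' R', Realizes A B D H' m st' R' ∧ values R' = bigValues op m ++ values R := by
  unfold addBig at hs
  split at hs
  · rename_i e
    obtain rfl := Option.some.inj hs
    exact ⟨H, R, h, by simp [bigValues, e]⟩
  · rename_i e
    obtain rfl := Option.some.inj hs
    refine ⟨H, (⟨op.bigLeg, .opn 0, .opn 0⟩, [m]) :: R, ⟨by simp [h.strands], ?_, h.heads⟩, ?_⟩
    · intro p hp
      rcases List.mem_cons.1 hp with rfl | hp
      · simp [StrandOK, TipOK]
      · exact h.ok p hp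
    · simp only [bigValues, e, values]
      rfl
  · rename_i e
    split at hs
    · rename_i e'
      simp only [cond_eq_ite] at hs
      split_ifs at hs with ha
      obtain rfl := Option.some.inj hs
      refine ⟨Function.update H op.bigLeg m, (⟨op.bigLeg, .head none, .opn 0⟩, [m]) :: R,
        ⟨by simp [h.strands], ?_, by simp [HeadsOK]⟩, ?_⟩
      · intro p hp
        rcases List.mem_cons.1 hp with rfl | hp
        · simp [StrandOK, TipOK]
        · exact StrandOK.update ha h.strands h.ok p hp
      · simp only [bigValues, e, values]
        rfl
    · simp at hs
  · rename_i e _ _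
    obtain rfl := Option.some.inj hs
    refine ⟨H, (⟨op.bigLeg, .free, .opn 0⟩, [m]) :: R, ⟨by simp [h.strands], ?_, h.heads⟩, ?_⟩
    · intro p hp
      rcases List.mem_cons.1 hp with rfl | hp
      · simp [StrandOK, TipOK]
      · exact h.ok p hp
    · have : op.bigKind.beq 0 = false := by
        rw [Bool.eq_false_iff, Ne, Nat.beq_eq]; assumption
      simp [bigValues, this, values]

theorem addHead_spec {A B D : ℕ} {H : ℕ → ℤ} {m : ℤ} {op : Op} {st st' : State} {R : List Filled}
    (h : Realizes A B D H m st R) (hs : addHead D op st = some st') (hmu : op.mu ≠ 0 → m = op.mu) :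
    ∃ H', Realizes A B D H' m st' R ∧ (op.smallKind = 2 → H' op.smallLeg = -m) := by
  unfold addHead at hs
  split at hs
  · rcases ha : headAllowed op.smallLeg st.strands st.heads with _ | _
    · simp [ha] at hs
    simp only [ha, cond_true] at hs
    simp only [cond_eq_ite] at hs
    have hok := StrandOK.update (v := -m) ha h.strands h.ok
    have hav := (headAllowed_spec ha).1
    have hh := h.heads
    -- The head value is recorded before the value -m is placed on a strand; the second component
    -- guarantees that the two agree.
    refine ⟨Function.update H op.smallLeg (-m), ⟨?_, hok, ?_⟩, fun _ => by simp⟩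
    · split at hs
      · split_ifs at hs
        obtain rfl := Option.some.inj hs
        exact h.strands
      · split_ifs at hs
        obtain rfl := Option.some.inj hs
        exact h.strands
      · simp at hs
    · split at hs
      · split_ifs at hs with h0
        obtain rfl := Option.some.inj hs
        have := hmu (by simpa using h0)
        simp only [HeadsOK, Function.update_self]
        omega
      · rename_i p j e
        split_ifs at hs with h0
        obtain rfl := Option.some.inj hs
        rw [e] at hh hav
        have hne : p ≠ op.smallLeg := by
          simp only [Heads.avoids, Bool.not_eq_true', Bool.eq_false_iff, ne_eq, Nat.beq_eq] at hav
          exact hav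
        simp only [HeadsOK, Function.update_self, Function.update_of_ne hne] at hh ⊢
        obtain rfl : j = D := by simpa using h0
        omega
      · simp at hs
  · rename_i e
    obtain rfl := Option.some.inj hs
    exact ⟨H, h, fun e' => absurd e' e⟩

theorem smallTip_none_spec {H : ℕ → ℤ} {m : ℤ} {op : Op} {t : Tip}
    (ht : smallTip op none = some t) (hmu : op.mu ≠ 0 → m = op.mu)
    (hH : op.smallKind = 2 → H op.smallLeg = -m) : TipOK H m op.smallLeg t [-m] := by
  unfold smallTip at ht
  split at ht
  · simp only [cond_eq_ite] at ht
    split_ifs at ht with h0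
    obtain rfl := Option.some.inj ht
    have := hmu (by simpa using h0)
    simp only [TipOK, List.head?_cons, Option.some.injEq]
    omega
  · rename_i e
    obtain rfl := Option.some.inj ht
    simp [TipOK, hH e]
  · obtain rfl := Option.some.inj ht
    trivial
  · simp at ht
  · simp at ht

theorem smallTip_some_spec {H : ℕ → ℤ} {m u : ℤ} {op : Op} {t : Tip} {j : ℕ} {w : List ℤ}
    (ht : smallTip op (some j) = some t) (hmu : op.mu ≠ 0 → m = op.mu)
    (hH : op.smallKind = 2 → H op.smallLeg = -m) (hu : -m + u = -(2 * j)) :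
    TipOK H m op.smallLeg t (-m :: u :: w) := by
  unfold smallTip at ht
  split at ht
  · simp only [cond_eq_ite] at ht
    split_ifs at ht with h0
    obtain rfl := Option.some.inj ht
    have := hmu (by simpa using h0)
    simp only [TipOK, List.head?_cons, Option.some.injEq]
    omega
  · rename_i e
    obtain rfl := Option.some.inj ht
    exact ⟨u, w, by simp [hH e], by rw [hH e]; exact hu⟩
  · obtain rfl := Option.some.inj ht
    trivial
  · obtain rfl := Option.some.inj ht
    exact ⟨u, w, by simp, by simpa using hu⟩
  · simp at ht

theorem mem_links {A B j : ℕ} {op : Op} (h : j ∈ links A B op) : j = 0 ∨ j = A ∨ j = B := by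
  simp only [links, cond_eq_ite, List.mem_append] at h
  rcases h with (h | h) | h <;> split_ifs at h <;> simp_all

theorem sumOK_of_mem_links {A B j : ℕ} {op : Op} (h : j ∈ links A B op) {u v : ℤ}
    (e : u + v = -(2 * j)) : SumOK A B u v := by
  unfold SumOK
  rcases mem_links h with rfl | rfl | rfl <;> simp_all

theorem endsAt_spec {leg j : ℕ} {s : Strand} (h : Strand.endsAt leg j s = true) :
    s.leg = leg ∧ s.right = .opn j := by
  simp only [Strand.endsAt, Bool.and_eq_true, Nat.beq_eq] at h
  exact ⟨h.1, Tip.eq_of_isOpn h.2⟩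

theorem addSmall_spec {A B : ℕ} {H : ℕ → ℤ} {m : ℤ} {op : Op} {l l' : List Strand}
    {R : List Filled} (hR : R.map Prod.fst = l) (hok : ∀ p ∈ R, StrandOK A B H m p)
    (hs : addSmall A B op l = some l') (hmu : op.mu ≠ 0 → m = op.mu)
    (hH : op.smallKind = 2 → H op.smallLeg = -m) :
    ∃ R', R'.map Prod.fst = l' ∧ (∀ p ∈ R', StrandOK A B H m p) ∧
      (values R').Perm ((op.smallLeg, -m) :: values R) := by
  unfold addSmall at hs
  split at hs
  · simp only [cond_eq_ite] at hs
    split_ifs at hs with h0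
    split at hs
    · simp at hs
    · rename_i t ht
      obtain rfl := Option.some.inj hs
      refine ⟨(⟨op.smallLeg, t, .opn op.mu⟩, [-m]) :: R, by simp [hR], ?_, by simp [values]⟩
      intro p hp
      rcases List.mem_cons.1 hp with rfl | hp
      · refine ⟨by simp, smallTip_none_spec ht hmu hH, ?_⟩
        have := hmu (by simpa using h0)
        simp only [TipOK, List.reverse_singleton, List.head?_cons, Option.some.injEq]
        omega
      · exact hok p hp
  · rename_i j hj
    have hjl : j ∈ links A B op := hj ▸ List.mem_singleton_self j
    split at hs
    · rename_i s r t hx ht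
      obtain rfl := Option.some.inj hs
      obtain ⟨hP, w, R', e1, e2, ⟨c1, c2, c3⟩, e4⟩ := takeStrand_spec hx hR hok
      obtain ⟨f1, f2⟩ := endsAt_spec hP
      simp only [f1, f2] at c1 c2 c3
      have hl := c3.getLast?_eq
      obtain ⟨w, rfl⟩ := List.getLast?_eq_some_iff.1 hl
      -- The strand ends with m - 2 * j, and appending -m creates the sum -2 * j.
      refine ⟨(⟨op.smallLeg, s.left.touch j, t⟩, w ++ [m - 2 * j] ++ [-m]) :: R',
        by simp [e1], ?_, ?_⟩
      · intro p hp
        rcases List.mem_cons.1 hp with rfl | hp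
        · refine ⟨?_, c2.touch hl (by ring), ?_⟩
          · refine List.isChain_append.2 ⟨c1, by simp, ?_⟩
            intro x hx y hy
            obtain rfl : m - 2 * j = x := by simpa using hx
            obtain rfl : -m = y := by simpa using hy
            exact sumOK_of_mem_links hjl (by ring)
          · simp only [List.reverse_append, List.reverse_singleton, List.singleton_append]
            exact smallTip_some_spec ht hmu hH (by ring)
        · exact e2 p hp
      · simp only [values, List.flatMap_cons, f1] at e4 ⊢
        rw [List.map_append, List.append_assoc]
        exact (List.perm_middle).trans (e4.symm.cons _)
    · simp at hs
  · rename_i i j hij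
    have hil : i ∈ links A B op := hij ▸ by simp
    have hjl : j ∈ links A B op := hij ▸ by simp
    split at hs
    · simp at hs
    · rename_i s r hx
      split at hs
      · simp at hs
      · rename_i s' r' hx'
        simp only [cond_eq_ite] at hs
        split_ifs at hs
        obtain rfl := Option.some.inj hs
        obtain ⟨hP, w, R', e1, e2, ⟨c1, c2, c3⟩, e4⟩ := takeStrand_spec hx hR hok
        obtain ⟨hP', w', R'', e1', e2', ⟨c1', c2', c3'⟩, e4'⟩ := takeStrand_spec hx' e1 e2
        obtain ⟨f1, f2⟩ := endsAt_spec hP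
        obtain ⟨f1', f2'⟩ := endsAt_spec hP'
        simp only [f1, f2] at c1 c2 c3
        simp only [f1', f2'] at c1' c2' c3'
        have hl := c3.getLast?_eq
        have hl' := c3'.getLast?_eq
        -- The value -m goes between the open ends, so the second strand is traversed backwards and
        -- its left end becomes the right end of the union.
        refine ⟨(⟨op.smallLeg, s.left.touch i, s'.left.touch j⟩, w ++ -m :: w'.reverse) :: R'',
          by simp [e1'], ?_, ?_⟩
        · intro p hp
          rcases List.mem_cons.1 hp with rfl | hp
          · refine ⟨?_, c2.touch hl (by ring), ?_⟩
            · refine List.isChain_append.2 ⟨c1, ?_, ?_⟩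
              · refine List.isChain_cons.2 ⟨?_, ?_⟩
                · intro y hy
                  rw [List.head?_reverse, hl'] at hy
                  obtain rfl : m - 2 * j = y := by simpa using hy
                  exact sumOK_of_mem_links hjl (by ring)
                · rw [List.isChain_reverse]
                  exact c1'.imp fun _ _ h => h.symm
              · intro x hx y hy
                rw [hl] at hx
                obtain rfl : m - 2 * i = x := by simpa using hx
                obtain rfl : -m = y := by simpa using hy
                exact sumOK_of_mem_links hil (by ring)
            · simp only [List.reverse_append, List.reverse_cons, List.reverse_reverse,
                List.append_assoc, List.singleton_append]
              exact c2'.touch hl' (by ring)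
          · exact e2' p hp
        · simp only [values, List.flatMap_cons, f1, f1'] at e4 e4' ⊢
          rw [List.map_append, List.map_cons, List.append_assoc, List.cons_append]
          refine List.perm_middle.trans (List.Perm.cons _ ?_)
          refine .trans (.append_left _ ?_) (e4.trans (.append_left _ e4')).symm
          rw [List.map_reverse]
          exact (List.reverse_perm _).append_right _
  · simp at hs

theorem step_spec {A B D : ℕ} {H : ℕ → ℤ} {m : ℤ} {op : Op} {st st' : State} {R : List Filled}
    (h : Realizes A B D H m st R) (hs : step A B D op st = some st')
    (hmu : op.mu ≠ 0 → m + 2 = op.mu) :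
    ∃ H' R', Realizes A B D H' (m + 2) st' R' ∧
      (values R').Perm ((op.smallLeg, -(m + 2)) :: (bigValues op (m + 2) ++ values R)) := by
  unfold step at hs
  split at hs
  · simp at hs
  rename_i st₁ h1
  split at hs
  · simp at hs
  rename_i st₂ h2
  split at hs
  · simp at hs
  rename_i l h3
  obtain rfl := Option.some.inj hs
  obtain ⟨H₁, R₁, r1, v1⟩ := addBig_spec h.shift h1
  obtain ⟨H₂, r2, hH⟩ := addHead_spec r1 h2 hmu
  obtain ⟨R₃, s3, o3, v3⟩ := addSmall_spec r2.strands r2.ok h3 hmu hH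
  rw [v1, values_shift] at v3
  exact ⟨H₂, R₃, ⟨s3, o3, r2.heads⟩, v3⟩

/-! ### Running words -/

theorem cond_none_eq_some {α : Type*} {b : Bool} {x : Option α} {y : α} :
    (bif b then x else none) = some y ↔ b = true ∧ x = some y := by
  cases b <;> simp

/-- Leg lengths. -/
abbrev Vec := ℕ × ℕ × ℕ

/-- A state, the number of levels without a positive value, and the number of values per leg. -/
structure Config where
  state : State
  gap : ℕ
  len : Vec

def unitVec : ℕ → Vec
  | 0 => (1, 0, 0)
  | 1 => (0, 1, 0)
  | _ => (0, 0, 1)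

def Vec.plus (x y : Vec) : Vec := (x.1.add y.1, x.2.1.add y.2.1, x.2.2.add y.2.2)

theorem Vec.plus_eq (x y : Vec) : Vec.plus x y = x + y := rfl

def Vec.size (x : Vec) : ℕ := (x.1.add x.2.1).add x.2.2

theorem Vec.size_eq (x : Vec) : Vec.size x = x.1 + x.2.1 + x.2.2 := rfl

/-- Perform one level; in an early phase the configuration determines the level. -/
def advance (A B D : ℕ) (early : Bool) (op : Op) (c : Config) : Option Config :=
  -- Once a level has omitted its positive value, all later levels must do so too. In an early phase
  -- the level is computed as m + 2 = size + gap + 1, by the invariant in `Built`; otherwise `mu =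
  -- 0` makes no assertion about m.
  bif op.bigLeg.blt 3 && op.smallLeg.blt 3 && (op.bigKind.beq 0 || c.gap.beq 0) then
    match step A B D ⟨op.bigLeg, op.bigKind, op.smallLeg, op.smallKind, op.link0, op.linkA,
        op.linkB, bif early then (c.len.size.add c.gap).add 1 else 0⟩ c.state with
    | none => none
    | some st =>
      bif op.bigKind.beq 0 then some ⟨st, c.gap.add 1, (unitVec op.smallLeg).plus c.len⟩
      else some ⟨st, 0, (unitVec op.smallLeg).plus ((unitVec op.bigLeg).plus c.len)⟩
  else none

def exec (A B D : ℕ) (early : Bool) : List Op → Config → Option Config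
  | [], c => some c
  | op :: w, c =>
    match advance A B D early op c with
    | none => none
    | some c' => exec A B D early w c'

/-- The configuration is reached by some arrangement of values. -/
def Built (A B D : ℕ) (c : Config) : Prop :=
  ∃ (m : ℤ) (H : ℕ → ℤ) (R : List Filled), Realizes A B D H m c.state R ∧ m % 2 = 1 ∧
    -- Each level contributes two values, or one if it belongs to the gap, and (m + 1) / 2 levels
    -- have been performed.
    m + 1 = c.len.size + c.gap ∧
    (∀ p ∈ values R, -m ≤ p.2 ∧ p.2 % 2 = 1) ∧
    (∀ v : ℤ, v % 2 = 1 → -m ≤ v → v ≤ m - 2 * c.gap →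
      ∃ leg < 3, (leg, v) ∈ values R) ∧
    (values R).countP (fun p => p.1 == 0) = c.len.1 ∧
    (values R).countP (fun p => p.1 == 1) = c.len.2.1 ∧
    (values R).countP (fun p => p.1 == 2) = c.len.2.2

/-- The empty arrangement sits at level m = -1, so that the first level is m = 1. -/
theorem built_nil (A B D : ℕ) : Built A B D ⟨⟨[], .none⟩, 0, 0⟩ := by
  refine ⟨-1, fun _ => 0, [], ⟨rfl, by simp, trivial⟩, by norm_num, rfl, by simp [values], ?_,
    rfl, rfl, rfl⟩
  intro v h0 h1 h2
  simp only [Nat.cast_zero, mul_zero, sub_zero] at h2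
  omega

theorem unitVec_size (l : ℕ) : (unitVec l).size = 1 := by
  unfold unitVec; split <;> rfl

/-- The vector x stands for lengths contributed by loops executed earlier. A level outside an early
phase depends on the state alone, so any x is allowed; an early level uses the exact value of m and
needs x = 0. -/
theorem Built.advance {A B D : ℕ} {early : Bool} {op : Op} {c c' : Config}
    (h : advance A B D early op c = some c') (x : Vec) (hx : early = true → x = 0)
    (hb : Built A B D ⟨c.state, c.gap, c.len + x⟩) :
    Built A B D ⟨c'.state, c'.gap, c'.len + x⟩ := by
  obtain ⟨m, H, R, hR, hm, hs, hr, hc, n0, n1, n2⟩ := hb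
  unfold Spider.advance at h
  rw [cond_none_eq_some] at h
  obtain ⟨h0, h⟩ := h
  simp only [Bool.and_eq_true, Bool.or_eq_true, Nat.blt_eq, Nat.beq_eq] at h0
  obtain ⟨⟨hb3, hs3⟩, hg⟩ := h0
  split at h
  · simp at h
  rename_i st hst
  obtain ⟨H', R', hR', hp⟩ := step_spec hR hst (by
    intro hne
    cases early
    · simp at hne
    · obtain rfl := hx rfl
      simp only [add_zero] at hs
      simp only [cond_true, Nat.add_eq]
      push_cast
      omega)
  simp only at hp n0 n1 n2 hs
  have hmem : ∀ p, p ∈ values R' ↔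
      p ∈ (op.smallLeg, -(m + 2)) :: (bigValues op (m + 2) ++ values R) := fun p => hp.mem_iff
  have hcount : ∀ leg : ℕ, (values R').countP (fun p => p.1 == leg) =
      ((op.smallLeg, -(m + 2)) :: (bigValues op (m + 2) ++ values R)).countP
        (fun p => p.1 == leg) := fun leg => hp.countP_eq _
  by_cases hk : op.bigKind = 0
  · have hbig : ∀ m, bigValues op m = [] := by intro m; simp [bigValues, hk]
    rw [show op.bigKind.beq 0 = true by rw [Nat.beq_eq]; exact hk, cond_true] at h
    obtain rfl := Option.some.inj h
    simp only [hbig, List.nil_append] at hmem hcount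
    refine ⟨m + 2, H', R', hR', by omega, ?_, ?_, ?_, ?_, ?_, ?_⟩
    · simp only [Vec.plus_eq, Vec.size_eq, Prod.fst_add, Prod.snd_add] at hs ⊢
      have := unitVec_size op.smallLeg
      rw [Vec.size_eq] at this
      push_cast [Nat.add_eq] at *
      omega
    · intro p hp
      rcases List.mem_cons.1 ((hmem p).1 hp) with rfl | hp
      · simp only; omega
      · have := hr p hp; omega
    · intro v h1 h2 h3
      simp only [Nat.add_eq] at h3
      push_cast at h3
      by_cases hv : v = -(m + 2)
      · exact ⟨op.smallLeg, hs3, (hmem _).2 (by simp [hv])⟩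
      · obtain ⟨leg, h4, h5⟩ := hc v h1 (by omega) (by simp only; omega)
        exact ⟨leg, h4, (hmem _).2 (List.mem_cons_of_mem _ h5)⟩
    all_goals
      rw [hcount, List.countP_cons]
      simp only [n0, n1, n2, Vec.plus_eq, Prod.fst_add, Prod.snd_add]
      generalize op.smallLeg = l at hs3
      interval_cases l <;> simp [unitVec] <;> ring
  · have hk' : op.bigKind.beq 0 = false := by rw [Bool.eq_false_iff, Ne, Nat.beq_eq]; exact hk
    have hbig : ∀ m, bigValues op m = [(op.bigLeg, m)] := by simp [bigValues, hk']
    rw [hk', cond_false] at h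
    obtain rfl := Option.some.inj h
    simp only [hbig, List.singleton_append] at hmem hcount
    have hg0 : c.gap = 0 := hg.resolve_left hk
    rw [hg0] at hs hc
    refine ⟨m + 2, H', R', hR', by omega, ?_, ?_, ?_, ?_, ?_, ?_⟩
    · simp only [Vec.plus_eq, Vec.size_eq, Prod.fst_add, Prod.snd_add] at hs ⊢
      have h1 := unitVec_size op.smallLeg
      have h2 := unitVec_size op.bigLeg
      rw [Vec.size_eq] at h1 h2
      push_cast at *
      omega
    · intro p hp
      rcases List.mem_cons.1 ((hmem p).1 hp) with rfl | hp
      · simp only; omega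
      · rcases List.mem_cons.1 hp with rfl | hp
        -- The invariant makes m + 1 a natural number, hence m ≥ -1.
        · have : -m ≤ m + 2 := by have := Int.natCast_nonneg (c.len + x).size; omega
          simp only; omega
        · have := hr p hp; omega
    · intro v h1 h2 h3
      simp only at h3
      push_cast at h3
      by_cases hv : v = -(m + 2)
      · exact ⟨op.smallLeg, hs3, (hmem _).2 (by simp [hv])⟩
      · by_cases hv' : v = m + 2
        · exact ⟨op.bigLeg, hb3, (hmem _).2 (by simp [hv'])⟩
        · obtain ⟨leg, h4, h5⟩ := hc v h1 (by omega) (by push_cast; omega)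
          exact ⟨leg, h4, (hmem _).2 (List.mem_cons_of_mem _ (List.mem_cons_of_mem _ h5))⟩
    all_goals
      rw [hcount, List.countP_cons, List.countP_cons]
      simp only [n0, n1, n2, Vec.plus_eq, Prod.fst_add, Prod.snd_add]
      generalize op.smallLeg = l at hs3
      generalize op.bigLeg = l' at hb3
      interval_cases l <;> interval_cases l' <;> simp [unitVec] <;> ring

theorem Built.exec {A B D : ℕ} {early : Bool} {w : List Op} {c c' : Config}
    (h : exec A B D early w c = some c') (x : Vec) (hx : early = true → x = 0)
    (hb : Built A B D ⟨c.state, c.gap, c.len + x⟩) :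
    Built A B D ⟨c'.state, c'.gap, c'.len + x⟩ := by
  induction w generalizing c with
  | nil =>
    obtain rfl := Option.some.inj h
    exact hb
  | cons op w ih =>
    rw [Spider.exec] at h
    split at h
    · simp at h
    · rename_i c₁ h1
      exact ih h (Built.advance h1 x hx hb)

/-! ### Loops and families -/

/-- The change of the lengths along a loop. -/
def loopVec (A B D : ℕ) (st : State) (w : List Op) : Option Vec :=
  match exec A B D false w ⟨st, 0, (0, 0, 0)⟩ with
  | none => none
  | some c =>
    bif c.gap.beq 0 && sameStrands st.strands c.state.strands && st.heads.beq c.state.heads then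
      some c.len
    else none

/-- The word is run once with lengths counted from zero. That run transfers to every level at which
the state can occur, because the state contains only offsets. The closing test makes the resulting
arrangement realize the original state again, so the loop can be repeated. -/
theorem Built.loop {A B D : ℕ} {st : State} {w : List Op} {v : Vec}
    (h : loopVec A B D st w = some v) (x : Vec) (hb : Built A B D ⟨st, 0, x⟩) :
    Built A B D ⟨st, 0, x + v⟩ := by
  unfold loopVec at h
  split at h
  · simp at h
  rename_i c hc
  rw [cond_none_eq_some] at h
  obtain ⟨h0, h⟩ := h
  obtain rfl := Option.some.inj h
  simp only [Bool.and_eq_true, Nat.beq_eq] at h0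
  obtain ⟨⟨hg, hs⟩, hh⟩ := h0
  obtain ⟨m, H, R, hR, rest⟩ := Built.exec hc x (by simp) (by
    rw [show ((0, 0, 0) : Vec) + x = x from zero_add x]; exact hb)
  rw [hg, add_comm c.len] at rest
  have hR' : Realizes A B D H m ⟨c.state.strands, st.heads⟩ R := by
    rw [Heads.eq_of_beq hh]; exact hR
  obtain ⟨R', h1, h2⟩ := sameStrands_spec hs hR'
  refine ⟨m, H, R', h1, rest.1, rest.2.1, ?_, ?_, ?_⟩
  · intro p hp
    exact rest.2.2.1 p (h2.mem_iff.2 hp)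
  · intro v a b c
    obtain ⟨leg, d, e⟩ := rest.2.2.2.1 v a b c
    exact ⟨leg, d, h2.mem_iff.1 e⟩
  · simp only [← h2.countP_eq]
    exact rest.2.2.2.2

def loopVecs (A B D : ℕ) (st : State) : List (List Op) → List Vec → Option (List Vec)
  | [], vs => some vs
  | w :: ws, vs =>
    match loopVec A B D st w with
    | none => none
    | some v => loopVecs A B D st ws (v :: vs)

/-- All multiples of the vectors in `vs` can be added to the lengths of `c`. -/
def Pumped (A B D : ℕ) (c : Config) (vs : List Vec) : Prop :=
  ∀ x ∈ AddSubmonoid.closure {v | v ∈ vs}, Built A B D ⟨c.state, c.gap, c.len + x⟩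

/-- All loops based at one state can be used any number of times, in addition to loops executed at
earlier states. -/
theorem Pumped.loops {A B D : ℕ} {c : Config} (hg : c.gap = 0) {ws : List (List Op)}
    {vs vs' : List Vec} (h : loopVecs A B D c.state ws vs = some vs') (hp : Pumped A B D c vs) :
    Pumped A B D c vs' := by
  induction ws generalizing vs with
  | nil =>
    obtain rfl := Option.some.inj h
    exact hp
  | cons w ws ih =>
    rw [loopVecs] at h
    split at h
    · simp at h
    rename_i v hv
    refine ih h fun x hx => ?_
    -- An element of the enlarged monoid is n • v + z with z in the old one; the induction on n
    -- performs the loop n times.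
    rw [show {u | u ∈ v :: vs} = {v} ∪ {u | u ∈ vs} by ext; simp, AddSubmonoid.closure_union,
      AddSubmonoid.mem_sup] at hx
    obtain ⟨y, hy, z, hz, rfl⟩ := hx
    obtain ⟨n, rfl⟩ := AddSubmonoid.mem_closure_singleton.1 hy
    rw [hg]
    induction n with
    | zero =>
      have := hp z hz
      rw [hg] at this
      simpa using this
    | succ n ihn =>
      have := Built.loop hv _ (ihn (AddSubmonoid.mem_closure_singleton.2 ⟨n, rfl⟩))
      rw [show c.len + ((n + 1) • v + z) = c.len + (n • v + z) + v by rw [succ_nsmul]; abel]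
      exact this

theorem Pumped.exec {A B D : ℕ} {w : List Op} {c c' : Config} {vs : List Vec}
    (h : exec A B D false w c = some c') (hp : Pumped A B D c vs) : Pumped A B D c' vs :=
  fun x hx => Built.exec h x (by simp) (hp x hx)

/-- Parameters of a family of labelings: leg `core` has a negative value at its core end. -/
structure Shape where
  A : ℕ
  B : ℕ
  core : ℕ
  d : ℕ
  i : ℕ

/-- A path of the machine with loops. -/
structure Family where
  shape : Shape
  start : List Op
  parts : List (List (List Op) × List Op)

/-- Loops are inserted only before the gap starts. Their vectors accumulate, since the word that
follows is valid whatever lengths have been added. -/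
def execParts (A B D : ℕ) : List (List (List Op) × List Op) → Config → List Vec →
    Option (Config × List Vec)
  | [], c, vs => some (c, vs)
  | (ws, w) :: ps, c, vs =>
    bif c.gap.beq 0 then
      match loopVecs A B D c.state ws vs with
      | none => none
      | some vs' =>
        match exec A B D false w c with
        | none => none
        | some c' => execParts A B D ps c' vs'
    else none

theorem Pumped.execParts {A B D : ℕ} {ps : List (List (List Op) × List Op)} {c c' : Config}
    {vs vs' : List Vec} (h : execParts A B D ps c vs = some (c', vs')) (hp : Pumped A B D c vs) :
    Pumped A B D c' vs' := by
  induction ps generalizing c vs with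
  | nil =>
    obtain ⟨rfl, rfl⟩ := Prod.mk.inj (Option.some.inj h)
    exact hp
  | cons p ps ih =>
    obtain ⟨ws, w⟩ := p
    rw [Spider.execParts] at h
    rw [cond_none_eq_some] at h
    obtain ⟨hg, h⟩ := h
    split at h
    · simp at h
    rename_i vs₁ h1
    split at h
    · simp at h
    rename_i c₁ h2
    exact ih h ((hp.loops (by simpa using hg) h1).exec h2)

/-! ### Reading a complete state as a labeling. -/

/-- The leg of `s` ends at the core with `s.left`. -/
def coreEnd (F : Shape) (s : Strand) : Bool :=
  bif s.leg.beq F.core then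
    match s.left with
    | .small j τ => (j.add 1).beq F.i && !τ.beq F.d
    | _ => false
  else
    match s.left with
    | .head (some τ) => !τ.beq F.d
    | _ => false

def otherLegs : ℕ → ℕ → ℕ → Bool
  | 0, 1, 2 => true
  | 0, 2, 1 => true
  | 1, 0, 2 => true
  | 1, 2, 0 => true
  | 2, 0, 1 => true
  | 2, 1, 0 => true
  | _, _, _ => false

/-- The state is a complete spider. -/
def complete (F : Shape) (st : State) : Bool :=
  match st.heads with
  | .two p q =>
    otherLegs F.core p q &&
    -- With K = m + 2, the offsets A - 1 and B - 1 belong to the labels K - A and K - B, which are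
    -- colours, so these values may be leaves. The third leaf is unrestricted, since its label
    -- serves as the fourth colour.
    match takeStrand (fun s => s.endsAt 0 (F.A.sub 1) && coreEnd F s) st.strands with
    | none => false
    | some (_, r) =>
      match takeStrand (fun s => s.endsAt 1 (F.B.sub 1) && coreEnd F s) r with
      | none => false
      | some (_, r') =>
        match takeStrand (fun s => s.leg.beq 2 && coreEnd F s) r' with
        | none => false
        | some (_, r'') => r''.isEmpty
  | _ => false

/-- When K = m + 2, the value -(m - 2 * (i - 1)) is the one with label i, so the leg `core` begins
with the label i. The recorded sum differs from -2 * d, which keeps the neighbour of the core from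
receiving the core colour K - d. -/
theorem coreEnd_spec {F : Shape} {H : ℕ → ℤ} {m : ℤ} {s : Strand} {w : List ℤ}
    (hc : coreEnd F s = true) (h : TipOK H m s.leg s.left w) :
    ∃ u v t, w = u :: v :: t ∧ u + v ≠ -(2 * F.d) ∧
      u = if s.leg = F.core then -(m - 2 * (F.i - 1)) else H s.leg := by
  unfold coreEnd at hc
  rw [cond_eq_ite] at hc
  split_ifs at hc with hl
  · rw [if_pos (by simpa using hl)]
    split at hc
    · rename_i j τ e
      rw [e] at h
      obtain ⟨v, t, rfl, h2⟩ := h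
      simp only [Bool.and_eq_true, Nat.beq_eq, Bool.not_eq_true', Bool.eq_false_iff, ne_eq] at hc
      refine ⟨_, v, t, rfl, ?_, ?_⟩
      · have := hc.2; omega
      · rw [← hc.1]; simp
    · simp at hc
  · rw [if_neg (by simpa using hl)]
    split at hc
    · rename_i τ e
      rw [e] at h
      obtain ⟨v, t, rfl, h2⟩ := h
      simp only [Nat.beq_eq, Bool.not_eq_true', Bool.eq_false_iff, ne_eq] at hc
      exact ⟨_, v, t, rfl, by omega, rfl⟩
    · simp at hc

/-- The label with value `v`. -/
def label (K v : ℤ) : ℕ := ((K + v) / 2).toNat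

/-- Labels of values u and v add up to K + (u + v) / 2, so the sums 0, -2 * A, -2 * B become K, K -
A, K - B. The bounds 2 - K ≤ x and d ≤ K ensure that no conversion to natural numbers truncates. -/
theorem legLabels_map {A B d : ℕ} {S : Finset ℕ} {K u v e : ℤ} {w t : List ℤ}
    (h0 : K.toNat ∈ S) (hA : (K - A).toNat ∈ S) (hB : (K - B).toNat ∈ S) (hK : K % 2 = 1)
    (hr : ∀ x ∈ w, 2 - K ≤ x ∧ x % 2 = 1) (hw : w = u :: v :: t) (hd : u + v ≠ -(2 * d))
    (hdK : d ≤ K) (hc : w.IsChain (SumOK A B)) (hl : w.getLast? = some e)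
    (he : label K e ∈ S) :
    LegLabels S (K - d).toNat (w.map (label K)) := by
  refine ⟨by simp [hw], ?_, ?_, ?_⟩
  · rw [List.isChain_map]
    refine hc.imp_of_mem_imp ?_
    intro x y hx hy hxy
    have h1 := hr x hx
    have h2 := hr y hy
    unfold label
    rcases hxy with h | h | h
    · convert h0 using 1; omega
    · convert hA using 1; omega
    · convert hB using 1; omega
  · rw [List.getLastD_eq_getLast?, List.getLast?_map, hl]
    exact he
  · have h1 := hr u (by simp [hw])
    have h2 := hr v (by simp [hw])
    simp only [hw, List.map_cons, List.getD_cons_zero, List.getD_cons_succ, label]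
    omega

/-- The spare index 3 carries the value at the core end of leg c, so the three cases for c need not
be treated separately when the core label is computed. -/
theorem otherLegs_sum {c p q : ℕ} (h : otherLegs c p q = true) (f : ℕ → ℤ) :
    (∃ g : ℕ → ℤ, g = (fun l => if l = c then f 3 else f l)
      ∧ g 0 + g 1 + g 2 = f 3 + (f p + f q)) := by
  refine ⟨_, rfl, ?_⟩
  unfold otherLegs at h
  split at h <;> simp at h ⊢ <;> ring

/-- The gap has A - 1 levels, so the values are exactly the odd integers from -m to m - 2 * (A - 1),
whose labels with K = m + 2 are 1, …, q. The core ends have sum -2 * (d + i) - (m - 2 * (i - 1)) =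
-2 * d - K, which gives the core the label K - d. -/
theorem Built.fourColorable {F : Shape} {c : Config}
    (hb : Built F.A F.B (F.d + F.i) c) (hc : complete F c.state = true) (hg : c.gap + 1 = F.A)
    (hd : F.d = 0 ∨ F.d = F.A ∨ F.d = F.B) (hB : 1 ≤ F.B) (hBK : F.B ≤ c.len.size) :
    FourColorable c.len.1 c.len.2.1 c.len.2.2 := by
  obtain ⟨m, H, R, hR, hm, hs, hr, hcov, n0, n1, n2⟩ := hb
  obtain ⟨⟨strands, heads⟩, gap, len⟩ := c
  unfold complete at hc
  simp only at *
  split at hc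
  swap
  · simp at hc
  rename_i p q
  rw [Bool.and_eq_true] at hc
  obtain ⟨hpq, hc⟩ := hc
  split at hc
  · simp at hc
  rename_i s0 r0 e0
  split at hc
  · simp at hc
  rename_i s1 r1 e1
  split at hc
  · simp at hc
  rename_i s2 r2 e2
  rw [List.isEmpty_iff] at hc
  subst hc
  obtain ⟨P0, w0, R0, f0, g0, ⟨a0, b0, c0⟩, v0⟩ := takeStrand_spec e0 hR.strands hR.ok
  obtain ⟨P1, w1, R1, f1, g1, ⟨a1, b1, c1⟩, v1⟩ := takeStrand_spec e1 f0 g0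
  obtain ⟨P2, w2, R2, f2, g2, ⟨a2, b2, c2⟩, v2⟩ := takeStrand_spec e2 f1 g1
  obtain rfl : R2 = [] := by simpa using f2
  simp only [Bool.and_eq_true, Strand.endsAt, Nat.beq_eq] at P0 P1 P2
  obtain ⟨⟨l0, k0⟩, m0⟩ := P0
  obtain ⟨⟨l1, k1⟩, m1⟩ := P1
  obtain ⟨l2, m2⟩ := P2
  obtain ⟨x0, y0, t0, h0, d0, i0⟩ := coreEnd_spec m0 b0
  obtain ⟨x1, y1, t1, h1, d1, i1⟩ := coreEnd_spec m1 b1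
  obtain ⟨x2, y2, t2, h2, d2, i2⟩ := coreEnd_spec m2 b2
  dsimp only at a0 b0 c0 a1 b1 c1 a2 b2 c2 h0 h1 h2
  rw [l0] at i0
  rw [l1] at i1
  rw [l2] at i2
  have hv : (values R).Perm (w0.map (Prod.mk 0) ++ (w1.map (Prod.mk 1) ++
      (w2.map (Prod.mk 2)))) := by
    rw [l0] at v0
    rw [l1] at v1
    rw [l2] at v2
    refine v0.trans (List.Perm.append_left _ (v1.trans (List.Perm.append_left _ ?_)))
    simpa [values] using v2
  -- Truncation in A - 1 is harmless because A is the gap plus one; below, B ≥ 1 plays the same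
  -- role.
  have z0 : w0.getLast? = some (m - 2 * (F.A - 1)) := by
    rw [Tip.eq_of_isOpn k0] at c0
    have := c0.getLast?_eq
    rw [this]
    congr 1
    simp only [Nat.sub_eq]
    omega
  have z1 : w1.getLast? = some (m - 2 * (F.B - 1)) := by
    rw [Tip.eq_of_isOpn k1] at c1
    have := c1.getLast?_eq
    rw [this]
    congr 1
    simp only [Nat.sub_eq]
    omega
  obtain ⟨e, z2⟩ : ∃ e, w2.getLast? = some e := by
    exact ⟨_, List.getLast?_eq_some_getLast (by simp [h2])⟩
  have hK : ((m + 2 : ℤ)) = (len.size + F.A : ℕ) := by push_cast; omega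
  have hr' : ∀ (j : ℕ) (w : List ℤ), w.map (Prod.mk j) ⊆ values R →
      ∀ x ∈ w, 2 - (m + 2) ≤ x ∧ x % 2 = 1 := by
    intro j w hw x hx
    have := hr _ (hw (List.mem_map_of_mem hx))
    simp only at this
    omega
  have r0 := hr' 0 w0 fun x hx => hv.mem_iff.2 (by simp only [List.mem_append]; tauto)
  have r1 := hr' 1 w1 fun x hx => hv.mem_iff.2 (by simp only [List.mem_append]; tauto)
  have r2 := hr' 2 w2 fun x hx => hv.mem_iff.2 (by simp only [List.mem_append]; tauto)
  have len0 : w0.length = len.1 := by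
    rw [← n0, hv.countP_eq]
    simp [List.countP_append, List.countP_map, Function.comp_def]
  have len1 : w1.length = len.2.1 := by
    rw [← n1, hv.countP_eq]
    simp [List.countP_append, List.countP_map, Function.comp_def]
  have len2 : w2.length = len.2.2 := by
    rw [← n2, hv.countP_eq]
    simp [List.countP_append, List.countP_map, Function.comp_def]
  have hsum : x0 + x1 + x2 = -(2 * F.d) - (m + 2) := by
    obtain ⟨g, hg, hgs⟩ := otherLegs_sum hpq fun l => if l = 3 then -(m - 2 * (F.i - 1)) else H l
    have hh : H p + H q = -(2 * ((F.d + F.i : ℕ) : ℤ)) := hR.heads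
    push_cast at hh
    have hp3 : p ≠ 3 ∧ q ≠ 3 := by
      unfold otherLegs at hpq
      split at hpq <;> simp at hpq ⊢
    simp only [hp3.1, hp3.2, if_true, if_false] at hgs
    have q0 : x0 = g 0 := by rw [i0, hg]; simp
    have q1 : x1 = g 1 := by rw [i1, hg]; simp
    have q2 : x2 = g 2 := by rw [i2, hg]; simp
    rw [q0, q1, q2, hgs]
    linarith
  have hx0 := r0 x0 (by simp [h0])
  have hx1 := r1 x1 (by simp [h1])
  have hx2 := r2 x2 (by simp [h2])
  have hdK : (F.d : ℤ) ≤ m + 2 := by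
    rw [hK]
    rcases hd with h | h | h <;> rw [h] <;> norm_cast <;> omega
  -- The three arithmetic colours together with the label of the third leaf.
  let S : Finset ℕ := {(m + 2).toNat, (m + 2 - F.A).toNat, (m + 2 - F.B).toNat, label (m + 2) e}
  have hcore : label (m + 2) x0 + label (m + 2) x1 + label (m + 2) x2 = (m + 2 - F.d).toNat := by
    unfold label; omega
  have hS0 : (m + 2).toNat ∈ S := by simp [S]
  have hSA : (m + 2 - F.A).toNat ∈ S := by simp [S]
  have hSB : (m + 2 - F.B).toNat ∈ S := by simp [S]
  refine ⟨S, w0.map (label (m + 2)), w1.map (label (m + 2)), w2.map (label (m + 2)),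
    Finset.card_le_four, by simp [len0], by simp [len1], by simp [len2], ?_⟩
  rw [show (w0.map (label (m + 2))).getD 0 0 = label (m + 2) x0 by simp [h0],
    show (w1.map (label (m + 2))).getD 0 0 = label (m + 2) x1 by simp [h1],
    show (w2.map (label (m + 2))).getD 0 0 = label (m + 2) x2 by simp [h2], hcore]
  refine ⟨?_, ?_, ?_, ?_, ?_⟩
  · rcases hd with h | h | h <;> rw [h]
    · simpa using hS0
    · exact hSA
    · exact hSB
  · refine legLabels_map hS0 hSA hSB (by omega) r0 h0 d0 hdK a0 z0 ?_
    convert hSA using 1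
    unfold label; omega
  · refine legLabels_map hS0 hSA hSB (by omega) r1 h1 d1 hdK a1 z1 ?_
    convert hSB using 1
    unfold label; omega
  · exact legLabels_map hS0 hSA hSB (by omega) r2 h2 d2 hdK a2 z2 (by simp [S])
  · intro n hn1 hn2
    rw [Vec.size_eq] at hK
    -- The label n belongs to the value 2 * n - K, which lies in the covered range because n ≤ q = K
    -- - A.
    obtain ⟨leg, -, hleg⟩ := hcov (2 * n - (m + 2)) (by omega) (by omega) (by omega)
    have hn : label (m + 2) (2 * n - (m + 2)) = n := by unfold label; omega
    rw [hv.mem_iff] at hleg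
    simp only [List.mem_append, List.mem_map, Prod.mk.injEq] at hleg
    rcases hleg with ⟨a, ha, -, rfl⟩ | ⟨a, ha, -, rfl⟩ | ⟨a, ha, -, rfl⟩
    · exact Or.inl (List.mem_map.2 ⟨_, ha, hn⟩)
    · exact Or.inr (Or.inl (List.mem_map.2 ⟨_, ha, hn⟩))
    · exact Or.inr (Or.inr (List.mem_map.2 ⟨_, ha, hn⟩))

/-- All lengths `p.1 + x` with `x` generated by `p.2` are colourable. -/
def Valid (p : Vec × List Vec) : Prop :=
  ∀ x ∈ AddSubmonoid.closure {v | v ∈ p.2},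
    FourColorable (p.1 + x).1 (p.1 + x).2.1 (p.1 + x).2.2

/-- The lengths obtained from a family. -/
def Family.eval (F : Family) : Option (Vec × List Vec) :=
  match exec F.shape.A F.shape.B (F.shape.d.add F.shape.i) true F.start
      ⟨⟨[], .none⟩, 0, (0, 0, 0)⟩ with
  | none => none
  | some c =>
    match execParts F.shape.A F.shape.B (F.shape.d.add F.shape.i) F.parts c [] with
    | none => none
    | some (c', vs) =>
      bif complete F.shape c'.state && (c'.gap.add 1).beq F.shape.A &&
          (F.shape.d.beq 0 || F.shape.d.beq F.shape.A || F.shape.d.beq F.shape.B) &&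
          Nat.ble 1 F.shape.B && F.shape.B.ble c'.len.size then
        some (c'.len, vs)
      else none

theorem Family.valid {F : Family} {p : Vec × List Vec} (h : F.eval = some p) : Valid p := by
  unfold eval at h
  split at h
  · simp at h
  rename_i c hc
  split at h
  · simp at h
  rename_i c' vs hp
  rw [cond_none_eq_some] at h
  obtain ⟨h0, h⟩ := h
  obtain rfl := Option.some.inj h
  simp only [Bool.and_eq_true, Bool.or_eq_true, Nat.beq_eq, Nat.ble_eq, Nat.add_eq] at h0
  obtain ⟨⟨⟨⟨h1, h2⟩, h3⟩, h4⟩, h5⟩ := h0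
  have hP : Pumped F.shape.A F.shape.B (F.shape.d.add F.shape.i) c [] := by
    intro x hx
    obtain rfl : x = 0 := by simpa using hx
    exact Built.exec hc 0 (fun _ => rfl) (built_nil _ _ _)
  intro x hx
  refine (hP.execParts hp x hx).fourColorable h1 h2 (or_assoc.1 h3) h4 (h5.trans ?_)
  simp only [Vec.size_eq, Prod.fst_add, Prod.snd_add]
  omega

/-- The permutations of the legs which are used. -/
def permute : ℕ → Vec → Vec
  | 0, v => v
  | 1, v => (v.1, v.2.2, v.2.1)
  | 2, v => (v.2.1, v.1, v.2.2)
  | 3, v => (v.2.1, v.2.2, v.1)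
  | 4, v => (v.2.2, v.1, v.2.1)
  | _, v => (v.2.2, v.2.1, v.1)

theorem fourColorable_permute (n : ℕ) (v : Vec) :
    FourColorable (permute n v).1 (permute n v).2.1 (permute n v).2.2 ↔
      FourColorable v.1 v.2.1 v.2.2 := by
  unfold permute
  split
  · rfl
  · exact ⟨fun h => h.swap_right, fun h => h.swap_right⟩
  · exact ⟨fun h => h.swap_left, fun h => h.swap_left⟩
  · exact ⟨fun h => h.swap_right.swap_left, fun h => h.swap_left.swap_right⟩
  · exact ⟨fun h => h.swap_left.swap_right, fun h => h.swap_right.swap_left⟩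
  · exact ⟨fun h => h.swap_left.swap_right.swap_left, fun h => h.swap_left.swap_right.swap_left⟩

def permuteHom (n : ℕ) : Vec →+ Vec where
  toFun := permute n
  map_zero' := by unfold permute; split <;> rfl
  map_add' x y := by unfold permute; split <;> rfl

/-- Permuting coordinates is additive, so it carries the generated monoid to the monoid generated by
the permuted vectors. -/
theorem Valid.permute {p : Vec × List Vec} (h : Valid p) (n : ℕ) :
    Valid (permute n p.1, p.2.map (Spider.permute n)) := by
  intro x hx
  have e : {v | v ∈ p.2.map (Spider.permute n)} = permuteHom n '' {v | v ∈ p.2} := by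
    ext v; simp [permuteHom]
  simp only [e, ← AddMonoidHom.map_mclosure] at hx
  obtain ⟨y, hy, rfl⟩ := hx
  have := (fourColorable_permute n (p.1 + y)).2 (h y hy)
  rwa [show Spider.permute n (p.1 + y) = Spider.permute n p.1 + permuteHom n y from
    (permuteHom n).map_add _ _] at this

/-! ### Encodings -/

/-- A level is encoded by twelve bits. -/
def decodeOp (n : ℕ) : Op :=
  ⟨n % 4, n / 4 % 4, n / 16 % 4, n / 64 % 8, (n / 512 % 2).beq 1, (n / 1024 % 2).beq 1,
    (n / 2048 % 2).beq 1, 0⟩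

/-- Words end with the digit `1`. -/
def decodeWord : ℕ → ℕ → List Op
  | 0, _ => []
  | f + 1, n => bif n.ble 1 then [] else decodeOp (n % 4096) :: decodeWord f (n / 4096)

/-- Encoded families, together with a permutation of the legs. -/
structure Code where
  core : ℕ
  d : ℕ
  i : ℕ
  perm : ℕ
  start : ℕ
  parts : List (List ℕ × ℕ)

def Code.eval (A : ℕ) (c : Code) : Option (Vec × List Vec) :=
  match Family.eval ⟨⟨A, A.add 1, c.core, c.d, c.i⟩, decodeWord 100 c.start,
      c.parts.map fun p => (p.1.map (decodeWord 100), decodeWord 100 p.2)⟩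
  with
  | none => none
  | some (v, vs) => some (permute c.perm v, vs.map (permute c.perm))

theorem Code.valid {A : ℕ} {c : Code} {p : Vec × List Vec} (h : c.eval A = some p) : Valid p := by
  unfold eval at h
  split at h
  · simp at h
  · rename_i hF
    obtain rfl := Option.some.inj h
    exact (Family.valid hF).permute _

def Vec.beq (x y : Vec) : Bool := x.1.beq y.1 && x.2.1.beq y.2.1 && x.2.2.beq y.2.2

theorem Vec.eq_of_beq {x y : Vec} (h : x.beq y = true) : x = y := by
  simp only [beq, Bool.and_eq_true, Nat.beq_eq] at h
  exact Prod.ext h.1.1 (Prod.ext h.1.2 h.2)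

def subVecs (l t : List Vec) : Bool := l.all fun v => t.any fun w => v.beq w

theorem subset_of_subVecs {l t : List Vec} (h : subVecs l t = true) : l ⊆ t := by
  intro v hv
  obtain ⟨w, hw, e⟩ := List.any_eq_true.1 (List.all_eq_true.1 h v hv)
  rwa [Vec.eq_of_beq e]

/-- The recorded lists need to contain only those loop vectors that the tables use. -/
theorem Valid.mono {v : Vec} {l t : List Vec} (h : Valid (v, t)) (hl : l ⊆ t) : Valid (v, l) :=
  fun x hx => h x (AddSubmonoid.closure_mono (fun _ hw => hl hw) hx)

/-- The encoded families have the listed lengths. -/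
def checkCodes (A : ℕ) : List Code → List (Vec × List Vec) → Bool
  | [], [] => true
  | c :: l, p :: t =>
    (match c.eval A with
    | none => false
    | some q => q.1.beq p.1 && subVecs p.2 q.2) && checkCodes A l t
  | _, _ => false

theorem valid_of_checkCodes {A : ℕ} {l : List Code} {t : List (Vec × List Vec)}
    (h : checkCodes A l t = true) : ∀ p ∈ t, Valid p := by
  induction l generalizing t with
  | nil => cases t <;> simp_all [checkCodes]
  | cons c l ih =>
    cases t with
    | nil => simp
    | cons p t =>
      rw [checkCodes, Bool.and_eq_true] at h
      obtain ⟨h1, h2⟩ := h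
      intro q hq
      rcases List.mem_cons.1 hq with rfl | hq
      · split at h1
        · simp at h1
        · rename_i r hr
          rw [Bool.and_eq_true] at h1
          have := (Code.valid hr).mono (subset_of_subVecs h1.2)
          rwa [Vec.eq_of_beq h1.1] at this
      · exact ih h2 q hq

/-! ### Explicit labelings -/

def chainOK (S : List ℕ) : List ℕ → Bool
  | u :: v :: t => S.contains (u + v) && chainOK S (v :: t)
  | [e] => S.contains e
  | [] => false

def legOK (S : List ℕ) (s : ℕ) : List ℕ → Bool
  | u :: v :: t => chainOK S (u :: v :: t) && !(u + v).beq s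
  | _ => false

def headSum (l : List (List ℕ)) : ℕ := (l.map fun x => x.getD 0 0).sum

/-- Explicit colours and labels of the three legs. -/
def explicitOK (S x y z : List ℕ) : Bool :=
  S.length.ble 4 && S.contains (headSum [x, y, z]) && legOK S (headSum [x, y, z]) x &&
    legOK S (headSum [x, y, z]) y && legOK S (headSum [x, y, z]) z &&
    (List.range (x.length + y.length + z.length)).all fun n =>
      x.contains (n + 1) || y.contains (n + 1) || z.contains (n + 1)

theorem chainOK_spec {S l : List ℕ} (h : chainOK S l = true) :
    l.IsChain (fun u v => u + v ∈ S.toFinset) ∧ l.getLastD 0 ∈ S.toFinset := by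
  induction l with
  | nil => simp [chainOK] at h
  | cons u t ih =>
    cases t with
    | nil => simpa [chainOK] using h
    | cons v t =>
      simp only [chainOK, Bool.and_eq_true, List.contains_iff_mem] at h
      obtain ⟨h1, h2⟩ := ih h.2
      exact ⟨List.isChain_cons_cons.2 ⟨by simpa using h.1, h1⟩, by simpa using h2⟩

theorem legOK_spec {S l : List ℕ} {s : ℕ} (h : legOK S s l = true) :
    LegLabels S.toFinset s l := by
  unfold legOK at h
  split at h
  · rw [Bool.and_eq_true] at h
    obtain ⟨h1, h2⟩ := chainOK_spec h.1
    refine ⟨by simp, h1, h2, ?_⟩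
    have := h.2
    simp only [Bool.not_eq_true', Bool.eq_false_iff, ne_eq, Nat.beq_eq] at this
    simpa using this
  · simp at h

/-- Explicit labelings need not have the shape required of families; any four colours are accepted.
-/
theorem fourColorable_of_explicitOK {S x y z : List ℕ} (h : explicitOK S x y z = true) :
    FourColorable x.length y.length z.length := by
  simp only [explicitOK, Bool.and_eq_true, List.contains_iff_mem, Nat.ble_eq] at h
  obtain ⟨⟨⟨⟨⟨h1, h2⟩, h3⟩, h4⟩, h5⟩, h6⟩ := h
  have e : headSum [x, y, z] = x.getD 0 0 + y.getD 0 0 + z.getD 0 0 := by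
    simp [headSum, add_assoc]
  rw [e] at h2 h3 h4 h5
  refine ⟨S.toFinset, x, y, z, (List.toFinset_card_le S).trans h1, rfl, rfl, rfl,
    List.mem_toFinset.2 h2, legOK_spec h3, legOK_spec h4, legOK_spec h5, fun n hn1 hn2 => ?_⟩
  have := List.all_eq_true.1 h6 (n - 1) (List.mem_range.2 (by omega))
  rw [Nat.sub_add_cancel hn1] at this
  simpa [or_assoc] using this

/-- The legs of explicit labelings have the listed lengths. -/
def checkExplicit : List (List ℕ × List ℕ × List ℕ × List ℕ) → List Vec → Bool
  | [], [] => true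
  | (S, x, y, z) :: l, v :: t =>
    explicitOK S x y z && Vec.beq (x.length, y.length, z.length) v && checkExplicit l t
  | _, _ => false

theorem valid_of_checkExplicit {l : List (List ℕ × List ℕ × List ℕ × List ℕ)} {t : List Vec}
    (h : checkExplicit l t = true) : ∀ p ∈ t.map fun v => (v, ([] : List Vec)), Valid p := by
  induction l generalizing t with
  | nil => cases t <;> simp_all [checkExplicit]
  | cons c l ih =>
    cases t with
    | nil => simp
    | cons v t =>
      obtain ⟨S, x, y, z⟩ := c
      simp only [checkExplicit, Bool.and_eq_true] at h
      intro q hq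
      rcases List.mem_cons.1 hq with rfl | hq
      · intro w hw
        obtain rfl : w = 0 := by simpa using hw
        rw [← Vec.eq_of_beq h.1.2]
        exact fourColorable_of_explicitOK h.1.1
      · exact ih h.2 q hq

/-! ### Periodic tables -/

def Vec.le (x y : Vec) : Bool := x.1.ble y.1 && x.2.1.ble y.2.1 && x.2.2.ble y.2.2

def Vec.minus (x y : Vec) : Vec := (x.1.sub y.1, x.2.1.sub y.2.1, x.2.2.sub y.2.2)

theorem Vec.plus_minus {x y : Vec} (h : x.le y = true) : x + y.minus x = y := by
  simp only [le, Bool.and_eq_true, Nat.ble_eq] at h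
  obtain ⟨⟨h1, h2⟩, h3⟩ := h
  exact Prod.ext (Nat.add_sub_cancel' h1)
    (Prod.ext (Nat.add_sub_cancel' h2) (Nat.add_sub_cancel' h3))

/-- Search for `v` among the sums of vectors from the list. -/
def inSpan : ℕ → List Vec → Vec → Bool
  | 0, _, _ => false
  | _ + 1, [], v => v.beq (0, 0, 0)
  | f + 1, g :: gs, v => (g.le v && inSpan f (g :: gs) (v.minus g)) || inSpan f gs v

/-- The first argument is fuel. A search that runs out of it fails, so only soundness is needed. -/
theorem mem_closure_of_inSpan {f : ℕ} {gs : List Vec} {v : Vec} (h : inSpan f gs v = true) :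
    v ∈ AddSubmonoid.closure {w | w ∈ gs} := by
  induction f generalizing gs v with
  | zero => simp [inSpan] at h
  | succ f ih =>
    cases gs with
    | nil =>
      rw [Vec.eq_of_beq h]
      exact zero_mem _
    | cons g gs =>
      rw [inSpan, Bool.or_eq_true, Bool.and_eq_true] at h
      rcases h with ⟨h1, h2⟩ | h
      · rw [← Vec.plus_minus h1]
        exact add_mem (AddSubmonoid.subset_closure (List.mem_cons_self ..)) (ih h2)
      · exact AddSubmonoid.closure_mono (fun _ hw => List.mem_cons_of_mem _ hw) (ih h)

def nth {α : Type*} : ℕ → List α → Option α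
  | _, [] => none
  | 0, x :: _ => some x
  | n + 1, _ :: l => nth n l

theorem mem_of_nth {α : Type*} {n : ℕ} {l : List α} {x : α} (h : nth n l = some x) : x ∈ l := by
  induction l generalizing n with
  | nil => simp [nth] at h
  | cons y l ih =>
    cases n with
    | zero => simp_all [nth]
    | succ n => exact List.mem_cons_of_mem _ (ih h)

def allBelow : ℕ → (ℕ → Bool) → Bool
  | 0, _ => true
  | n + 1, p => p n && allBelow n p

theorem of_allBelow {n : ℕ} {p : ℕ → Bool} (h : allBelow n p = true) {i : ℕ} (hi : i < n) :
    p i = true := by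
  induction n with
  | zero => omega
  | succ n ih =>
    rw [allBelow, Bool.and_eq_true] at h
    rcases Nat.lt_succ_iff_lt_or_eq.1 hi with hi | rfl
    · exact ih h.2 hi
    · exact h.1

/-- A three-parameter family of lengths `len i j k`, for which `skip i j k` fails, with periods
`v₁, v₂, v₃` in steps `μ₁, μ₂, μ₃`; the table covers the coordinates below `θ₁ + μ₁`, and so on.
Values of `k` with the same quotient by `stride` share an entry of the table. -/
structure Sector where
  len : ℕ → ℕ → ℕ → Vec
  skip : ℕ → ℕ → ℕ → Bool
  v₁ : Vec
  v₂ : Vec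
  v₃ : Vec
  μ₁ : ℕ
  μ₂ : ℕ
  μ₃ : ℕ
  θ₁ : ℕ
  θ₂ : ℕ
  θ₃ : ℕ
  stride : ℕ

structure Sector.Periodic (s : Sector) : Prop where
  pos₁ : 0 < s.μ₁
  pos₂ : 0 < s.μ₂
  pos₃ : 0 < s.μ₃
  len_add : ∀ i j k a b c,
    s.len (i + s.μ₁ * a) (j + s.μ₂ * b) (k + s.μ₃ * c) =
      s.len i j k + (a • s.v₁ + (b • s.v₂ + c • s.v₃))
  -- Discarded cells must remain discarded under translation by periods. Read contrapositively, an
  -- admissible triple reduces to a cell that the table has to contain. A coordinate is translated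
  -- only from its threshold on.
  skip_add : ∀ i j k a b c, a = 0 ∨ s.θ₁ ≤ i → b = 0 ∨ s.θ₂ ≤ j → c = 0 ∨ s.θ₃ ≤ k →
    s.skip i j k = true → s.skip (i + s.μ₁ * a) (j + s.μ₂ * b) (k + s.μ₃ * c) = true

/-- The family must reach the cell itself. In each direction in which the cell represents infinitely
many triples, the family must also be able to absorb the period. -/
def checkEntry (s : Sector) (i j k : ℕ) : Option (Vec × List Vec) → Bool
  | none => false
  | some p => p.1.le (s.len i j k) && inSpan 100 p.2 ((s.len i j k).minus p.1) &&
      (!s.θ₁.ble i || inSpan 100 p.2 s.v₁) && (!s.θ₂.ble j || inSpan 100 p.2 s.v₂) &&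
      (!s.θ₃.ble k || inSpan 100 p.2 s.v₃)

/-- The digits of the table are indices of members of `L`. -/
def checkTable (L : List (Vec × List Vec)) (s : Sector) (T : List (List ℕ)) : Bool :=
  allBelow (s.θ₁ + s.μ₁) fun i =>
    match nth i T with
    | none => false
    | some R =>
      allBelow (s.θ₂ + s.μ₂) fun j =>
        match nth j R with
        | none => false
        | some d =>
          allBelow (s.θ₃ + s.μ₃) fun k =>
            s.skip i j k || checkEntry s i j k (nth (d / 4096 ^ (k / s.stride) % 4096) L)

theorem exists_reduced (θ : ℕ) {μ : ℕ} (h : 0 < μ) (i : ℕ) :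
    ∃ r n, r < θ + μ ∧ i = r + μ * n ∧ (n = 0 ∨ θ ≤ r) := by
  by_cases hi : i < θ
  · exact ⟨i, 0, by omega, by simp, Or.inl rfl⟩
  · refine ⟨θ + (i - θ) % μ, (i - θ) / μ, ?_, ?_, Or.inr (Nat.le_add_right ..)⟩
    · have := Nat.mod_lt (i - θ) h; omega
    · have := Nat.mod_add_div (i - θ) μ; omega

/-- Each coordinate reduces to a representative below threshold plus step. Undoing the reduction
adds multiples of the periods, and a nonzero multiple occurs only where the entry was required to
generate that period. -/
theorem Sector.Periodic.fourColorable {s : Sector} (hs : s.Periodic) {L : List (Vec × List Vec)}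
    (hL : ∀ p ∈ L, Valid p) {T : List (List ℕ)} (hT : checkTable L s T = true) {i j k : ℕ}
    (h : s.skip i j k = false) :
    FourColorable (s.len i j k).1 (s.len i j k).2.1 (s.len i j k).2.2 := by
  obtain ⟨i, a, hi, rfl, ha⟩ := exists_reduced s.θ₁ hs.pos₁ i
  obtain ⟨j, b, hj, rfl, hb⟩ := exists_reduced s.θ₂ hs.pos₂ j
  obtain ⟨k, c, hk, rfl, hc⟩ := exists_reduced s.θ₃ hs.pos₃ k
  have hskip : s.skip i j k = false := by
    by_contra h'
    rw [hs.skip_add i j k a b c ha hb hc (by simpa using h')] at h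
    simp at h
  have h1 := of_allBelow hT hi
  split at h1
  · simp at h1
  have h2 := of_allBelow h1 hj
  split at h2
  · simp at h2
  have h3 := of_allBelow h2 hk
  rw [hskip, Bool.false_or] at h3
  unfold checkEntry at h3
  split at h3
  · simp at h3
  rename_i p hp
  simp only [Bool.and_eq_true, Bool.or_eq_true, Bool.not_eq_true', Bool.eq_false_iff, ne_eq,
    Nat.ble_eq] at h3
  obtain ⟨⟨⟨⟨e0, e1⟩, e2⟩, e3⟩, e4⟩ := h3
  have key : ∀ {n θ r : ℕ} {v : Vec}, n = 0 ∨ θ ≤ r → ¬θ ≤ r ∨ inSpan 100 p.2 v = true →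
      n • v ∈ AddSubmonoid.closure {w | w ∈ p.2} := by
    intro n θ r v hn hv
    rcases hn with rfl | hn
    · rw [zero_smul]; exact zero_mem _
    · exact nsmul_mem (mem_closure_of_inSpan (hv.resolve_left (not_not.2 hn))) n
  have := hL p (mem_of_nth hp) _ (add_mem (mem_closure_of_inSpan e1)
    (add_mem (key ha e2) (add_mem (key hb e3) (key hc e4))))
  rwa [← add_assoc, Vec.plus_minus e0, ← hs.len_add] at this

/-! ### Certificates -/

/-! ### Certificates for an odd number of edges. -/

/-- Families for an odd number of edges; the parameters are `core`, `d` and `i`, a permutation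
and the words. -/
def oddCodes : List Code := [
  ⟨1, 2, 1, 4, 0x1604244, [([0x1604], 0x12e6), ([0x1a26a04a04], 0x12a6a26a04a08), ([0x1a26a26a04],
  0x1615604c25a04), ([0x1a15a04a15], 0x1910a04a15a15a04a15)]⟩, ⟨0, 2, 1, 5, 0x1615255, [([0x1615],
  0x12e6), ([0x1a26a15a15], 0x12a6a26a15a19), ([0x1a26a26a15], 0x1604615c24a15), ([0x1a04a15a04],
  0x1900a04a15a04a04a15a04)]⟩, ⟨1, 2, 1, 4, 0x1604244, [([0x1604], 0x12a62e6604608),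
  ([0x1a26a26a04], 0x1615604c25a04), ([0x1a15a04a15], 0x1910a04a15a15a04a15)]⟩, ⟨1, 0, 1, 1,
  0x1626266, [([0x1626], 0x16044a44e8), ([0x1604c04604, 0x1604c04a04604], 0x1615604c05604),
  ([0x1a15a04a15], 0x1910a04a15a15a04a15)]⟩, ⟨0, 2, 1, 5, 0x1615255, [([0x1615], 0x12a62e6615619),
  ([0x1a26a26a15], 0x1604615c24a15), ([0x1a04a15a04], 0x1900a04a15a04a04a15a04)]⟩, ⟨0, 0, 1, 3,
  0x1626266, [([0x1626], 0x16154a54e9), ([0x1615c15615, 0x1615c15a15615], 0x1604615c14615),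
  ([0x1a04a15a04], 0x1900a04a15a04a04a15a04)]⟩, ⟨0, 0, 1, 3, 0x1626266, [([0x1626], 0x16154a54e9),
  ([0x1615c15615, 0x1615c15a15615], 0x1900604615c14615)]⟩, ⟨1, 0, 1, 1, 0x1626266, [([0x1626],
  0x16044a44e8), ([0x1604c04604, 0x1604c04a04604], 0x1910a04a15615604c05604)]⟩, ⟨0, 0, 1, 3,
  0x1626266, [([0x1626], 0x16154a54e9), ([0x1615c15615, 0x1615c15a15615],
  0x1900a04a15a04604615c14615)]⟩, ⟨1, 0, 1, 1, 0x1626266, [([0x1626], 0x16044a44e8), ([0x1604c04604,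
  0x1604c04a04604], 0x1615604c05a04604), ([0x1a15a04a15], 0x1910a04a15a15a04a15)]⟩, ⟨1, 0, 1, 1,
  0x1626266, [([0x1626], 0x16044a44e8), ([0x1604c04604, 0x1604c04a04604],
  0x1510604c05a04a04a04604)]⟩, ⟨1, 0, 1, 1, 0x1626266, [([0x1626], 0x16044a44e8), ([0x1604c04604,
  0x1604c04a04604], 0x1510604c05a04604)]⟩, ⟨1, 2, 1, 1, 0x1626266, [([0x1626], 0x16046264e4),
  ([0x1a04a26a04], 0x12a6a26a04a08a26a04), ([0x1a26a26a04], 0x1615604c25a04), ([0x1a15a04a15],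
  0x1910a04a15a15a04a15)]⟩, ⟨1, 2, 1, 5, 0x1626266, [([0x1626], 0x12842e662662a), ([0x1a04a26a26],
  0x1615604c25), ([0x1a15a04a15], 0x1910a04a15a15a04a15)]⟩, ⟨0, 0, 1, 3, 0x1626266, [([0x1626],
  0x16154a54e9), ([0x1615c15615, 0x1615c15a15615], 0x1604615c14a15615), ([0x1a04a15a04],
  0x1900a04a15a04a04a15a04)]⟩, ⟨0, 2, 1, 3, 0x1626266, [([0x1626], 0x16156264e5), ([0x1a15a26a15],
  0x12a6a26a15a19a26a15), ([0x1a26a26a15], 0x1604615c24a15), ([0x1a04a15a04],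
  0x1900a04a15a04a04a15a04)]⟩, ⟨0, 0, 1, 3, 0x1626266, [([0x1626], 0x16154a54e9), ([0x1615c15615,
  0x1615c15a15615], 0x1900604615c14a15615)]⟩, ⟨1, 0, 1, 1, 0x1626266, [([0x1626], 0x16044a44e8),
  ([0x1604c04604, 0x1604c04a04604], 0x1910a04a15615604c05a04604)]⟩, ⟨1, 0, 1, 4, 0x1c24a0448604a,
  [([0x1c24a04c06a26], 0x1c0ea26), ([0x1a26a26a04], 0x1615604c25a04), ([0x1a15a04a15],
  0x1910a04a15a15a04a15)]⟩, ⟨0, 2, 1, 5, 0x1626266, [([0x1626], 0x12952e662662a), ([0x1a15a26a26],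
  0x1c25), ([0x1c15615615, 0x1c15a15615615], 0x1604615c14a15615615), ([0x1a04a15a04],
  0x1900a04a15a04a04a15a04)]⟩, ⟨0, 0, 1, 3, 0x1626066, [([0x1a26c26], 0x1a15c15a2e8a5c29),
  ([0x1615c15615, 0x1615c15a15615], 0x1900a04a15a04604615c14a15615)]⟩, ⟨2, 2, 1, 4, 0x1604244,
  [([0x1604], 0x12952e6604608), ([0x1a15a26a04], 0x1920a04a15a26a04)]⟩, ⟨1, 2, 1, 4, 0x1626266,
  [([0x1626], 0x12842e662662a), ([0x1a04a26a26], 0x1910a04a15615604c25)]⟩, ⟨1, 2, 1, 4,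
  0x12a62e6604608244, [([0x1a26a26a04], 0x1615604c25a04), ([0x1a15a04a15], 0x1910a04a15a15a04a15)]⟩,
  ⟨1, 0, 1, 4, 0x1604044, [([0x1a04c04], 0x1615604c25a0488ec0a), ([0x1a15a04a15],
  0x1910a04a15a15a04a15)]⟩, ⟨1, 2, 1, 2, 0x1615255, [([0x1615], 0x1910284a15a152ea)]⟩, ⟨2, 2, 1, 4,
  0x1604244, [([0x1604], 0x12e6), ([0x1a26a04a04], 0x1295a26a04a08), ([0x1a15a26a04],
  0x1920a04a15a26a04)]⟩, ⟨1, 2, 1, 4, 0x1626266, [([0x1626], 0x12842e662662a), ([0x1a04a26a26],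
  0x1c24), ([0x1c04604604, 0x1c04a04604604], 0x1615604c05604604), ([0x1a15a04a15],
  0x1910a04a15a15a04a15)]⟩, ⟨1, 2, 1, 3, 0x1615255, [([0x1615], 0x12e6), ([0x1a26a15a15],
  0x1910284a15a15a2aa15a15)]⟩, ⟨0, 2, 1, 4, 0x1626266, [([0x1626], 0x1900604615c242952e662662a)]⟩,
  ⟨0, 2, 1, 3, 0x1615055, [([0x1a15c15], 0x1c1e), ([0x1a26a15a15], 0x12a6a26a15a19),
  ([0x1a26a26a15], 0x1900604615c24a15)]⟩, ⟨0, 0, 1, 5, 0x1615055, [([0x1a15c15],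
  0x1604615c24a1589ec1a), ([0x1a04a15a04], 0x1900a04a15a04a04a15a04)]⟩, ⟨1, 2, 1, 4,
  0x12a62e6604248, [([0x1a26a26a04], 0x1615604c25a04), ([0x1a15a04a15], 0x1910a04a15a15a04a15)]⟩,
  ⟨0, 0, 1, 5, 0x1c25a1549605a, [([0x1c25a15c16a26], 0x1c1ea26), ([0x1a26a26a15], 0x1604615c24a15),
  ([0x1a04a15a04], 0x1900a04a15a04a04a15a04)]⟩, ⟨2, 2, 1, 1, 0x160404e, [([0x1a04a26a04],
  0x1295a26a04a08a26a04), ([0x1a15a26a04], 0x1920a04a15a26a04)]⟩, ⟨1, 3, 1, 1, 0x1626266,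
  [([0x1626], 0x16046264e4), ([0x1a04a26a04], 0x15106044a5604a26a04a08a26a04)]⟩, ⟨2, 2, 1, 1,
  0x1626266, [([0x1626], 0x16046264e4), ([0x1a04a26a04], 0x1295a26a04a08a26a04), ([0x1a15a26a04],
  0x1920a04a15a26a04)]⟩, ⟨2, 2, 1, 4, 0x1604244, [([0x1604], 0x12e6), ([0x1a26a04a04],
  0x1920a04295a26a04a08)]⟩, ⟨0, 2, 1, 5, 0x12a62e6615619255, [([0x1a26a26a15], 0x1604615c24a15),
  ([0x1a04a15a04], 0x1900a04a15a04a04a15a04)]⟩, ⟨1, 2, 1, 4, 0x1626266, [([0x1626],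
  0x12842e662662a), ([0x1a04a26a26], 0x1c24), ([0x1c04a04604604], 0x1615604c05a04604604),
  ([0x1a15a04a15], 0x1910a04a15a15a04a15)]⟩, ⟨0, 0, 1, 3, 0x1626266, [([0x1626], 0x16154a54e9),
  ([0x1615c15615, 0x1615c15a15615], 0x1900a04a15a04604615c14a15615)]⟩, ⟨1, 2, 1, 5, 0x12842e662626a,
  [([0x1a04a26a26], 0x1615604c25), ([0x1a15a04a15], 0x1910a04a15a15a04a15)]⟩, ⟨0, 2, 1, 5,
  0x1615255, [([0x1615], 0x12a6a152e6619), ([0x1a26a15a26], 0x1900a04a15a04604615c24a15a26)]⟩, ⟨0,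
  0, 1, 3, 0x1626266, [([0x1626], 0x1900a04a15a046046154a44e9)]⟩, ⟨1, 2, 1, 4, 0x12a62e6284,
  [([0x1a26a26a04], 0x1615604c25a04), ([0x1a15a04a15], 0x1910a04a15a15a04a15)]⟩, ⟨0, 0, 1, 3,
  0x1626266, [([0x1626], 0x19006046154a44e9)]⟩, ⟨1, 0, 1, 1, 0x1626266, [([0x1626],
  0x1910a04a156156044a54e8)]⟩, ⟨0, 0, 1, 2, 0x1626266, [([0x1626], 0x16046154a44e9),
  ([0x1a04a15a04], 0x1900a04a15a04a04a15a04)]⟩, ⟨1, 2, 1, 4, 0x1626266, [([0x1626],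
  0x12842e662662a), ([0x1a04a26a26], 0x1910a04a15615604c05604604c24)]⟩, ⟨1, 0, 1, 1, 0x1626266,
  [([0x1626], 0x15106044a54e8626)]⟩, ⟨1, 0, 1, 4, 0x1604044, [([0x1a04c04],
  0x1615604c05604604c24a0488ec0a), ([0x1a15a04a15], 0x1910a04a15a15a04a15)]⟩, ⟨1, 0, 1, 1,
  0x1626266, [([0x1626], 0x1510604c056046044a44e8)]⟩, ⟨1, 2, 1, 5, 0x1626266, [([0x1626],
  0x1910a04a15a15284a1561562a4e5)]⟩, ⟨0, 0, 1, 5, 0x1615055, [([0x1a15c15],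
  0x1604615c14615615c25a1589ec1a), ([0x1a04a15a04], 0x1900a04a15a04a04a15a04)]⟩, ⟨1, 0, 1, 0,
  0x1626266, [([0x1626], 0x16156044a54e8), ([0x1a15a04a15], 0x1910a04a15a15a04a15)]⟩, ⟨0, 0, 1, 2,
  0x1626066, [([0x1a26c26], 0x1604a15c14a2e8a5c29), ([0x1a04a15a04], 0x1900a04a15a04a04a15a04)]⟩,
  ⟨1, 3, 1, 4, 0x1626066, [([0x1a26c26], 0x1510a0448562ec24a26c2a)]⟩, ⟨1, 3, 1, 4, 0x1626266,
  [([0x1626], 0x1510604485604a0460462a4e4)]⟩, ⟨1, 2, 1, 4, 0x12842e62a6, [([0x1a04a26a26],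
  0x1910a04a15615604c25)]⟩, ⟨1, 2, 1, 4, 0x1284a26c2e62a066, [([0x1a04a26a26], 0x1615604c25),
  ([0x1a15a04a15], 0x1910a04a15a15a04a15)]⟩, ⟨1, 0, 1, 4, 0x1615604c05604604c24a0448e04a,
  [([0x1a15a04a15], 0x1910a04a15a15a04a15)]⟩, ⟨2, 2, 1, 4, 0x12952e6284, [([0x1a15a26a04],
  0x1920a04a15a26a04)]⟩, ⟨1, 0, 1, 5, 0x1c2ea0448604a, [([0x1a26a04a26], 0x1615604c25a04a26),
  ([0x1a15a04a15], 0x1910a04a15a15a04a15)]⟩, ⟨1, 3, 1, 1, 0x12a6484244, [([0x1a26c24a04c06],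
  0x1510604c25a04c0e)]⟩, ⟨0, 2, 1, 5, 0x12a62e6615259, [([0x1a26a26a15], 0x1900604615c24a15)]⟩, ⟨1,
  0, 1, 1, 0x1a04a264ae068, [([0x1a04a26a26], 0x1910a04a15615604c25)]⟩, ⟨1, 2, 1, 4,
  0x12a62e6604248, [([0x1a26a26a04], 0x1910a04a15615604c25a04)]⟩, ⟨1, 0, 1, 4, 0x1604044,
  [([0x1a04c04], 0x1910a04a15615604c25a0488ec0a)]⟩, ⟨0, 0, 1, 5, 0x1615055, [([0x1a15c15],
  0x1900a04a15a04604615c24a1589ec1a)]⟩, ⟨0, 0, 1, 5, 0x1604615c14615615c25a1549e05a,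
  [([0x1a04a15a04], 0x1900a04a15a04a04a15a04)]⟩, ⟨1, 0, 1, 0, 0x1626066, [([0x1a26c26],
  0x1a04a268aec28), ([0x1a04a26a26], 0x1615604c25), ([0x1a15a04a15], 0x1910a04a15a15a04a15)]⟩, ⟨1,
  2, 1, 5, 0x1626266, [([0x1626], 0x1910284a1561562a4e5)]⟩, ⟨2, 2, 1, 2, 0x1284a15c1e619055,
  [([0x1a04a15a26], 0x1920a04a15a26a04a15a26)]⟩, ⟨0, 2, 1, 3, 0x12a6a26a1561905e, [([0x1a26a26a15],
  0x1900a04a15a04604615c24a15)]⟩, ⟨0, 0, 1, 3, 0x1c1ea264a5069, [([0x1a26a26a15],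
  0x1900604615c24a15)]⟩, ⟨0, 2, 1, 5, 0x12a62e6295, [([0x1a26a26a15], 0x1604615c24a15),
  ([0x1a04a15a04], 0x1900a04a15a04a04a15a04)]⟩, ⟨0, 0, 1, 4, 0x1604615c24a1549e05a,
  [([0x1a04a15a04], 0x1900a04a15a04a04a15a04)]⟩, ⟨2, 2, 1, 4, 0x12e6244, [([0x1a26a04a04],
  0x1920a04295a26a04a08)]⟩, ⟨0, 0, 1, 4, 0x1604a15c14a2ec25a1549605a, [([0x1a04a15a04],
  0x1900a04a15a04a04a15a04)]⟩, ⟨2, 2, 1, 2, 0x1920a04a15a26284a15c1e619055, []⟩, ⟨1, 2, 1, 4,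
  0x12842e62a6, [([0x1a04a26a26], 0x1910a04a15a15a04a15615604c25)]⟩, ⟨1, 0, 1, 4,
  0x1910a04a15615604c25a0448e04a, []⟩, ⟨1, 0, 1, 4, 0x1910a04a15615604c05604604c24a0448e04a, []⟩,
  ⟨1, 0, 1, 4, 0x1604044, [([0x1a04c04], 0x1910a04a15615604c05604604c24a0488ec0a)]⟩, ⟨0, 0, 1, 4,
  0x1900a04a15a04604615c24a1549e05a, []⟩, ⟨0, 0, 1, 5, 0x1900a04a15a04604615c14615615c25a1549e05a,
  []⟩, ⟨0, 0, 1, 5, 0x1615055, [([0x1a15c15], 0x1900a04a15a04604615c14615615c25a1589ec1a)]⟩, ⟨1, 0,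
  1, 5, 0x1910a04a15a15a04a15615604c25a0448e04a, []⟩, ⟨1, 0, 1, 1, 0x1510604c25a04a264ae068, []⟩,
  ⟨0, 0, 1, 2, 0x1900604a15c14a2e4a5069, []⟩, ⟨1, 2, 1, 5, 0x1910a04a15a15284a1561562a4e5266, []⟩,
  ⟨1, 3, 1, 1, 0x1510604c25a042a648e244, []⟩, ⟨1, 3, 1, 4, 0x1510604c25a042a6626a042e6248, []⟩, ⟨0,
  2, 1, 4, 0x1900604615c242952e662626a, []⟩, ⟨0, 0, 1, 2, 0x1900a04a15a04604a15c14a2e4a5069, []⟩,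
  ⟨0, 0, 1, 2, 0x1900a04a15a04604a15c14a2e8a5c29626066, []⟩, ⟨1, 0, 1, 0,
  0x1910a04a15615604c25a04c0ea264a4068, []⟩, ⟨0, 2, 1, 5, 0x12952e62a6, [([0x1a15a26a26],
  0x1900a04a15a04604615c24)]⟩]

/-- The lengths in `oddCodes`, with the vectors that may be added. -/
def oddLengths : List (Vec × List Vec) := [
  ((7, 16, 10), [(0, 2, 4), (2, 4, 0), (4, 2, 0), (0, 2, 0)]), ((7, 16, 12), [(0, 2, 4), (2, 4, 0),
  (4, 2, 0), (0, 2, 0)]), ((5, 16, 10), [(0, 2, 4), (4, 2, 0), (0, 2, 0)]), ((13, 6, 10), [(8, 0,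
  0), (2, 0, 4), (6, 0, 0), (0, 2, 0)]), ((5, 16, 12), [(0, 2, 4), (4, 2, 0), (0, 2, 0)]), ((13, 6,
  12), [(8, 0, 0), (2, 0, 4), (6, 0, 0), (0, 2, 0)]), ((9, 6, 4), [(8, 0, 0), (6, 0, 0), (0, 2,
  0)]), ((11, 6, 6), [(8, 0, 0), (6, 0, 0), (0, 2, 0)]), ((11, 6, 8), [(8, 0, 0), (6, 0, 0), (0, 2,
  0)]), ((15, 6, 10), [(8, 0, 0), (2, 0, 4), (6, 0, 0), (0, 2, 0)]), ((15, 6, 2), [(8, 0, 0), (6, 0,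
  0), (0, 2, 0)]), ((11, 6, 2), [(8, 0, 0), (6, 0, 0), (0, 2, 0)]), ((17, 14, 10), [(2, 0, 4), (2,
  4, 0), (4, 2, 0), (0, 2, 0)]), ((11, 10, 8), [(0, 4, 2), (4, 0, 2), (2, 0, 0)]), ((15, 6, 12),
  [(8, 0, 0), (2, 0, 4), (6, 0, 0), (0, 2, 0)]), ((17, 14, 12), [(2, 0, 4), (2, 4, 0), (4, 2, 0),
  (0, 2, 0)]), ((11, 6, 4), [(8, 0, 0), (6, 0, 0), (0, 2, 0)]), ((13, 6, 6), [(8, 0, 0), (6, 0, 0),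
  (0, 2, 0)]), ((7, 14, 10), [(4, 4, 0), (0, 2, 4), (4, 2, 0)]), ((11, 16, 12), [(0, 8, 0), (0, 2,
  4), (0, 6, 0), (4, 2, 0), (2, 0, 0)]), ((15, 8, 8), [(8, 0, 0), (6, 0, 0), (0, 4, 0)]), ((5, 12,
  4), [(2, 2, 2), (0, 2, 0)]), ((11, 6, 6), [(4, 2, 0), (2, 0, 0)]), ((5, 14, 10), [(0, 2, 4), (4,
  2, 0)]), ((3, 14, 10), [(0, 2, 4), (0, 4, 0)]), ((9, 2, 2), [(2, 0, 0)]), ((7, 12, 4), [(2, 2, 2),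
  (2, 4, 0), (0, 2, 0)]), ((11, 14, 10), [(0, 8, 0), (0, 2, 4), (0, 6, 0), (4, 2, 0), (2, 0, 0)]),
  ((13, 4, 2), [(4, 2, 0), (2, 0, 0)]), ((11, 4, 4), [(2, 0, 0)]), ((13, 6, 4), [(2, 4, 0), (4, 2,
  0), (4, 0, 0)]), ((3, 14, 12), [(0, 2, 4), (0, 4, 0)]), ((5, 12, 10), [(0, 2, 4), (4, 2, 0)]),
  ((7, 14, 12), [(4, 4, 0), (0, 2, 4), (4, 2, 0)]), ((13, 8, 4), [(2, 2, 2), (4, 2, 0)]), ((13, 12,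
  2), [(4, 2, 0), (0, 2, 0)]), ((13, 14, 4), [(2, 2, 2), (4, 2, 0), (0, 2, 0)]), ((5, 10, 2), [(2,
  4, 0), (0, 2, 0)]), ((5, 14, 12), [(0, 2, 4), (4, 2, 0)]), ((11, 16, 10), [(0, 8, 0), (0, 2, 4),
  (4, 2, 0), (2, 0, 0)]), ((13, 6, 8), [(8, 0, 0), (6, 0, 0), (0, 2, 0)]), ((7, 10, 8), [(0, 4, 2),
  (4, 0, 2)]), ((7, 14, 8), [(4, 2, 0), (0, 2, 0)]), ((5, 6, 8), [(0, 2, 0)]), ((5, 10, 10), [(0, 2,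
  4), (4, 2, 0)]), ((3, 6, 4), [(0, 2, 0)]), ((5, 6, 6), [(0, 2, 0)]), ((7, 12, 6), [(2, 4, 0), (0,
  0, 2)]), ((11, 12, 6), [(4, 2, 0), (2, 0, 0)]), ((3, 8, 2), [(0, 2, 0)]), ((3, 20, 10), [(0, 2,
  4), (0, 4, 0)]), ((9, 6, 2), [(0, 2, 0)]), ((7, 10, 4), [(2, 0, 0)]), ((3, 20, 12), [(0, 2, 4),
  (0, 4, 0)]), ((7, 10, 6), [(2, 4, 0), (0, 0, 2)]), ((9, 12, 8), [(2, 4, 0), (0, 0, 4)]), ((11, 4,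
  2), [(4, 0, 0)]), ((7, 10, 2), [(2, 0, 0)]), ((5, 6, 6), [(4, 2, 0)]), ((9, 8, 10), [(0, 2, 4),
  (4, 2, 0)]), ((3, 16, 10), [(0, 2, 4)]), ((5, 6, 4), [(2, 2, 2)]), ((7, 10, 12), [(0, 4, 2), (4,
  0, 2)]), ((9, 4, 2), [(4, 4, 0)]), ((5, 8, 4), [(4, 2, 0)]), ((7, 6, 6), [(2, 4, 0)]), ((5, 10,
  6), [(4, 2, 0)]), ((3, 12, 6), [(0, 4, 0)]), ((3, 12, 8), [(0, 4, 0)]), ((3, 16, 12), [(0, 2,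
  4)]), ((9, 10, 10), [(2, 0, 4), (2, 4, 0), (0, 0, 4)]), ((7, 6, 2), [(2, 0, 0)]), ((11, 6, 6),
  [(2, 2, 2)]), ((11, 6, 8), [(2, 4, 0)]), ((7, 6, 4), [(2, 4, 0)]), ((5, 10, 12), [(0, 2, 4), (4,
  2, 0)]), ((3, 12, 10), [(0, 4, 2)]), ((5, 8, 2), [(2, 4, 0)]), ((5, 12, 12), [(0, 4, 2)]), ((9, 4,
  4), []), ((5, 8, 10), [(4, 2, 0)]), ((3, 8, 6), []), ((3, 14, 6), []), ((3, 18, 6), [(0, 4, 0)]),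
  ((3, 8, 8), []), ((3, 14, 8), []), ((3, 18, 8), [(0, 4, 0)]), ((3, 10, 10), []), ((5, 6, 2), []),
  ((5, 4, 4), []), ((5, 10, 4), []), ((7, 4, 2), []), ((7, 8, 2), []), ((7, 4, 4), []), ((7, 8, 4),
  []), ((7, 8, 8), []), ((9, 6, 6), []), ((5, 6, 8), [(4, 2, 0)])]

/-- Colours and legs of small labelings with an odd number of edges. -/
def oddExplicit : List (List ℕ × List ℕ × List ℕ × List ℕ) := [
  ([4, 6, 7, 9], [5, 2, 7], [1, 6], [3, 4]), ([7, 8, 9, 11], [6, 2, 9], [4, 5, 3, 8], [1, 7]), ([5,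
  10, 11, 13], [8, 3, 10], [1, 9, 2, 11], [4, 7, 6, 5]), ([4, 10, 11, 13], [9, 2, 11], [3, 8, 5, 6,
  7, 4], [1, 10]), ([10, 14, 15, 17], [8, 7, 10], [6, 9, 5, 12, 2, 15], [3, 11, 4, 13, 1, 14]), ([9,
  18, 19, 22], [15, 4, 18], [6, 13, 5, 14, 8, 11, 7, 12, 10, 9], [1, 17, 2, 16, 3, 19]), ([13, 20,
  21, 23], [11, 10, 13], [3, 17, 6, 14, 7, 16, 4, 19, 1, 20], [9, 12, 8, 15, 5, 18, 2, 21]), ([17,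
  26, 27, 30], [14, 13, 17], [4, 22, 5, 21, 9, 18, 8, 19, 7, 23, 3, 27], [12, 15, 11, 16, 10, 20, 6,
  24, 2, 25, 1, 26]), ([14, 30, 31, 34], [13, 17, 14], [20, 11, 19, 15, 16, 18, 12, 22, 8, 23, 7,
  27, 3, 31], [1, 29, 2, 28, 6, 24, 10, 21, 9, 25, 5, 26, 4, 30]), ([5, 8, 9, 12], [7, 2, 6, 3, 9],
  [1, 8], [4, 5]), ([9, 10, 11, 13], [7, 3, 8, 2, 11], [5, 6, 4, 9], [1, 10]), ([9, 10, 11, 13], [5,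
  6, 7, 3, 8, 2, 11], [1, 10], [4, 9]), ([18, 34, 35, 37], [23, 12, 25, 10, 27, 7, 30, 4, 33, 1,
  34], [3, 31, 6, 28, 9, 26, 8, 29, 5, 32, 2, 35], [11, 24, 13, 22, 15, 19, 16, 21, 14, 20, 17,
  18])]

/-- The lengths in `oddExplicit`. -/
def oddSmall : List Vec := [
  (3, 2, 2), (3, 4, 2), (3, 4, 4), (3, 6, 2), (3, 6, 6), (3, 10, 6), (3, 10, 8), (3, 12, 12), (3,
  14, 14), (5, 2, 2), (5, 4, 2), (7, 2, 2), (11, 12, 12)]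

/-- For odd q, the choice A = 2 makes K = q + A odd; the colours are q + 2, q, q - 1 and a leaf
label. -/
theorem valid_oddLengths : ∀ p ∈ oddLengths, Valid p :=
  valid_of_checkCodes (A := 2) (l := oddCodes) (by decide +kernel)

theorem valid_oddSmall : ∀ p ∈ oddSmall.map fun v => (v, ([] : List Vec)), Valid p :=
  valid_of_checkExplicit (l := oddExplicit) (by decide +kernel)

def oddAll : List (Vec × List Vec) := oddLengths ++ oddSmall.map fun v => (v, [])

theorem valid_oddAll : ∀ p ∈ oddAll, Valid p := fun p hp =>
  (List.mem_append.1 hp).elim (valid_oddLengths p) (valid_oddSmall p)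

/-! ### Certificates for an even number of edges. -/

/-- Families for an even number of edges. -/
def evenCodes : List Code := [
  ⟨1, 3, 2, 2, 0x1a15255255, [([0x1a15a15], 0x1a15), ([0x1615615615c15], 0x1604615615c14),
  ([0x1a04a15a15a04], 0x12a6615a04a15a15a08), ([0x1a26a15a04a15], 0x18e0910a04a15a26a15a04a15)]⟩,
  ⟨0, 3, 2, 1, 0x1a26266266, [([0x1a26a26], 0x1a26), ([0x1626626626c26], 0x1615626626c25),
  ([0x1a15a26a26a15], 0x12a6626a15a26a26a19), ([0x1a26a26a15a26], 0x1604615626c24a15a26),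
  ([0x1a04a15a26a04], 0x18e4a04), ([0x1c14a04a04c05a15a04c04a04a15],
  0x1c10900a04c05a15a04c04a04a15)]⟩, ⟨2, 0, 2, 0, 0x1a04244244, [([0x1a04a04], 0x1a04),
  ([0x1604604604c04], 0x1615485604c09), ([0x1615c15a04a15615615604c15615604,
  0x1615c05604615604c14615604, 0x1615c15a04a15615615604c05a15a04604604615c04604615604c14615604],
  0x1c14615604), ([0x1c04a15a04604604615c04604615604], 0x1604615604), ([0x1a04a15a04a04],
  0x1626604615c06), ([0x1a26a04a15a26], 0x18e0920a04a15a26a26a04a15a26)]⟩, ⟨2, 3, 2, 0,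
  0x1a15255255, [([0x1a15a15], 0x1a15), ([0x1615615615c15], 0x1604615615c14), ([0x1a04a15a15a04],
  0x1284604a15a04a04a19a15a04), ([0x1a04a04a15a04], 0x1626604615c06a04a15a04), ([0x1a26a04a15a26],
  0x18e4a04a15a26), ([0x1c24a04a15c16a26a04c05a15a26], 0x1c10920a04c05a15a26)]⟩, ⟨0, 3, 1, 0,
  0x1a15255255, [([0x1a15a15], 0x1a15), ([0x1615615615c15], 0x1626615615c16), ([0x1a26a15a15a26],
  0x12a6a26a26a15a19a26), ([0x1a26a26a26a15], 0x1a26a15), ([0x1626615626c26a15a26626626615c26,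
  0x1626615626c16615626615c25], 0x1604626615c24), ([0x1a04a26a15a04], 0x18e5a15a04),
  ([0x1c05a15a04c04a04a15c14a04a04], 0x1900c00a04a15c14a04a04)]⟩, ⟨2, 3, 2, 2, 0x1a15255255,
  [([0x1a15a15], 0x1a15), ([0x1615615615c15], 0x1604615615c14), ([0x1a04a15a15a04],
  0x1295615a04a15a15a08), ([0x1a15a15a04a15], 0x1c14a15a04a15), ([0x1c14615604615c05604615604,
  0x1c04a15a04604604615c04604615604], 0x1604615604), ([0x1a04a15a04a04], 0x1626604615c06),
  ([0x1a26a04a15a26], 0x18e4a04a15a26), ([0x1c24a04a15c16a26a04c05a15a26], 0x1c10920a04c05a15a26)]⟩,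
  ⟨0, 3, 2, 0, 0x1a04244244, [([0x1a04a04], 0x1a04), ([0x1604604604c04], 0x1615604604c05),
  ([0x1a15a04a04a15], 0x12a6615a04a04a15a19a04a04a15), ([0x1a26a15a04a04],
  0x1c10900a048e5a15a04a04)]⟩, ⟨1, 0, 1, 3, 0x1a26266266, [([0x1a26a26], 0x1a26),
  ([0x1626626626c26], 0x16046264a6c28), ([0x1604626c26a04a26626626604c26626,
  0x1604626c06604626604c24626], 0x1626), ([0x1a26a04a26a26], 0x1615626604c25), ([0x1a15a26a04a15],
  0x18e4a04a15), ([0x1c14a04a15c15a15a04c05a15a15], 0x1910c10a04a15c15a15a04c05a15a15)]⟩, ⟨2, 0, 1,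
  0, 0x1a04244244, [([0x1a04a04], 0x1a04), ([0x1604604604c04], 0x1615604484c09),
  ([0x1615604c14615604615c05604, 0x1615604c04a15a04604604615c04604,
  0x1615604c14615604615c15a04a15615615604c05a15a04604604615c04604], 0x1604), ([0x1a04a15a04a04],
  0x1626604615c06), ([0x1a26a04a15a26], 0x18e4a04a15a26), ([0x1c24a04a15c16a26a04c05a15a26],
  0x1920c20a04a15c16a26a04c05a15a26)]⟩, ⟨0, 0, 1, 1, 0x1a26266266, [([0x1a26a26], 0x1a26),
  ([0x1626626626c26], 0x16156264a6c29), ([0x1615626c26a15a26626626615c26626,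
  0x1615626c16615626615c25626], 0x1626), ([0x1a26a15a26a26], 0x1604626615c24), ([0x1a04a26a15a04],
  0x18e5a15a04), ([0x1c05a15a04c04a04a15c14a04a04], 0x1900c00a04a15c14a04a04)]⟩, ⟨2, 3, 2, 0,
  0x1a04244244, [([0x1a04a04], 0x1a04), ([0x1604604604c04], 0x1615604604c05), ([0x1a15a04a04a15],
  0x1284604a15a04a04a19), ([0x1a04a04a15a04], 0x1c05a15a04), ([0x1c15615604615c15a04a15615615604,
  0x1c05a15a04604604615c14a04a15615615604], 0x1615615604), ([0x1a15a15a04a15],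
  0x1626604615c16a04a15), ([0x1a26a04a15a26], 0x18e4a04a15a26), ([0x1c24a04a15c16a26a04c05a15a26],
  0x1c10920a04c05a15a26)]⟩, ⟨2, 0, 2, 2, 0x1a15255255, [([0x1a15a15], 0x1a15), ([0x1615615615c15],
  0x1604495615c18), ([0x1604c15615604615c15a04a15615615, 0x1604c05a15a04604604615c14a04a15615615],
  0x1615615), ([0x1a15a15a04a15], 0x1626604615c16a04a15), ([0x1a26a04a15a26], 0x18e4a04a15a26),
  ([0x1c24a04a15c16a26a04c05a15a26], 0x1c10920a04c05a15a26)]⟩, ⟨0, 3, 2, 1, 0x1615626626c25266266,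
  [([0x1a15a26a26a15], 0x12a6626a15a26a26a19), ([0x1a26a26a15a26], 0x1604615626c24a15a26),
  ([0x1a04a15a26a04], 0x18e4a04), ([0x1c14a04a04c05a15a04c04a04a15],
  0x1c10900a04c05a15a04c04a04a15)]⟩, ⟨0, 3, 2, 0, 0x1a15255255, [([0x1a15a15], 0x1a15),
  ([0x1615615615c15], 0x12a6626a15a26626619615c16), ([0x1a26a26a15a26], 0x1604615626c24a15a26),
  ([0x1a04a15a26a04], 0x18e4a04), ([0x1c14a04a04c05a15a04c04a04a15],
  0x1c10900a04c05a15a04c04a04a15)]⟩, ⟨0, 3, 2, 0, 0x1a15255255, [([0x1a15a15], 0x1a15),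
  ([0x1615615615c15], 0x1604615615c14), ([0x1a04a15a15a04], 0x12a6615a04a04a15a19a04),
  ([0x1a26a15a04a04], 0x1c10900a048e5a15a04a04)]⟩, ⟨2, 3, 2, 0, 0x1a15255255, [([0x1a15a15],
  0x1a15), ([0x1615615615c15], 0x1284604a15a04604619615c14), ([0x1a04a04a15a04],
  0x1626604615c06a04a15a04), ([0x1a26a04a15a26], 0x18e4a04a15a26),
  ([0x1c24a04a15c16a26a04c05a15a26], 0x1c10920a04c05a15a26)]⟩, ⟨0, 3, 1, 0, 0x1a15255266,
  [([0x1a15a15a26a26], 0x1295a15a15a26a2a), ([0x1a15a15a15a26], 0x1a15a26),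
  ([0x1615626615c25626615626c16, 0x1615626615c15a26a15615615626c15], 0x1c16),
  ([0x1c26a15a26626626615c26626615626], 0x1626615626), ([0x1a26a15a26a26], 0x1604626615c24),
  ([0x1a04a26a15a04], 0x18e5a15a04), ([0x1c05a15a04c04a04a15c14a04a04], 0x1900c00a04a15c14a04a04)]⟩,
  ⟨0, 3, 1, 0, 0x1a15255255, [([0x1a15a15], 0x1a15), ([0x1615615615c15], 0x1604615615c14),
  ([0x1a04a15a15a04], 0x12a6a04a04a15a19a04), ([0x1a26a04a04a15], 0x1900c00a04a158e4a04a04a15)]⟩,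
  ⟨1, 3, 1, 2, 0x1626604604c06244244, [([0x1a26a04a04a26], 0x12a6a04a26a26a08a04a26),
  ([0x1a26a04a26a26], 0x1a26), ([0x1626626604c06a26a04604604626c24a04a26], 0x1615604626c25a04a26),
  ([0x1a15a04a26a15], 0x18e5a15), ([0x1c05a15a15c14a04a15c15a15a04], 0x1910c10a04a15c15a15a04)]⟩,
  ⟨2, 0, 1, 2, 0x1a15255255, [([0x1a15a15], 0x1a15), ([0x1615615615c15], 0x1604615495c18),
  ([0x1604615c15a04a15615615604c15615, 0x1604615c05604615604c14615], 0x1615), ([0x1a15a04a15a15],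
  0x1c14), ([0x1c04a15a04604604615c04604615604], 0x1604615604), ([0x1a04a15a04a04],
  0x1626604615c06), ([0x1a26a04a15a26], 0x18e4a04a15a26), ([0x1c24a04a15c16a26a04c05a15a26],
  0x1920c20a04a15c16a26a04c05a15a26)]⟩, ⟨2, 3, 1, 0, 0x1a15255255, [([0x1a15a15], 0x1a15),
  ([0x1615615615c15], 0x1284a04604615619c14), ([0x1a04a04a04a15], 0x1a04a15),
  ([0x1604615604c14615604615c05, 0x1604615604c04a15a04604604615c04,
  0x1604615604c14615604615c15a04a15615615604c05a15a04604604615c04], 0x1626604615c06),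
  ([0x1a26a04a15a26], 0x19208e0a04a15a26a26a04a15a26)]⟩, ⟨1, 3, 2, 3, 0x1604626626c24266266,
  [([0x1a04a26a26a04], 0x12a6626a04a26a26a08), ([0x1a26a26a04a26], 0x1615604626c25a04a26),
  ([0x1a15a04a26a15], 0x18e5a15), ([0x1c05a15a15c14a04a15c15a15a04],
  0x1c10910a04c05a15a15c14a04a15c15a15a04)]⟩, ⟨2, 0, 1, 2, 0x1a15255255, [([0x1a15a15], 0x1a15),
  ([0x1615615615c15], 0x1604615495c18), ([0x1604615c15a04a15615615604c15615,
  0x1604615c05604615604c14615], 0x1615), ([0x1a15a04a15a15], 0x1c14),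
  ([0x1c04a15a04604604615c04604615604], 0x1604615604), ([0x1a04a15a04a04], 0x1626604615c06),
  ([0x1a26a04a15a26], 0x19208e0a04a15a26a26a04a15a26)]⟩, ⟨1, 0, 1, 3, 0x1a26266266, [([0x1a26a26],
  0x1a26), ([0x1626626626c26], 0x16156046264a5c28), ([0x1a15a04a26a15], 0x18e5a15),
  ([0x1c05a15a15c14a04a15c15a15a04], 0x1910c10a04a15c15a15a04)]⟩, ⟨0, 3, 2, 0,
  0x1626615615c16255255, [([0x1a26a15a15a26], 0x12a6626a15a26a26a19a15a26), ([0x1a26a26a15a26],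
  0x1604615626c24a15a26), ([0x1a04a15a26a04], 0x18e4a04), ([0x1c14a04a04c05a15a04c04a04a15],
  0x1c10900a04c05a15a04c04a04a15)]⟩, ⟨2, 0, 2, 1, 0x1a04244244, [([0x1a04a04], 0x1a04),
  ([0x1604604604c04], 0x1626604615486604c09), ([0x1a26a04a15a26], 0x18e0920a04a15a26a26a04a15a26)]⟩,
  ⟨2, 0, 2, 0, 0x1a04244244, [([0x1a04a04], 0x1a04), ([0x1604604604c04], 0x1615485604c09),
  ([0x1615c15a04a15615615604c15615604], 0x1c14615604), ([0x1c04a15a04604604615c04604615604],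
  0x1604615604), ([0x1a04a15a04a04], 0x1626604615c06), ([0x1a26a04a15a26], 0x18e4a04a15a26),
  ([0x1c24a04a15c16a26a04c05a15a26], 0x1c10920a04c05a15a26)]⟩, ⟨0, 0, 1, 0, 0x1a26266266,
  [([0x1a26a26], 0x1c156154a5c298e5), ([0x1c15615, 0x1c15a15c15a15a15c15a15615,
  0x1c15a15c15615615c15c15a15615], 0x1615), ([0x1a15c15a15a15c15615615c15c15a15], 0x1604c15615c14),
  ([0x1a04c05a15a04c04a04a15c14a04], 0x1900c00a04a15c14a04)]⟩, ⟨1, 0, 2, 3, 0x1a26266266,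
  [([0x1a26a26], 0x1a26), ([0x1626626626c26], 0x16156266044a5626c28), ([0x1a15a26a04a15],
  0x18e4a04a15), ([0x1c14a04a15c15a15a04c05a15a15], 0x1c10910a04c05a15a15)]⟩, ⟨2, 3, 2, 2,
  0x1a15255255, [([0x1a15a15], 0x1a15), ([0x1615615615c15], 0x1604615615c14), ([0x1a04a15a15a04],
  0x1295615a04a15a15a08), ([0x1a15a15a04a15], 0x1c14a15a04a15), ([0x1c14615604615c05604615604,
  0x1c04a15a04604604615c04604615604], 0x1604615604), ([0x1a04a15a04a04], 0x1626604615c06),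
  ([0x1a26a04a15a26], 0x18e0920a04a15a26a26a04a15a26)]⟩, ⟨2, 0, 1, 0, 0x1615604484c09244244,
  [([0x1615604c14615604615c05604, 0x1615604c04a15a04604604615c04604,
  0x1615604c14615604615c15a04a15615615604c05a15a04604604615c04604], 0x1604), ([0x1a04a15a04a04],
  0x1626604615c06), ([0x1a26a04a15a26], 0x18e4a04a15a26), ([0x1c24a04a15c16a26a04c05a15a26],
  0x1920c20a04a15c16a26a04c05a15a26)]⟩, ⟨2, 0, 2, 3, 0x1a15255255, [([0x1a15a15], 0x1a15),
  ([0x1615615615c15], 0x1626615615c16), ([0x1a26a15a15a26], 0x1a04a15896a268e8a15a15a26),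
  ([0x1a04a15c16a26a04c05a15a26c24], 0x1c10920a04c05a15a26c24)]⟩, ⟨0, 0, 1, 1, 0x1a26266266,
  [([0x1a26a26], 0x1a26), ([0x1626626626c26], 0x1615626626c25), ([0x1a15a26a26a15],
  0x1604c15a158a48e9a15), ([0x1a04c05a15a04c04a04a15c14a04], 0x1900c00a04a15c14a04)]⟩, ⟨2, 3, 2, 2,
  0x1a15255255, [([0x1a15a15], 0x1a15), ([0x1615615615c15], 0x1604615615c14), ([0x1a04a15a15a04],
  0x1295615a04a15a15a08), ([0x1a15a15a04a15], 0x14e4604615c16a04a15),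
  ([0x1c24a04a15c16a26a04c05a15a26], 0x1c10920a04c05a15a26)]⟩, ⟨2, 0, 2, 1, 0x1a04244244,
  [([0x1a04a04], 0x1a04), ([0x1604604604c04], 0x1626604615486604c09), ([0x1a26a04a15a26],
  0x18e4a04a15a26), ([0x1c24a04a15c16a26a04c05a15a26], 0x1c10920a04c05a15a26)]⟩, ⟨2, 0, 2, 0,
  0x1615485604c09244244, [([0x1615c15a04a15615615604c15615604, 0x1615c05604615604c14615604,
  0x1615c15a04a15615615604c05a15a04604604615c04604615604c14615604], 0x1615604), ([0x1a15a04a15a15],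
  0x1c14), ([0x1c04a15a04604604615c04604615604], 0x1604615604), ([0x1a04a15a04a04],
  0x1626604615c06), ([0x1a26a04a15a26], 0x18e0920a04a15a26a26a04a15a26)]⟩, ⟨0, 0, 1, 0,
  0x1a26266266, [([0x1a26a26], 0x1a26), ([0x1626626626c26], 0x16156264a6c29),
  ([0x1615626c26a15a26626626615c26626, 0x1615626c16615626615c25626], 0x1626), ([0x1a26a15a26a26],
  0x1c25), ([0x1c15a26a15615615626c15615626615], 0x14e5615), ([0x1c15615,
  0x1c15a15c15a15a15c15a15615], 0x1615), ([0x1a15c15a15a15c15615615c15c15a15], 0x1604615c14c14a15),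
  ([0x1a04a15c14a04a04c05a15a04c04], 0x1900c00a04a15c14a04a04c05a15a04c04)]⟩, ⟨2, 0, 1, 3,
  0x1a15255255, [([0x1a15a15], 0x1a15), ([0x1615615615c15], 0x1626604615496c18), ([0x1a26a04a15a26],
  0x19208e0a04a15a26a26a04a15a26)]⟩, ⟨0, 3, 2, 0, 0x1a26266266, [([0x1a26a26],
  0x18a5a15a15615626c298e5), ([0x1c15a15a15c15a15a15c15a15a15, 0x1c15a15a15c15615615c15c15a15a15],
  0x1a15), ([0x1615c15, 0x1615c15a15c15a15a15c15a15], 0x1604615c14c14a15),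
  ([0x1a04a15c14a04a04c05a15a04c04], 0x1c10900a04c05a15a04c04)]⟩, ⟨0, 3, 2, 0, 0x1a26266266,
  [([0x1a26a26], 0x18a5a15a15615626c298e5), ([0x1c15a15a15c15615615c15c15a15a15], 0x1a15),
  ([0x1615c15, 0x1615c15a15c15a15a15c15a15], 0x1604c15615c14), ([0x1a04c05a15a04c04a04a15c14a04],
  0x1c10900a04c05a15a04c04a04a15c14a04)]⟩, ⟨2, 0, 1, 1, 0x1a04244244, [([0x1a04a04], 0x1a04),
  ([0x1604604604c04], 0x1615604484c09), ([0x1615604c14615604615c05604,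
  0x1615604c04a15a04604604615c04604], 0x1604), ([0x1a04a15a04a04], 0x1626604615c06),
  ([0x1a26a04a15a26], 0x19208e0a04a15a26a26a04a15a26)]⟩, ⟨1, 3, 2, 2, 0x12a6604284244,
  [([0x1a26a04a04a04], 0x1c06a04), ([0x1c26a04a26626626604c26626604626,
  0x1c06604626604c24626604626], 0x1626604626), ([0x1a26a04a26a26], 0x1615626604c25),
  ([0x1a15a26a04a15], 0x18e4a04a15), ([0x1c14a04a15c15a15a04c05a15a15], 0x1c10910a04c05a15a15)]⟩,
  ⟨0, 0, 1, 1, 0x16156264a6c29266266, [([0x1615626c26a15a26626626615c26626,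
  0x1615626c16615626615c25626], 0x1626), ([0x1a26a15a26a26], 0x1604626615c24), ([0x1a04a26a15a04],
  0x18e5a15a04), ([0x1c05a15a04c04a04a15c14a04a04], 0x1900c00a04a15c14a04a04)]⟩, ⟨0, 3, 1, 1,
  0x1615626626c25266266, [([0x1a15a26a26a15], 0x12a6a26a26a15a19a26a26a15), ([0x1a26a26a26a15],
  0x1a26a15), ([0x1626615626c26a15a26626626615c26], 0x1604626615c24), ([0x1a04a26a15a04],
  0x18e5a15a04), ([0x1c05a15a04c04a04a15c14a04a04], 0x1900c00a04a15c14a04a04)]⟩, ⟨1, 0, 1, 3,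
  0x16046264a6c28266266, [([0x1604626c26a04a26626626604c26626, 0x1604626c06604626604c24626],
  0x1626), ([0x1a26a04a26a26], 0x1615626604c25), ([0x1a15a26a04a15], 0x18e4a04a15),
  ([0x1c14a04a15c15a15a04c05a15a15], 0x1910c10a04a15c15a15a04c05a15a15)]⟩, ⟨2, 3, 2, 2,
  0x1a04244244, [([0x1a04a04], 0x1a04), ([0x1604604604c04], 0x1295604a15615604608c05),
  ([0x1a15a04a15a15], 0x1a15), ([0x1615615604c15615604615c15a04a15,
  0x1615615604c05a15a04604604615c14a04a15], 0x1626604615c16a04a15), ([0x1a26a04a15a26],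
  0x18e4a04a15a26), ([0x1c24a04a15c16a26a04c05a15a26], 0x1c10920a04c05a15a26)]⟩, ⟨1, 3, 2, 2,
  0x1604615615c14255255, [([0x1a04a15a15a04], 0x12a6615a04a15a15a08), ([0x1a26a15a04a15],
  0x18e0910a04a15a26a15a04a15)]⟩, ⟨2, 3, 2, 2, 0x1604615615c14255255, [([0x1a04a15a15a04],
  0x1295615a04a15a15a08), ([0x1a15a15a04a15], 0x1c14a15a04a15), ([0x1c14615604615c05604615604,
  0x1c04a15a04604604615c04604615604], 0x1604615604), ([0x1a04a15a04a04], 0x1626604615c06),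
  ([0x1a26a04a15a26], 0x18e4a04a15a26), ([0x1c24a04a15c16a26a04c05a15a26], 0x1c10920a04c05a15a26)]⟩,
  ⟨2, 0, 1, 0, 0x1a04244244, [([0x1a04a04], 0x1a04), ([0x1604604604c04], 0x1615604484c09),
  ([0x1615604c14615604615c05604, 0x1615604c04a15a04604604615c04604], 0x1604), ([0x1a04a15a04a04],
  0x14e4604615c06), ([0x1c24a04a15c16a26a04c05a15a26], 0x1920c20a04a15c16a26a04c05a15a26)]⟩, ⟨0, 0,
  2, 0, 0x16154a5626c29266266, [([0x1615c25626615626c16615626, 0x1615c15a26a15615615626c15615626],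
  0x1615626), ([0x1a15a26a15a15], 0x1604615626c14), ([0x1a04a15a26a04], 0x18e4a04),
  ([0x1c14a04a04c05a15a04c04a04a15], 0x1c10900a04c05a15a04c04a04a15)]⟩, ⟨2, 3, 1, 0, 0x1a15255244,
  [([0x1a15a15a04a04], 0x1295a15a15a04a08), ([0x1a15a15a15a04], 0x1a15a04),
  ([0x1615604615c15a04a15615615604c15, 0x1615604615c05604615604c14,
  0x1615604615c15a04a15615615604c05a15a04604604615c04604615604c14], 0x1c14),
  ([0x1c04a15a04604604615c04604615604], 0x1604615604), ([0x1a04a15a04a04], 0x1626604615c06),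
  ([0x1a26a04a15a26], 0x19208e0a04a15a26a26a04a15a26)]⟩, ⟨1, 0, 2, 2, 0x1a26266266, [([0x1a26a26],
  0x1a26), ([0x1626626626c26], 0x16044a4626c28), ([0x1604c24626604626c06604626,
  0x1604c04a26a04604604626c04604626,
  0x1604c24626604626c26a04a26626626604c06a26a04604604626c04604626], 0x14e4), ([0x1c04604],
  0x1a04a04c04a04604), ([0x1604604c04c04], 0x1615604c05c05), ([0x1a15a04c05a15a15c14a04a15c15],
  0x1c10910a04c05a15a15c14a04a15c15)]⟩, ⟨2, 0, 2, 2, 0x1a15255255, [([0x1a15a15], 0x1a15),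
  ([0x1615615615c15], 0x1604494615c18), ([0x1604c14615604615c05604615,
  0x1604c04a15a04604604615c04604615,
  0x1604c14615604615c15a04a15615615604c05a15a04604604615c04604615], 0x1604615), ([0x1a04a15a04a04],
  0x1626604615c06), ([0x1a26a04a15a26], 0x18e0920a04a15a26a26a04a15a26)]⟩, ⟨0, 3, 2, 0,
  0x1604615615c14255255, [([0x1a04a15a15a04], 0x12a6615a04a04a15a19a04), ([0x1a26a15a04a04],
  0x1c10900a048e5a15a04a04)]⟩, ⟨0, 0, 1, 0, 0x1a26266266, [([0x1a26a26], 0x1c156154a5c298e5),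
  ([0x1c15615, 0x1c15a15c15a15a15c15a15615, 0x1c15a15c15615615c15c15a15615], 0x1615),
  ([0x1a15c15a15a15c15615615c15c15a15], 0x1900c00604615c14c14a15)]⟩, ⟨0, 0, 2, 1, 0x1a26266266,
  [([0x1a26a26], 0x1a26), ([0x1626626626c26], 0x16154a6626c29),
  ([0x1615c26626615626c26a15a26626626], 0x1626626), ([0x1a26a26a15a26], 0x1604615626c24a15a26),
  ([0x1a04a15a26a04], 0x18e4a04), ([0x1c14a04a04c05a15a04c04a04a15],
  0x1c10900a04c05a15a04c04a04a15)]⟩, ⟨0, 3, 2, 0, 0x1615604604c05244244, [([0x1a15a04a04a15],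
  0x12a6615a04a04a15a19a04a04a15), ([0x1a26a15a04a04], 0x1c10900a048e5a15a04a04)]⟩, ⟨1, 3, 2, 2,
  0x1a04244244, [([0x1a04a04], 0x1a04), ([0x1604604604c04], 0x1615604604c05), ([0x1a15a04a04a15],
  0x12a6604a15a15a04a08a15), ([0x1a26a04a15a15], 0x1c10910a04c05a15a158e4a04a15a15)]⟩, ⟨2, 3, 2, 0,
  0x1284615295255, [([0x1a04a15a15a15], 0x1c14a15), ([0x1c14615604615c05604615604,
  0x1c04a15a04604604615c04604615604,
  0x1c14615604615c15a04a15615615604c05a15a04604604615c04604615604], 0x1604615604),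
  ([0x1a04a15a04a04], 0x1626604615c06), ([0x1a26a04a15a26], 0x18e0920a04a15a26a26a04a15a26)]⟩, ⟨0,
  0, 2, 0, 0x1a26266266, [([0x1a26a26], 0x1a26), ([0x1626626626c26], 0x16154a5626c29),
  ([0x1615c25626615626c16615626, 0x1615c15a26a15615615626c15615626], 0x1615626), ([0x1a15a26a15a15],
  0x1a158e5a15a15), ([0x1615c15], 0x1604615c14c14a15), ([0x1a04a15c14a04a04c05a15a04c04],
  0x1c10900a04c05a15a04c04)]⟩, ⟨1, 0, 1, 3, 0x1a26266266, [([0x1a26a26], 0x1a26),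
  ([0x1626626626c26], 0x16046264a6c28), ([0x1604626c26a04a26626626604c26626], 0x1626),
  ([0x1a26a04a26a26], 0x1604626604c24), ([0x1a04a26a04a04], 0x1615604626c05), ([0x1a15a04a26a15],
  0x18e5a15), ([0x1c05a15a15c14a04a15c15a15a04], 0x1910c10a04a15c15a15a04)]⟩, ⟨1, 3, 2, 3,
  0x1a26266266, [([0x1a26a26], 0x1a26), ([0x1626626626c26], 0x1615626626c25), ([0x1a15a26a26a15],
  0x18a4a04a15a15a268e8a15), ([0x1c14a04a15c15a15a04c05a15a15], 0x1c10910a04c05a15a15)]⟩, ⟨1, 0, 1,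
  2, 0x1a26266266, [([0x1a26a26], 0x1c046044a4c288e4), ([0x1c04604, 0x1c04a04c04a04a04c04a04604,
  0x1c04a04c04604604c04c04a04604], 0x1604), ([0x1a04c04a04a04c04604604c04c04a04], 0x1615c04604c05),
  ([0x1a15c14a04a15c15a15a04c05a15], 0x1910c10a04a15c15a15a04c05a15)]⟩, ⟨0, 0, 1, 0, 0x1a26266266,
  [([0x1a26a26], 0x1a26), ([0x1626626626c26], 0x1c156154a54e9c25), ([0x1c15615,
  0x1c15a15c15a15a15c15a15615, 0x1c15a15c15615615c15c15a15615], 0x1615),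
  ([0x1a15c15a15a15c15615615c15c15a15], 0x1604c15615c14), ([0x1a04c05a15a04c04a04a15c14a04],
  0x1900c00a04a15c14a04)]⟩, ⟨1, 0, 1, 2, 0x1a26266266, [([0x1a26a26], 0x1a26), ([0x1626626626c26],
  0x1c046044a44e8c24), ([0x1c04604, 0x1c04a04c04a04a04c04a04604, 0x1c04a04c04604604c04c04a04604],
  0x1604), ([0x1a04c04a04a04c04604604c04c04a04], 0x1615c04604c05),
  ([0x1a15c14a04a15c15a15a04c05a15], 0x1910c10a04a15c15a15a04c05a15)]⟩, ⟨0, 0, 1, 0, 0x18e6266266,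
  [([0x1c26a26a26c26a26a26c26a26a26], 0x1a26), ([0x1626c26, 0x1626c26a26c26a26a26c26a26],
  0x1615c254a5c29), ([0x1615c15c15615], 0x1615), ([0x1a15a15c15a15615c15a15c15], 0x1c15a15c15),
  ([0x1c15615], 0x1604c15615c14615), ([0x1a04c05a15a04c04a04a15c14a04], 0x1900c00a04a15c14a04)]⟩,
  ⟨1, 3, 1, 2, 0x12a6a04244284, [([0x1a26a04a04a04, 0x1a26a04604604626c24a04a26626626604c06,
  0x1a26a04604604626c04604626604c04], 0x1626626604c06), ([0x1a26a26a04a26], 0x1615604626c25a04a26),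
  ([0x1a15a04a26a15], 0x18e5a15), ([0x1c05a15a15c14a04a15c15a15a04], 0x1910c10a04a15c15a15a04)]⟩,
  ⟨1, 0, 2, 2, 0x1a26266266, [([0x1a26a26], 0x1a26), ([0x1626626626c26], 0x16044a4626c28),
  ([0x1604c24626604626c06604626, 0x1604c04a26a04604604626c04604626], 0x14e4), ([0x1c04604], 0x1604),
  ([0x1a04c04a04a04c04604604c04c04a04], 0x1615c04604c05), ([0x1a15c14a04a15c15a15a04c05a15],
  0x1c10910a04c05a15a15c14a04a15c15a15a04c05a15)]⟩, ⟨0, 0, 2, 0, 0x1a26266266, [([0x1a26a26],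
  0x1a26), ([0x1626626626c26], 0x16154a5626c29), ([0x1615c25626615626c16615626,
  0x1615c15a26a15615615626c15615626], 0x14e5), ([0x1c15615], 0x1615),
  ([0x1a15c15a15a15c15615615c15c15a15], 0x1a15a15c15a15), ([0x1615615c15c15], 0x1604615c14c14),
  ([0x1a04a15c14a04a04c05a15a04c04], 0x1c10900a04c05a15a04c04)]⟩, ⟨0, 3, 2, 0, 0x12a6615295255,
  [([0x1a26a15a15a15], 0x1c16), ([0x1c16a26a15615615626c25a15a26626626615], 0x1626626615),
  ([0x1a26a26a15a26], 0x1604615626c24a15a26), ([0x1a04a15a26a04], 0x18e4a04),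
  ([0x1c14a04a04c05a15a04c04a04a15], 0x1c10900a04c05a15a04c04a04a15)]⟩, ⟨2, 0, 2, 0,
  0x1615485604c09244244, [([0x1615c15a04a15615615604c15615604, 0x1615c05604615604c14615604,
  0x1615c15a04a15615615604c05a15a04604604615c04604615604c14615604], 0x1615604), ([0x1a15a04a15a15],
  0x1c14), ([0x1c04a15a04604604615c04604615604], 0x1604615604), ([0x1a04a15a04a04],
  0x1626604615c06), ([0x1a26a04a15a26], 0x18e4a04a15a26), ([0x1c24a04a15c16a26a04c05a15a26],
  0x1c10920a04c05a15a26)]⟩, ⟨1, 0, 1, 3, 0x1a26266266, [([0x1a26a26], 0x1a26), ([0x1626626626c26],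
  0x1615626626c25), ([0x1a15a26a26a15], 0x1c05a15a158a48e8a15), ([0x1c05a15a15c14a04a15c15a15a04],
  0x1910c10a04a15c15a15a04)]⟩, ⟨0, 3, 2, 0, 0x1a15255255, [([0x1a15a15], 0x1a15),
  ([0x1615615615c15], 0x12a6615a04604615619c14), ([0x1a26a15a04a04], 0x1c10900a048e5a15a04a04)]⟩,
  ⟨1, 3, 1, 2, 0x1a04244244, [([0x1a04a04], 0x1a04), ([0x1604604604c04], 0x1615604604c05),
  ([0x1a15a04a04a15], 0x12a6a15a15a04a08a15), ([0x1a26a15a15a04],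
  0x1910c10a04a15c15a15a048e5a15a15a04)]⟩, ⟨0, 0, 1, 1, 0x1a26266266, [([0x1a26a26], 0x1a26),
  ([0x1626626626c26], 0x16156264a6c29), ([0x1615626c26a15a26626626615c26626,
  0x1615626c16615626615c25626], 0x1604615c244e4), ([0x1a04a15c14a04a04c05a15a04c04],
  0x1900c00a04a15c14a04a04c05a15a04c04)]⟩, ⟨2, 0, 1, 1, 0x1a04244244, [([0x1a04a04], 0x1a04),
  ([0x1604604604c04], 0x1626604604c06), ([0x1a26a04a04a26], 0x1920c20a04a15c16a26a048858e9)]⟩, ⟨2,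
  0, 1, 3, 0x1a15255255, [([0x1a15a15], 0x1a15), ([0x1615615615c15], 0x12e6c15),
  ([0x1a26c25a15a15c16a26a15c15a15], 0x1c05a15a26894c18a15), ([0x1c05a15a26c24a04a15c16a26a04],
  0x1920c20a04a15c16a26a04)]⟩, ⟨0, 3, 1, 0, 0x1604615615c14255255, [([0x1a04a15a15a04],
  0x12a6a04a04a15a19a04), ([0x1a26a04a04a15], 0x1900c00a04a158e4a04a04a15)]⟩, ⟨1, 0, 2, 2,
  0x1a26266266, [([0x1a26a26], 0x1a26), ([0x1626626626c26], 0x16044a4626c28),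
  ([0x1604c24626604626c06604626, 0x1604c04a26a04604604626c04604626], 0x14e4), ([0x1c04604,
  0x1c04a04c04a04a04c04a04604], 0x1604), ([0x1a04c04a04a04c04604604c04c04a04],
  0x1c10910a04c05a15615c04604c05)]⟩, ⟨0, 0, 2, 1, 0x1a26266266, [([0x1a26a26], 0x1a26),
  ([0x1626626626c26], 0x16154a5626c29), ([0x1615c25626615626c16615626], 0x1604615626c14615626),
  ([0x1a04a15a26a04], 0x18e4a04), ([0x1c14a04a04c05a15a04c04a04a15],
  0x1c10900a04c05a15a04c04a04a15)]⟩, ⟨1, 0, 2, 3, 0x16044a6626c28266266,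
  [([0x1604c26626604626c26a04a26626626], 0x1626626), ([0x1a26a26a04a26], 0x1615604626c25a04a26),
  ([0x1a15a04a26a15], 0x18e5a15), ([0x1c05a15a15c14a04a15c15a15a04],
  0x1c10910a04c05a15a15c14a04a15c15a15a04)]⟩, ⟨0, 3, 1, 0, 0x1a15255255, [([0x1a15a15], 0x1a15),
  ([0x1615615615c15], 0x12a6a04604615619c14), ([0x1a26a04a04a15], 0x1900c00a04a158e4a04a04a15)]⟩,
  ⟨1, 3, 2, 2, 0x1a26266266, [([0x1a26a26], 0x18a4a04a04604626c288e4),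
  ([0x1c04a04a04c04a04a04c04a04a04, 0x1c04a04a04c04604604c04c04a04a04], 0x1a04), ([0x1604c04,
  0x1604c04a04c04a04a04c04a04], 0x1c10910a04c05a15615c04604c05)]⟩, ⟨2, 0, 2, 2, 0x1a15255255,
  [([0x1a15a15], 0x1a15), ([0x1615615615c15], 0x1604494615c18), ([0x1604c14615604615c05604615,
  0x1604c04a15a04604604615c04604615], 0x1604615), ([0x1a04a15a04a04], 0x1626604615c06),
  ([0x1a26a04a15a26], 0x18e4a04a15a26), ([0x1c24a04a15c16a26a04c05a15a26], 0x1c10920a04c05a15a26)]⟩,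
  ⟨2, 3, 1, 0, 0x1a15255255, [([0x1a15a15], 0x1a15284a15a15a15a19a15),
  ([0x1615604615c05604615604c14], 0x1c14), ([0x1c04a15a04604604615c04604615604], 0x1604615604),
  ([0x1a04a15a04a04], 0x1626604615c06), ([0x1a26a04a15a26], 0x19208e0a04a15a26a26a04a15a26)]⟩, ⟨1,
  0, 2, 2, 0x1a26266266, [([0x1a26a26], 0x1a26), ([0x1626626626c26], 0x16044a4626c28),
  ([0x1604c24626604626c06604626, 0x1604c04a26a04604604626c04604626], 0x1604626), ([0x1a04a26a04a04],
  0x16156044e5c05), ([0x1a15a04c05a15a15c14a04a15c15], 0x1c10910a04c05a15a15c14a04a15c15)]⟩, ⟨0, 3,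
  2, 0, 0x1a26266266, [([0x1a26a26], 0x18a5a15a15615626c298e5), ([0x1c15a15a15c15a15a15c15a15a15,
  0x1c15a15a15c15615615c15c15a15a15], 0x1a15), ([0x1615c15, 0x1615c15a15c15a15a15c15a15],
  0x1c10900604c15615c14)]⟩, ⟨0, 0, 1, 0, 0x1a26266266, [([0x1a26a26], 0x1a26), ([0x1626626626c26],
  0x1c156154a54e9c25), ([0x1c15615, 0x1c15a15c15a15a15c15a15615, 0x1c15a15c15615615c15c15a15615],
  0x1615), ([0x1a15c15a15a15c15615615c15c15a15], 0x1900c00604615c14c14a15)]⟩, ⟨0, 0, 2, 0,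
  0x1a26266266, [([0x1a26a26], 0x1a26), ([0x1626626626c26], 0x16154a5626c29),
  ([0x1615c25626615626c16615626, 0x1615c15a26a15615615626c15615626], 0x14e5), ([0x1c15615,
  0x1c15a15c15a15a15c15a15615, 0x1c15a15c15615615c15c15a15615], 0x1604615c14c14a15615),
  ([0x1a04a15c14a04a04c05a15a04c04], 0x1c10900a04c05a15a04c04)]⟩, ⟨2, 0, 1, 2, 0x1a15255255,
  [([0x1a15a15], 0x1a15), ([0x1615615615c15], 0x14e4604615496c18),
  ([0x1c24a04a15c16a26a04c05a15a26], 0x1920c20a04a15c16a26a04c05a15a26)]⟩, ⟨2, 0, 1, 0,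
  0x1a04244244, [([0x1a04a04], 0x1a04), ([0x1604604604c04], 0x1615604485c09),
  ([0x1615604c15615604615c15a04a15615, 0x1615604c05a15a04604604615c14a04a15615], 0x1615),
  ([0x1a15a15a04a15], 0x14e4604615c16a04a15), ([0x1c24a04a15c16a26a04c05a15a26],
  0x1920c20a04a15c16a26a04c05a15a26)]⟩, ⟨0, 0, 1, 0, 0x1a15255266, [([0x1a15a15a26a26],
  0x1604c25a158948eaa26), ([0x1a04c05a15a04c04a04a15c14a04], 0x1900c00a04a15c14a04)]⟩, ⟨1, 3, 1, 2,
  0x1284a04a04a2626a244, [([0x1a04a04a04a26], 0x1a04a26), ([0x1604626604c24626604626c06],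
  0x1615604626c05), ([0x1a15a04a26a15], 0x18e5a15), ([0x1c05a15a15c14a04a15c15a15a04],
  0x1910c10a04a15c15a15a04)]⟩, ⟨1, 0, 1, 3, 0x1a26266266, [([0x1a26a26], 0x1a26),
  ([0x1626626626c26], 0x1604626626c24), ([0x1a04a26a26a04], 0x1510c00a048a58e8a04)]⟩, ⟨1, 0, 1, 2,
  0x1a26266266, [([0x1a26a26], 0x1a26), ([0x1626626626c26], 0x1c046044a44e8c24), ([0x1c04604,
  0x1c04a04c04a04a04c04a04604], 0x1604), ([0x1a04c04a04a04c04604604c04c04a04],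
  0x1510c00604c05604c04)]⟩, ⟨1, 3, 1, 2, 0x1a04244244, [([0x1a04a04], 0x12a6a04a04a04a08),
  ([0x1a26a04a04a04, 0x1a26a04604604626c24a04a26626626604c06], 0x1615626604c05), ([0x1a15a26a04a15],
  0x19108e0a04a15a15a26a04a15)]⟩, ⟨1, 3, 2, 2, 0x1a15255255, [([0x1a15a15], 0x1a15),
  ([0x1615615615c15], 0x1604615615c14), ([0x1a04a15a15a04], 0x18e0910a04a152a6615a04a15a15a08)]⟩,
  ⟨2, 0, 2, 1, 0x1a04244244, [([0x1a04a04], 0x1a04), ([0x1604604604c04], 0x1626604604c06),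
  ([0x1a26a04a04a26], 0x1c10920a04c05a15a26884a048e9)]⟩, ⟨2, 0, 1, 3, 0x1c15255255,
  [([0x1c15615615615], 0x12e6), ([0x1a26c25a15a15c16a26a15c15a15], 0x1c05a15a26894c18a15),
  ([0x1c05a15a26c24a04a15c16a26a04], 0x1920c20a04a15c16a26a04)]⟩, ⟨1, 3, 2, 3,
  0x1615626626c25266266, [([0x1a15a26a26a15], 0x18e6a26a15), ([0x1c16a26a15c15a15a26c25a15a15],
  0x18a4a04a15a15a26c28a15a15), ([0x1c14a04a15c15a15a04c05a15a15], 0x1c10910a04c05a15a15)]⟩, ⟨0, 3,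
  1, 0, 0x12a6295255, [([0x1a26a15a15a15], 0x1a15), ([0x1615626615c25626615626c16,
  0x1615626615c15a26a15615615626c15], 0x1604615626c14), ([0x1a04a15a26a04],
  0x1900c00a04a158e4a04)]⟩, ⟨0, 0, 2, 0, 0x1a26266266, [([0x1a26a26], 0x1615626c258e5),
  ([0x1a15a26c25a15a15c16a26a15c15], 0x1604615c148a4a15c19), ([0x1a04a15c14a04a04c05a15a04c04],
  0x1c10900a04c05a15a04c04)]⟩, ⟨2, 3, 1, 0, 0x1a15284295255, [([0x1615604615c05604615604c14,
  0x1615604615c15a04a15615615604c05a15a04604604615c04604615604c14], 0x1c14),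
  ([0x1c04a15a04604604615c04604615604], 0x1604615604), ([0x1a04a15a04a04], 0x1626604615c06),
  ([0x1a26a04a15a26], 0x19208e0a04a15a26a26a04a15a26)]⟩, ⟨1, 3, 1, 0, 0x1a15255266,
  [([0x1a15a15a26a26], 0x1284a15a15a26a2a), ([0x1a04a15a15a26], 0x19108e0a04a15a15a26)]⟩, ⟨2, 0, 2,
  2, 0x1a15255255, [([0x1a15a15], 0x1a15), ([0x1615615615c15], 0x1a04a158962e6c18),
  ([0x1a04a15c16a26a04c05a15a26c24], 0x1c10920a04c05a15a26c24)]⟩, ⟨2, 0, 1, 0,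
  0x1615604484c09244244, [([0x1615604c14615604615c05604, 0x1615604c04a15a04604604615c04604],
  0x1604), ([0x1a04a15a04a04], 0x14e4604615c06), ([0x1c24a04a15c16a26a04c05a15a26],
  0x1920c20a04a15c16a26a04c05a15a26)]⟩, ⟨1, 3, 1, 2, 0x1a04244244, [([0x1a04a04], 0x1a04),
  ([0x1604604604c04], 0x12a6a15615604608c05), ([0x1a26a15a15a04],
  0x1910c10a04a15c15a15a048e5a15a15a04)]⟩, ⟨0, 0, 1, 1, 0x1a26266266, [([0x1a26a26], 0x1a26),
  ([0x1626626626c26], 0x16046156264a4c29), ([0x1a04a15a26a04], 0x1900c00a04a158e4a04)]⟩, ⟨1, 3, 2,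
  2, 0x1a04244244, [([0x1a04a04], 0x1a04), ([0x1604604604c04], 0x12a6615a04a15615608604c05),
  ([0x1a26a15a04a15], 0x18e0910a04a15a26a15a04a15)]⟩, ⟨1, 3, 1, 2, 0x1284a042442a6,
  [([0x1a04a04a04a26], 0x1a04a26), ([0x1604626604c24626604626c06,
  0x1604626604c24626604626c26a04a26626626604c06a26a04604604626c04], 0x1615604626c05),
  ([0x1a15a04a26a15], 0x18e5a15), ([0x1c05a15a15c14a04a15c15a15a04], 0x1910c10a04a15c15a15a04)]⟩,
  ⟨0, 3, 2, 0, 0x12a6615295255, [([0x1a26a15a15a15], 0x1c16),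
  ([0x1c16a26a15615615626c25a15a26626626615], 0x1626626615), ([0x1a26a26a15a26],
  0x16046154e4c24a15a26), ([0x1a04a15c14a04a04c05a15a04c04], 0x1c10900a04c05a15a04c04)]⟩, ⟨2, 0, 2,
  2, 0x1604494615c18255255, [([0x1604c14615604615c05604615, 0x1604c04a15a04604604615c04604615,
  0x1604c14615604615c15a04a15615615604c05a15a04604604615c04604615], 0x1604615), ([0x1a04a15a04a04],
  0x1626604615c06), ([0x1a26a04a15a26], 0x18e0920a04a15a26a26a04a15a26)]⟩, ⟨1, 0, 2, 2,
  0x1a26266266, [([0x1a26a26], 0x16044a4c248e8), ([0x1604c04c04604], 0x1604),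
  ([0x1a04a04c04a04604c04a04c04], 0x1a04c04a04a04c04), ([0x1604c04], 0x1c10510604c05c05a04)]⟩, ⟨0,
  0, 2, 1, 0x1a26266266, [([0x1a26a26], 0x1a26), ([0x1626626626c26], 0x16154a5626c29),
  ([0x1615c25626615626c16615626], 0x1615626), ([0x1a15a26a15a15], 0x1604615626c14),
  ([0x1a04a15a26a04], 0x18e0900a04a15a26a04)]⟩, ⟨2, 0, 2, 2, 0x1a15255255, [([0x1a15a15], 0x1a15),
  ([0x1615615615c15], 0x1604494615c18), ([0x1604c14615604615c05604615,
  0x1604c04a15a04604604615c04604615], 0x1604615), ([0x1a04a15a04a04],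
  0x18e0920a04a15a26626604615c06)]⟩, ⟨2, 0, 2, 0, 0x1a04244244, [([0x1a04a04], 0x1a04),
  ([0x1604604604c04], 0x1615485604c09), ([0x1615c15a04a15615615604c15615604], 0x1615604),
  ([0x1a15a04a15a15], 0x1c15), ([0x1c05a15a04604604615c14a04a15615615604], 0x12e6604),
  ([0x1a26a04c05a15a26c24a04a15c16], 0x1c10920a04c05a15a26c24a04a15c16)]⟩, ⟨0, 0, 1, 0,
  0x1a15255266, [([0x1a15a15a26a26], 0x1c26a26a158968eaa26), ([0x1c26a26a15c16a26a26c25a15a26],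
  0x1604615c24c24a15a26), ([0x1a04a15c14a04a04c05a15a04c04],
  0x1900c00a04a15c14a04a04c05a15a04c04)]⟩, ⟨0, 3, 3, 0, 0x1a15255255, [([0x1a15a15], 0x1a15),
  ([0x1615615615c15], 0x1626615615c16), ([0x1a26a15a15a26], 0x18a08e0304a15a26a26a19a15a26)]⟩, ⟨0,
  0, 1, 0, 0x1a26266266, [([0x1a26a26], 0x1c156154a5c298e5), ([0x1c15615,
  0x1c15a15c15a15a15c15a15615], 0x1a15a15c15a15615), ([0x1615615c15c15], 0x1900c00604615c14c14)]⟩,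
  ⟨0, 3, 1, 0, 0x1295a152552a6, [([0x1a15a15a15a26], 0x1a15a26), ([0x1615626615c25626615626c16,
  0x1615626615c15a26a15615615626c15], 0x1604615626c14), ([0x1a04a15a26a04],
  0x1900c00a04a158e4a04)]⟩, ⟨0, 0, 1, 1, 0x1a26266266, [([0x1a26a26], 0x1a26), ([0x1626626626c26],
  0x1604626615c14a26a156156156264a5c29), ([0x1a04a26a15a04], 0x18e5a15a04),
  ([0x1c05a15a04c04a04a15c14a04a04], 0x1900c00a04a15c14a04a04)]⟩, ⟨0, 3, 2, 1, 0x1a04244244,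
  [([0x1a04a04], 0x1a04), ([0x1604604604c04], 0x1626604604c06), ([0x1a26a04a04a26], 0x18e6),
  ([0x1c06a26a04c04a04a26c24a04a04], 0x1c10900a048a5a15a04a04a26c29a04a04)]⟩, ⟨2, 3, 2, 2,
  0x1a15255255, [([0x1a15a15], 0x1a15), ([0x1615615615c15], 0x1894a04a15a26a15c18a152e6c15),
  ([0x1c24a04a15c16a26a04c05a15a26], 0x1c10920a04c05a15a26)]⟩, ⟨2, 0, 1, 0, 0x1a04244244,
  [([0x1a04a04], 0x1a04), ([0x1604604604c04], 0x1615604484c09),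
  ([0x1615604c04a15a04604604615c04604], 0x1604), ([0x1a04a15a04a04], 0x1c04),
  ([0x1c14a04a15615615604c05a15a04604604615], 0x12e6), ([0x1a26c24a04a15c16a26a04c05a15],
  0x1920c20a04a15c16a26a04c05a15)]⟩, ⟨2, 3, 2, 3, 0x1615626626c25266266, [([0x1a15a26a26a15],
  0x18e5a15), ([0x1c25a15a15c16a26a15c15a15a26], 0x1894a04a15a26a15c18a15a26),
  ([0x1c24a04a15c16a26a04c05a15a26], 0x1c10920a04c05a15a26)]⟩, ⟨1, 0, 2, 2, 0x1a26266266,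
  [([0x1a26a26], 0x16044a4c248e8), ([0x1604c04c04604, 0x1604c04c04a04a04c04a04a04c04604],
  0x1615604c05c05604), ([0x1a15a04c05a15a15c14a04a15c15], 0x1c10910a04c05a15a15c14a04a15c15)]⟩, ⟨1,
  0, 1, 2, 0x1a26266266, [([0x1a26a26], 0x1c046044a4c288e4), ([0x1c04604,
  0x1c04a04c04a04a04c04a04604], 0x1510c00604c05604c04604)]⟩, ⟨1, 0, 2, 3, 0x1a26266266,
  [([0x1a26a26], 0x1a26), ([0x1626626626c26], 0x16044a4626c28), ([0x1604c24626604626c06604626],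
  0x1c10910a04c05a15615c046044e5)]⟩, ⟨0, 0, 2, 1, 0x1a26266266, [([0x1a26a26], 0x16046154a4c248e9),
  ([0x1a04a15c14a04a04c05a15a04c04], 0x1c10900a04c05a15a04c04)]⟩, ⟨2, 3, 1, 2, 0x1a15255255,
  [([0x1a15a15], 0x1604615615c14a15), ([0x1a04a15a15a04], 0x1295a04a15a15a08), ([0x1a15a04a15a15],
  0x19204e0604615c16a04a15a15)]⟩, ⟨2, 3, 2, 2, 0x1604615615c14255255, [([0x1a04a15a15a04],
  0x1295615a04a15a15a08), ([0x1a15a15a04a15], 0x14e4604615c16a04a15),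
  ([0x1c24a04a15c16a26a04c05a15a26], 0x1c10920a04c05a15a26)]⟩, ⟨2, 0, 2, 3, 0x1626615615c16255255,
  [([0x1a26a15a15a26], 0x1a04a15896a268e8a15a15a26), ([0x1a04a15c16a26a04c05a15a26c24],
  0x1c10920a04c05a15a26c24)]⟩, ⟨2, 3, 1, 0, 0x1615604604c05244244, [([0x1a15a04a04a15],
  0x1284a15a04a04a19), ([0x1a04a15a04a04], 0x1615615604c05a15a04a04), ([0x1a15a15a04a15],
  0x14e4604615c16a04a15), ([0x1c24a04a15c16a26a04c05a15a26], 0x1920c20a04a15c16a26a04c05a15a26)]⟩,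
  ⟨2, 0, 1, 1, 0x1615604484c09244244, [([0x1615604c14615604615c05604,
  0x1615604c04a15a04604604615c04604], 0x1604), ([0x1a04a15a04a04], 0x1626604615c06),
  ([0x1a26a04a15a26], 0x19208e0a04a15a26a26a04a15a26)]⟩, ⟨0, 3, 1, 0, 0x12a6a04604615619c14255255,
  [([0x1a26a04a04a15], 0x1900c00a04a158e4a04a04a15)]⟩, ⟨1, 3, 2, 2, 0x1a04244244, [([0x1a04a04],
  0x1a04), ([0x1604604604c04], 0x12a6604a15615604608c05), ([0x1a26a04a15a15],
  0x1c10910a04c05a15a158e4a04a15a15)]⟩, ⟨0, 0, 1, 1, 0x16046156264a4c29266266, [([0x1a04a15a26a04],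
  0x1900c00a04a158e4a04)]⟩, ⟨1, 3, 2, 2, 0x12a6604284244, [([0x1a26a04a04a04], 0x1615626604c05),
  ([0x1a15a26a04a15], 0x18e4a04a15), ([0x1c14a04a15c15a15a04c05a15a15], 0x1c10910a04c05a15a15)]⟩,
  ⟨2, 0, 1, 3, 0x1a268e6266266, [([0x1626c26], 0x1615c26626c25), ([0x1a15c16a26a15c15a15a26c25a15],
  0x1c05a15a26894c18a15a26c25a15), ([0x1c05a15a26c24a04a15c16a26a04], 0x1920c20a04a15c16a26a04)]⟩,
  ⟨1, 0, 2, 2, 0x1a26266266, [([0x1a26a26], 0x16044a4626c28a26), ([0x1604c24626604626c06604626,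
  0x1604c04a26a04604604626c04604626], 0x1615c046044e5), ([0x1a15c14a04a15c15a15a04c05a15],
  0x1c10910a04c05a15a15c14a04a15c15a15a04c05a15)]⟩, ⟨1, 0, 2, 2, 0x1a26266266, [([0x1a26a26],
  0x16044a4c248e8), ([0x1604c04c04604, 0x1604c04c04a04604c04a04c04604,
  0x1604c04c04a04a04c04a04a04c04604], 0x1c10510604c05c05604)]⟩, ⟨0, 0, 2, 1, 0x1a26266266,
  [([0x1a26a26], 0x1a26), ([0x1626626626c26], 0x16154a5626c29), ([0x1615c25626615626c16615626],
  0x1615626), ([0x1a15a26a15a15], 0x18e0900604615626c14)]⟩, ⟨1, 0, 2, 2, 0x1a26266266,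
  [([0x1a26a26], 0x16044a4626c28a26), ([0x1604c24626604626c06604626,
  0x1604c04a26a04604604626c04604626], 0x14e4), ([0x1c04604, 0x1c04a04c04a04a04c04a04604],
  0x1c10510604c05c05a04604)]⟩, ⟨0, 3, 2, 0, 0x12a6615295255, [([0x1a26a15a15a15], 0x1604626615c14),
  ([0x1a04a26a15a04], 0x1c10900a048e5a15a04)]⟩, ⟨0, 0, 2, 1, 0x16046266154a4626c29266266,
  [([0x1a04a26a15a04], 0x1c10900a048e5a15a04)]⟩, ⟨1, 0, 2, 2, 0x1a26266266, [([0x1a26a26],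
  0x16044a4c248e8), ([0x1604c04c04604], 0x1a04c04a04a04c04604), ([0x1604c04],
  0x1c10910a04c05a15615c04604c05)]⟩, ⟨1, 0, 1, 3, 0x1a26266266, [([0x1a26a26], 0x1a26),
  ([0x1626626626c26], 0x16046264a6c28), ([0x1604626c26a04a26626626604c26626,
  0x1604626c06604626604c24626], 0x1910c10a04a15c15615604c254e5)]⟩, ⟨0, 0, 1, 1, 0x1a26266266,
  [([0x1a26a26], 0x1a26), ([0x1626626626c26], 0x1604c156154a44e9c25),
  ([0x1a04c05a15a04c04a04a15c14a04], 0x1900c00a04a15c14a04)]⟩, ⟨1, 3, 2, 2, 0x1626604604c06244244,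
  [([0x1a26a04a04a26], 0x1615604626c25a04a262a6626a04a26a26a08a04a26), ([0x1a15a04a26a15],
  0x1c10910a048e5a15a15a04a26a15)]⟩, ⟨1, 0, 1, 3, 0x16046264a6c28266266,
  [([0x1604626c26a04a26626626604c26626, 0x1604626c06604626604c24626], 0x1626), ([0x1a26a04a26a26],
  0x16154e4604c25), ([0x1a15c14a04a15c15a15a04c05a15], 0x1910c10a04a15c15a15a04c05a15)]⟩, ⟨2, 0, 2,
  1, 0x1626604615486604c09244244, [([0x1a26a04a15a26], 0x18e4a04a15a26),
  ([0x1c24a04a15c16a26a04c05a15a26], 0x1c10920a04c05a15a26)]⟩, ⟨2, 0, 2, 2, 0x1a15255255,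
  [([0x1a15a15], 0x1a15), ([0x1615615615c15], 0x1604494615c18), ([0x1604c14615604615c05604615],
  0x18e0520604615c06604615)]⟩, ⟨2, 0, 2, 2, 0x1a15255255, [([0x1a15a15], 0x1604494615c18a15),
  ([0x1604c04a15a04604604615c04604615], 0x1604615), ([0x1a04a15a04a04], 0x14e4604615c06),
  ([0x1c24a04a15c16a26a04c05a15a26], 0x1c10920a04c05a15a26)]⟩, ⟨2, 3, 1, 2, 0x1a15255255,
  [([0x1a15a15], 0x1a15), ([0x1615615615c15], 0x1604615615c14), ([0x1a04a15a15a04],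
  0x12e6c04604615604c14a15a04295a15a15a04a08a15a15a04), ([0x1a26c24a04a15c16a26a04c05a15],
  0x1920c20a04a15c16a26a04c05a15)]⟩, ⟨2, 3, 2, 0, 0x1604615615c14255255, [([0x1a04a15a15a04],
  0x1284604a15a04a04a19a15a04), ([0x1a04a04a15a04], 0x18e0920a04a15a26626604615c06a04a15a04)]⟩, ⟨2,
  0, 2, 3, 0x1615615604495615c18255255, [([0x1a15a15a04a15], 0x1626604615c16a04a15),
  ([0x1a26a04a15a26], 0x18e0920a04a15a26a26a04a15a26)]⟩, ⟨0, 3, 2, 0,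
  0x12a6615a04604615619c14255255, [([0x1a26a15a04a04], 0x1c10900a048e5a15a04a04)]⟩, ⟨1, 3, 2, 2,
  0x1615604604c05244244, [([0x1a15a04a04a15], 0x12a6604a15a15a04a08a15), ([0x1a26a04a15a15],
  0x1c10910a04c05a15a158e4a04a15a15)]⟩, ⟨1, 3, 2, 2, 0x12a6604a04a04244248, [([0x1a26a04a04a04],
  0x1615626604c05), ([0x1a15a26a04a15], 0x18e4a04a15), ([0x1c14a04a15c15a15a04c05a15a15],
  0x1c10910a04c05a15a15)]⟩, ⟨0, 0, 1, 0, 0x1a26266266, [([0x1a26a26], 0x1604c15615c146154a5c298e5),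
  ([0x1a04c05a15a04c04a04a15c14a04], 0x1900c00a04a15c14a04)]⟩, ⟨0, 0, 2, 0, 0x16154a5626c29266266,
  [([0x1615c25626615626c16615626, 0x1615c15a26a15615615626c15615626], 0x1615626),
  ([0x1a15a26a15a15], 0x16046154e4c14), ([0x1a04a15c14a04a04c05a15a04c04],
  0x1c10900a04c05a15a04c04)]⟩, ⟨1, 3, 2, 0, 0x12846152a6255, [([0x1a04a15a26a15],
  0x18e0910a04a15a26a15)]⟩, ⟨1, 0, 2, 2, 0x1a26266266, [([0x1a26a26], 0x16044a4626c28a26),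
  ([0x1604c04a26a04604604626c04604626], 0x1604626), ([0x1a04a26a04a04], 0x1a048e4a04a04),
  ([0x1604c04], 0x1c10510604c05c05a04)]⟩, ⟨0, 0, 1, 0, 0x1a15255266, [([0x1a15a15a26a26],
  0x1c25a158958eaa26), ([0x1c15615], 0x1900c00604615c14c14a15615)]⟩, ⟨1, 0, 2, 2,
  0x16044a4626c28266266, [([0x1604c24626604626c06604626, 0x1604c04a26a04604604626c04604626],
  0x14e4), ([0x1c04604], 0x1c10910a04c05a15615c04604c05604)]⟩, ⟨0, 0, 2, 1, 0x16154a5626c29266266,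
  [([0x1615c25626615626c16615626], 0x1615626), ([0x1a15a26a15a15], 0x1604615626c14),
  ([0x1a04a15a26a04], 0x18e0900a04a15a26a04)]⟩, ⟨0, 3, 2, 0,
  0x1604615626c24a15a26626626615c162a6615295255, [([0x1a04a15a26a04], 0x18e0900a04a15a26a04)]⟩, ⟨1,
  0, 2, 3, 0x1a26266266, [([0x1a26a26], 0x1a26), ([0x1626626626c26], 0x16044a4626c28),
  ([0x1604c24626604626c06604626], 0x14e4), ([0x1c04604], 0x1c10910a04c05a15615c04604c05604)]⟩, ⟨0,
  3, 1, 0, 0x12a6a15255295, [([0x1a26a15615615626c15615626615c15],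
  0x1604615626c24a15a26626626615c16), ([0x1a04a15a26a04], 0x1900c00a04a158e4a04)]⟩, ⟨1, 3, 2, 2,
  0x12a6604284244, [([0x1a26a04a04a04], 0x1615604626c25a04a26626626604c06), ([0x1a15a04a26a15],
  0x1c10910a048e5a15a15a04a26a15)]⟩, ⟨1, 0, 2, 3, 0x1a26266266, [([0x1a26a26], 0x16156044a5c258e8),
  ([0x1a15a04c05a15a15c14a04a15c15], 0x1c10910a04c05a15a15c14a04a15c15)]⟩, ⟨1, 0, 2, 3,
  0x1a26266266, [([0x1a26a26], 0x1a26), ([0x1626626626c26], 0x16156044a54e5c28),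
  ([0x1a15a04c05a15a15c14a04a15c15], 0x1c10910a04c05a15a15c14a04a15c15)]⟩, ⟨2, 0, 1, 0,
  0x1a04244244, [([0x1a04a04], 0x1a04), ([0x1604604604c04], 0x1615615604485c09), ([0x1a15a15a04a15],
  0x19204e0604615c16a04a15)]⟩, ⟨2, 0, 1, 3, 0x1a15255255, [([0x1a15a15], 0x1a15),
  ([0x1615615615c15], 0x19208e0a04a15a26626604615496c18)]⟩, ⟨0, 0, 2, 1, 0x1a26266266,
  [([0x1a26a26], 0x1a26), ([0x1626626626c26], 0x16046264e4c24), ([0x1a04a26c24a04a04c06a26a04c04],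
  0x1c10900a04c05a15a048a4a04c09)]⟩, ⟨0, 0, 2, 1, 0x1a26266266, [([0x1a26a26], 0x1a26),
  ([0x1626626626c26], 0x1604626626c24), ([0x1a04a26a26a04], 0x18e4a04),
  ([0x1c24a04a04c06a26a04c04a04a26], 0x1c10900a04c05a15a048a4a04c09a04a26)]⟩, ⟨2, 0, 1, 0,
  0x1a04244244, [([0x1a04a04], 0x1615604485c09a04), ([0x1615604c15615604615c15a04a15615,
  0x1615604c05a15a04604604615c14a04a15615], 0x1615), ([0x1a15a15a04a15], 0x12e6c14a04a15),
  ([0x1a26c24a04a15c16a26a04c05a15], 0x1920c20a04a15c16a26a04c05a15)]⟩, ⟨0, 3, 2, 4, 0x1a04244266,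
  [([0x1a04a04a26a26], 0x1c10900a048a5a15a04a04a268e9)]⟩, ⟨0, 3, 1, 0, 0x12a6a15255295,
  [([0x1a26a15615615626c25a15a26626626615c16, 0x1a26a15615615626c15615626615c15], 0x1626626615c16),
  ([0x1a26a26a15a26], 0x1604c25a158e4), ([0x1a04c05a15a04c04a04a15c14a04], 0x1900c00a04a15c14a04)]⟩,
  ⟨0, 0, 2, 0, 0x16154a5626c29266266, [([0x1615c25626615626c16615626,
  0x1615c15a26a15615615626c15615626], 0x14e5), ([0x1c15615], 0x1604615c14c14a15615),
  ([0x1a04a15c14a04a04c05a15a04c04], 0x1c10900a04c05a15a04c04)]⟩, ⟨1, 0, 1, 2, 0x1a26266266,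
  [([0x1a26a26], 0x1a26), ([0x1626626626c26], 0x1615c04604c056044a44e8c24),
  ([0x1a15c14a04a15c15a15a04c05a15], 0x1910c10a04a15c15a15a04c05a15)]⟩, ⟨1, 0, 2, 3, 0x1a26266266,
  [([0x1a26a26], 0x1c10510604c058a5a04c08604626c248e4)]⟩, ⟨0, 0, 1, 1, 0x1a26266266, [([0x1a26a26],
  0x1a26), ([0x1626626626c26], 0x16156264a6c29), ([0x1615626c26a15a26626626615c26626,
  0x1615626c16615626615c25626], 0x1900c00604615c244e4)]⟩, ⟨0, 0, 1, 0, 0x1a15255266,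
  [([0x1a15a15a26a26], 0x18e5), ([0x1c25a15a15c16a26a15c15a15a26],
  0x1900c00604615c24c24a15a26896c1aa15a26)]⟩, ⟨0, 3, 2, 0, 0x12956152a6255, [([0x1a15a15a26a15],
  0x1604626615c14a26a15), ([0x1a04a26a15a04], 0x1c10900a048e5a15a04)]⟩, ⟨0, 0, 2, 1, 0x1a26266266,
  [([0x1a26a26], 0x1a26), ([0x1626626626c26], 0x16046266154a4626c29), ([0x1a04a26a15a04],
  0x1c10900a048e5a15a04)]⟩, ⟨0, 3, 2, 1, 0x1a15255266, [([0x1a15a15a26a26],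
  0x1604615626c24a15a26626626615c16a26a15295615a26a15a15a2aa26), ([0x1a04a15a26a04],
  0x18e0900a04a15a26a04)]⟩, ⟨1, 3, 2, 3, 0x1a26266266, [([0x1a26a26], 0x18a4a04a15615626c288e5),
  ([0x1c14a04a15c15a15a04c05a15a15], 0x1c10910a04c05a15a15)]⟩, ⟨2, 0, 1, 2, 0x1a15255255,
  [([0x1a15a15], 0x1a15), ([0x1615615615c15], 0x19204e0604615496c18)]⟩, ⟨2, 0, 1, 0, 0x1a04244244,
  [([0x1a04a04], 0x1a04), ([0x1604604604c04], 0x1615604484c09),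
  ([0x1615604c04a15a04604604615c04604], 0x19204e0604615c06604)]⟩, ⟨1, 3, 2, 2, 0x1a15255255,
  [([0x1a15a15], 0x1a15), ([0x1615615615c15], 0x18a4a04a15a152e6c18),
  ([0x1c14a04a15c15a15a04c05a15a15], 0x1c10910a04c05a15a15)]⟩, ⟨2, 3, 1, 0, 0x1604615615c14255255,
  [([0x1a04a15a15a04], 0x1284a04a04a15a19a04), ([0x1a04a04a04a15], 0x19204e0604615c06a04a15)]⟩, ⟨2,
  0, 1, 0, 0x1a04244244, [([0x1a04a04], 0x1a04), ([0x1604604604c04],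
  0x1920c20a04a15c162e6604485c09)]⟩, ⟨2, 0, 1, 1, 0x1626604604c06244244, [([0x1a26a04a04a26],
  0x1920c20a04a15c16a26a048858e9)]⟩, ⟨2, 0, 1, 0, 0x1615604484c09244244,
  [([0x1615604c14615604615c05604], 0x1604), ([0x1a04a15a04a04], 0x1c04),
  ([0x1c14a04a15615615604c05a15a04604604615], 0x12e6), ([0x1a26c24a04a15c16a26a04c05a15],
  0x1920c20a04a15c16a26a04c05a15)]⟩, ⟨2, 0, 1, 0, 0x1a04244244, [([0x1a04a04],
  0x1615615604485c09a04), ([0x1a15a15a04a15], 0x19208e0a04a15a26626604615c16a04a15)]⟩, ⟨2, 0, 2, 0,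
  0x1a04244244, [([0x1a04a04], 0x1a04), ([0x1604604604c04],
  0x1c10920a04c05a15a26c24a04a15c16a26a04c05a15a26884a04c092e6604c04)]⟩, ⟨0, 0, 2, 0,
  0x1604615626c24a15a266266266154a6626c29266266, [([0x1a04a15a26a04], 0x18e4a04),
  ([0x1c14a04a04c05a15a04c04a04a15], 0x1c10900a04c05a15a04c04a04a15)]⟩, ⟨2, 3, 1, 0, 0x1284295255,
  [([0x1a04a15a15a15], 0x1a15), ([0x1615604615c15a04a15615615604c15],
  0x19204e0604615c06604615604c14)]⟩, ⟨1, 3, 1, 2, 0x12842a6244, [([0x1a04a26a04a04], 0x1a04),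
  ([0x1604604626c24a04a26626626604c06a26a04], 0x1910c10a04a15c15615604c058e5a04)]⟩, ⟨1, 3, 1, 2,
  0x1284a042442a6, [([0x1a04a04a04a26], 0x1a048e4), ([0x1604c04],
  0x1910c10a04a15c15615604c05c05a04)]⟩, ⟨2, 0, 2, 1, 0x1a26266266, [([0x1a26a26],
  0x1c10920a04c05a15a26884a04c09a26a04c04604626c248e4)]⟩, ⟨0, 3, 2, 0,
  0x1604615626c14a15a26a152956152a6255, [([0x1a04a15a26a04], 0x18e4a04),
  ([0x1c14a04a04c05a15a04c04a04a15], 0x1c10900a04c05a15a04c04a04a15)]⟩, ⟨1, 0, 1, 2,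
  0x1c24a04c0e08604a, [([0x1c24a04a26c26a26a04c06a26a26], 0x1615c24a04c05a26a26),
  ([0x1a15c14a04a15c15a15a04c05a15], 0x1910c10a04a15c15a15a04c05a15)]⟩, ⟨1, 0, 1, 3, 0x1a26266266,
  [([0x1a26a26], 0x1510c006044a5c288e4)]⟩, ⟨1, 0, 1, 3, 0x1a26266266, [([0x1a26a26], 0x1a26),
  ([0x1626626626c26], 0x1510c006044a54e8c24)]⟩, ⟨1, 0, 1, 2, 0x1a04244266, [([0x1a04a04a26a26],
  0x1510c20a048858eaa26)]⟩, ⟨1, 3, 1, 0, 0x1a15255266, [([0x1a15a15a26a26],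
  0x19108e0284a15a15a26a2a)]⟩, ⟨0, 4, 2, 2, 0x1a04244266, [([0x1a04a04a26a26],
  0x14905006048e5a04a04a2aa26)]⟩, ⟨1, 0, 1, 3, 0x1a26266266, [([0x1a26a26],
  0x1510c00604c056044a4c288e4)]⟩, ⟨1, 0, 2, 3, 0x1a26266266, [([0x1a26a26],
  0x1c105106044a5c258e8)]⟩, ⟨1, 3, 2, 0, 0x1284626a152552a6, [([0x1a04a26a15a15],
  0x1c10910a048e5a15a15)]⟩, ⟨1, 0, 2, 2, 0x1a04244266, [([0x1a04a04a26a26],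
  0x1c10510604c25885a048eaa26)]⟩, ⟨2, 0, 2, 4, 0x1a04a1509608e, [([0x1a04a15c16a26a04c05a15a26c24],
  0x1c10920a04c05a15a26c24)]⟩, ⟨2, 0, 1, 5, 0x1c05a15c1e094058, [([0x1c05a15a26c24a04a15c16a26a04],
  0x1920c20a04a15c16a26a04)]⟩, ⟨0, 0, 1, 0, 0x1a26266266, [([0x1a26a26],
  0x1a15a15c15a156154a5c298e5), ([0x1615615c15c15], 0x1900c00604615c14c14)]⟩, ⟨0, 0, 1, 1,
  0x1a26266266, [([0x1a26a26], 0x1a26), ([0x1626626626c26], 0x1900c00604615c14c14a156154a54e9c25)]⟩,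
  ⟨0, 3, 2, 1, 0x1a26266266, [([0x1a26a26], 0x1c10900a048a5a15a04604626c298e4)]⟩, ⟨2, 0, 2, 5,
  0x1a04a15896a260e8255, [([0x1a04a15c16a26a04c05a15a26c24], 0x1c10920a04c05a15a26c24)]⟩, ⟨1, 0, 2,
  3, 0x1a26266266, [([0x1a26a26], 0x1a26), ([0x1626626626c26],
  0x1c10910a04c05a156154e46044a5626c28)]⟩, ⟨1, 0, 2, 2, 0x1a26266244, [([0x1a26a26a04a04],
  0x1c10910a04c05a15615c24a04885a268eaa04a04)]⟩, ⟨0, 3, 2, 0, 0x1626615615c16255255,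
  [([0x1a26a15a15a26], 0x1604615626c24a15a262a6626a15a26a26a19a15a26), ([0x1a04a15a26a04],
  0x18e0900a04a15a26a04)]⟩, ⟨2, 0, 2, 2, 0x1a04a158962e6c18255255,
  [([0x1a04a15c16a26a04c05a15a26c24], 0x1c10920a04c05a15a26c24)]⟩, ⟨1, 3, 1, 2, 0x1c06a042a6284244,
  [([0x1c26a04a26626626604c26626604626], 0x1626604626), ([0x1a26a04a26a26], 0x14e4604c24),
  ([0x1c04604], 0x1615c04604c05604), ([0x1a15c14a04a15c15a15a04c05a15],
  0x1910c10a04a15c15a15a04c05a15)]⟩, ⟨1, 0, 1, 3, 0x18e6266266, [([0x1c26a26a26c26a26a26c26a26a26,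
  0x1c26a26a26c26626626c26c26a26a26], 0x1a26), ([0x1626c26], 0x1c04a04c04604604c244a4c28),
  ([0x1c04604], 0x1615c04604c05604), ([0x1a15c14a04a15c15a15a04c05a15],
  0x1910c10a04a15c15a15a04c05a15)]⟩, ⟨0, 3, 2, 1, 0x1a26266266, [([0x1a26a26],
  0x1c10900a04c05a15a04c04a04a15c14a04a048a5a15a04604626c298e4)]⟩, ⟨2, 0, 2, 0, 0x1a04244244,
  [([0x1a04a04], 0x1a04), ([0x1604604604c04], 0x18e0520604615486604c09)]⟩, ⟨0, 3, 2, 0,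
  0x1a04244244, [([0x1a04a04], 0x1a04), ([0x1604604604c04], 0x1c10900a048a5a15a04a042e6c09)]⟩, ⟨2,
  0, 2, 2, 0x1a15255255, [([0x1a15a15], 0x1615615604495615c18a15), ([0x1a15a15a04a15],
  0x18e0520604615c16a04a15)]⟩, ⟨2, 3, 1, 2, 0x1604615615c14255255, [([0x1a04a15a15a04],
  0x1295a04a15a15a08), ([0x1a15a04a15a15], 0x19204e0604615c16a04a15a15)]⟩, ⟨1, 3, 1, 2,
  0x12a6a15615604608c05244244, [([0x1a26a15a15a04], 0x1910c10a04a15c15a15a048e5a15a15a04)]⟩, ⟨2, 4,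
  2, 0, 0x1604615615c14255255, [([0x1a04a15a15a04], 0x1284604604a15a04a04a19a15a04),
  ([0x1a04a04a04a15], 0x18e0520604615c06a04a15)]⟩, ⟨2, 0, 2, 0, 0x1a04244244, [([0x1a04a04],
  0x1a04), ([0x1604604604c04], 0x1c10920a04c05a15a26884a04c092e6604c04)]⟩, ⟨0, 0, 2, 1,
  0x1a26266266, [([0x1a26a26], 0x1604626c248e4), ([0x1a04a26c24a04a04c06a26a04c04],
  0x1c10900a04c05a15a048a4a04c09)]⟩, ⟨2, 0, 2, 1, 0x1604626626c24266266, [([0x1a04a26a26a04],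
  0x18e4a04), ([0x1c24a04a04c06a26a04c04a04a26], 0x1c10920a04c05a15a26884a04c09a26a04c04a04a26)]⟩,
  ⟨2, 3, 2, 2, 0x1894a04a15a26a15c186152e6055, [([0x1c24a04a15c16a26a04c05a15a26],
  0x1c10920a04c05a15a26)]⟩, ⟨1, 3, 2, 3, 0x16154e6626c25266266, [([0x1a15c16a26a15c15a15a26c25a15],
  0x18a4a04a15a15a26c28a15), ([0x1c14a04a15c15a15a04c05a15a15], 0x1c10910a04c05a15a15)]⟩, ⟨0, 0, 2,
  0, 0x1a15a264a62e6069, [([0x1a15a26c26a26a15c16a26a26c25], 0x1604615c24c24),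
  ([0x1a04a15c14a04a04c05a15a04c04], 0x1c10900a04c05a15a04c04)]⟩, ⟨1, 0, 1, 2, 0x16262e6066,
  [([0x1626626c26c26], 0x1615c046044a5c28c24), ([0x1a15c14a04a15c15a15a04c05a15],
  0x1910c10a04a15c15a15a04c05a15)]⟩, ⟨1, 3, 1, 2, 0x1615604604c05244244, [([0x1a15a04a04a15],
  0x12a6a15a15a04a08a15), ([0x1a26a15a15a04], 0x1910c10a04a15c15a15a048e5a15a15a04)]⟩, ⟨0, 0, 1, 0,
  0x16156264a6c29266266, [([0x1615626c16615626615c25626], 0x1604615c244e4),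
  ([0x1a04a15c14a04a04c05a15a04c04], 0x1900c00a04a15c14a04a04c05a15a04c04)]⟩, ⟨0, 3, 2, 0,
  0x1604615c24c24a15a26c268aea15096266, [([0x1a04a15c14a04a04c05a15a04c04],
  0x1c10900a04c05a15a04c04)]⟩, ⟨1, 0, 1, 2, 0x1615c24a04c052e66264a4c28266266,
  [([0x1a15c14a04a15c15a15a04c05a15], 0x1910c10a04a15c15a15a04c05a15)]⟩, ⟨0, 0, 1, 1, 0x1a26266266,
  [([0x1a26a26], 0x1a26), ([0x1626626626c26], 0x1900c006046154e44a4c29)]⟩, ⟨2, 3, 2, 2,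
  0x1a04244244, [([0x1a04a04], 0x1c10920a048956152e6604c05a08)]⟩, ⟨1, 0, 2, 2, 0x1c24a040840ae,
  [([0x1c04604], 0x1c10910a04c05a15615c04604c05604)]⟩, ⟨1, 0, 1, 2, 0x1c24a040840ea, [([0x1c04604],
  0x1910c10a04a15c15615604c05c05a04604)]⟩, ⟨2, 3, 1, 2, 0x1a04244244, [([0x1a04a04],
  0x1295a04a04a04a08), ([0x1a15a04a04a04], 0x19204e0604615c16a04a15615615604c05)]⟩, ⟨0, 3, 2, 1,
  0x1a268e6266266, [([0x1626c26], 0x1c10900a048a5a15a04a04a26c29a04604c26626c24)]⟩, ⟨0, 3, 2, 0,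
  0x1c25a158952e62a6255, [([0x1c15615], 0x1604615c14c14a15615), ([0x1a04a15c14a04a04c05a15a04c04],
  0x1c10900a04c05a15a04c04)]⟩, ⟨1, 0, 2, 2, 0x1c24a04884a26c2aa04a048e6266244, [([0x1c04604],
  0x1615c04604c05604), ([0x1a15c14a04a15c15a15a04c05a15],
  0x1c10910a04c05a15a15c14a04a15c15a15a04c05a15)]⟩, ⟨0, 3, 3, 0, 0x1a15255255, [([0x1a15a15],
  0x1a15), ([0x1615615615c15], 0x18a08e0304a15a26626619615c16)]⟩, ⟨0, 3, 3, 0, 0x1a15255255,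
  [([0x1a15a15], 0x1a15), ([0x1615615615c15], 0x1c108a03044e5a15a26626619615c16)]⟩, ⟨0, 3, 2, 2,
  0x1a04244266, [([0x1a04a04a26a26], 0x18e0900a04295626a04a04a26a2a)]⟩, ⟨1, 0, 2, 3, 0x1a26266266,
  [([0x1a26a26], 0x1a26), ([0x1626626626c26], 0x1c105106044a54e5c28)]⟩, ⟨0, 0, 2, 1, 0x1a26266266,
  [([0x1a26a26], 0x1a26), ([0x1626626626c26], 0x1c109006044e56154a4626c29)]⟩, ⟨1, 0, 2, 3,
  0x1a26266266, [([0x1a26a26], 0x1c10510604c25c25a04a268a6a268e8)]⟩, ⟨0, 3, 2, 0, 0x1a15255255,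
  [([0x1a15a15], 0x1c10900604c25a158a46262e6615c16a19)]⟩, ⟨1, 0, 2, 2, 0x1c24a04c04a26a268842440ea,
  [([0x1c04604], 0x1c10510604c05c05a04604)]⟩, ⟨0, 3, 1, 0, 0x1295a15a15a2626a255,
  [([0x1a15a15a15a26], 0x1a158e5), ([0x1615c15], 0x1900c00604615c14c14a15)]⟩, ⟨0, 3, 2, 0,
  0x1604626615c142a6615a15a15255259, [([0x1a04a26a15a04], 0x1c10900a048e5a15a04)]⟩, ⟨2, 0, 2, 2,
  0x1a04a154962e6058, [([0x1a04a15c16a26a04c05a15a26c24], 0x1c10920a04c05a15a26c24)]⟩, ⟨2, 3, 1, 2,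
  0x1295284244, [([0x1a15a04a04a04], 0x1a04), ([0x1604615604c04a15a04604604615c04],
  0x1626604615c06), ([0x1a26a04a15a26], 0x19208e0a04a15a26a26a04a15a26)]⟩, ⟨1, 0, 2, 3,
  0x16156266044a5626c28266266, [([0x1a15a26a04a15], 0x1c10910a04c05a15a158e4a04a15)]⟩, ⟨0, 0, 2, 1,
  0x1a26266266, [([0x1a26a26], 0x1604615626c24a15a266266266154a6626c29a26), ([0x1a04a15a26a04],
  0x18e0900a04a15a26a04)]⟩, ⟨0, 0, 2, 1, 0x1a15a260a609e, [([0x1a15a26c26a26a15c16a26a26c25],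
  0x1604615c24c24), ([0x1a04a15c14a04a04c05a15a04c04], 0x1c10900a04c05a15a04c04)]⟩, ⟨2, 0, 1, 2,
  0x14e4604615496c18255255, [([0x1c24a04a15c16a26a04c05a15a26],
  0x1920c20a04a15c16a26a04c05a15a26)]⟩, ⟨2, 0, 1, 4, 0x1c16a26a040850e9,
  [([0x1c16a26a04c05a15a26c24a04a15], 0x1920c20a04a15c16a26a04c05a15a26c24a04a15)]⟩, ⟨0, 0, 1, 0,
  0x1604c25a150940ea, [([0x1a04c05a15a04c04a04a15c14a04], 0x1900c00a04a15c14a04)]⟩, ⟨1, 3, 2, 2,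
  0x18a4a04a156152e6058, [([0x1c14a04a15c15a15a04c05a15a15], 0x1c10910a04c05a15a15)]⟩, ⟨1, 3, 2, 2,
  0x18a4a04a15a152e6c18255255, [([0x1c14a04a15c15a15a04c05a15a15], 0x1c10910a04c05a15a15)]⟩, ⟨1, 0,
  2, 2, 0x1a04a158a5a15c186152e6055, [([0x1a04a15c15a15a04c05a15a15c14],
  0x1c10910a04c05a15a15c14)]⟩, ⟨1, 0, 1, 2, 0x1615c24a040850ea, [([0x1a15c14a04a15c15a15a04c05a15],
  0x1910c10a04a15c15a15a04c05a15)]⟩, ⟨1, 0, 1, 2, 0x1615c24a04c0508e04a,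
  [([0x1a15c14a04a15c15a15a04c05a15], 0x1910c10a04a15c15a15a04c05a15)]⟩, ⟨2, 0, 2, 2,
  0x1604615604494615c18a15a15255255, [([0x1a04a15a04a04], 0x1c10920a04c05a152e6c04)]⟩, ⟨0, 0, 1, 0,
  0x1604c25a15c1409e05a, [([0x1a04c05a15a04c04a04a15c14a04], 0x1900c00a04a15c14a04)]⟩, ⟨0, 3, 2, 0,
  0x1604a15c14894a2e0a5255, [([0x1a04a15c14a04a04c05a15a04c04], 0x1c10900a04c05a15a04c04)]⟩, ⟨2, 3,
  1, 0, 0x1615604604c05244244, [([0x1a15a04a04a15], 0x1284a15a04a04a19), ([0x1a04a15a04a04],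
  0x19204e0604615c16a04a15615615604c05a15a04a04)]⟩, ⟨2, 4, 2, 0, 0x1a15255244, [([0x1a15a15a04a04],
  0x1494615604a15a15a04a08), ([0x1c04a15a04604604615c04604615604], 0x18e0520604615c06604615604)]⟩,
  ⟨2, 0, 2, 1, 0x1626604604c06244244, [([0x1a26a04a04a26], 0x1c10920a04c05a15a26884a048e9)]⟩, ⟨1, 0,
  2, 2, 0x16156044a5c250e8266, [([0x1a15a04c05a15a15c14a04a15c15],
  0x1c10910a04c05a15a15c14a04a15c15)]⟩, ⟨0, 3, 2, 1, 0x16042e6044,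
  [([0x1a04a26c24a04a04c06a26a04c04], 0x1c10900a048a5a15a04a04a26c29a04a04c06a26a04c04)]⟩, ⟨0, 3, 2,
  1, 0x1604c262660e4, [([0x1a04c06a26a04c04a04a26c24a04], 0x1c10900a048a5a15a04a04a26c29a04)]⟩, ⟨0,
  0, 2, 0, 0x1604615c24894a158ea266255, [([0x1a04a15c14a04a04c05a15a04c04],
  0x1c10900a04c05a15a04c04)]⟩, ⟨0, 3, 2, 1, 0x16044e6626c24266266,
  [([0x1a04c06a26a04c04a04a26c24a04], 0x1c10900a048a5a15a04a04a26c29a04)]⟩, ⟨0, 3, 2, 0,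
  0x1604c25a158942e62a6255, [([0x1a04c05a15a04c04a04a15c14a04],
  0x1c10900a04c05a15a04c04a04a15c14a04)]⟩, ⟨0, 3, 2, 0, 0x1604c25a158942e6a26a1525526a,
  [([0x1a04c05a15a04c04a04a15c14a04], 0x1c10900a04c05a15a04c04a04a15c14a04)]⟩, ⟨1, 0, 1, 2,
  0x1615604c25c25a04a26c260ae068, [([0x1a15a04c05a15a15c14a04a15c15],
  0x1910c10a04a15c15a15a04c05a15a15c14a04a15c15)]⟩, ⟨1, 3, 2, 2, 0x18a4a04a15615a26c28c2526e066,
  [([0x1c14a04a15c15a15a04c05a15a15], 0x1c10910a04c05a15a15)]⟩, ⟨1, 0, 2, 2,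
  0x16154e46044a5626c28266266, [([0x1a15c14a04a15c15a15a04c05a15],
  0x1c10910a04c05a15a15c14a04a15c15a15a04c05a15)]⟩, ⟨0, 0, 1, 0, 0x1604c156154a4c29c256262e6066,
  [([0x1a04c05a15a04c04a04a15c14a04], 0x1900c00a04a15c14a04)]⟩, ⟨2, 3, 1, 0, 0x1295284255,
  [([0x1a15a04a15a15], 0x1a15), ([0x1615615604c05a15a04604604615c14a04a15],
  0x19204e0604615c16a04a15)]⟩, ⟨2, 3, 1, 2, 0x1295a04244284, [([0x1a15a04a04a04],
  0x19204e0604615c16a04a15615615604c05)]⟩, ⟨2, 0, 1, 4, 0x1a26266244, [([0x1a26a26a04a04],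
  0x1920c20a04a15c16a26a048858e9a26a04a04)]⟩, ⟨1, 0, 1, 3, 0x16156046264a5c28266266,
  [([0x1a15a04a26a15], 0x1910c10a04a15c15a15a048e5a15)]⟩, ⟨1, 0, 2, 2, 0x1c24a0408e0a6,
  [([0x1c24a04a26c26a26a04c06a26a26],
  0x1c10910a04c05a15a15c14a04a15c15a15a04c05a15615c24a04c05a26a26)]⟩, ⟨1, 4, 1, 2, 0x1a04244244,
  [([0x1a04a04], 0x15104a0604c052e6604c08a04)]⟩, ⟨0, 3, 3, 0, 0x1a15255255, [([0x1a15a15],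
  0x1c108a0304c15a152e6615c19a15)]⟩, ⟨1, 0, 1, 2, 0x1a260e4244, [([0x1a26c24a04a04c06a26a04c04a04],
  0x1510c20a04885c0aa26a04c04a04)]⟩, ⟨1, 0, 1, 2, 0x1a26266244, [([0x1a26a26a04a04],
  0x1510c20a048858eaa26a04a04)]⟩, ⟨1, 4, 2, 3, 0x12a64862e6244, [([0x1a26c26a26a04c06a26a26c24a04],
  0x1c10510604c25c25a04)]⟩, ⟨1, 4, 2, 3, 0x12a6c266266042e6086, [([0x1a26c26a26a04c06a26a26c24a04],
  0x1c10510604c25c25a04)]⟩, ⟨1, 3, 2, 5, 0x18a4a04a15a15a260e8255,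
  [([0x1c14a04a15c15a15a04c05a15a15], 0x1c10910a04c05a15a15)]⟩, ⟨0, 3, 2, 0, 0x18a5a15096266,
  [([0x1c25a15c16c16a26c25], 0x1c10900604c25a15c14a26c2e)]⟩, ⟨1, 0, 2, 2, 0x1604c262660e4,
  [([0x1a04c06a26a04c04a04a26c24a04], 0x1c10510604c058a5a04c08a04a26c24a04)]⟩, ⟨0, 0, 1, 1,
  0x1a15a26c260ae069, [([0x1a15a26c26a26a15c16a26a26c25], 0x1900c00604615c24c24)]⟩, ⟨0, 3, 1, 0,
  0x1295a26a1525526a, [([0x1a15a26a15a15], 0x1900c00604615c148e4a15a15)]⟩, ⟨0, 0, 1, 1,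
  0x1c26a26a150960ea, [([0x1c26a26a15c16a26a26c25a15a26], 0x1900c00604615c24c24a15a26)]⟩, ⟨0, 0, 1,
  0, 0x1a260e5255, [([0x1a26c25a15a15c16a26a15c15a15], 0x1900c00604615c24c24a15a26896c1aa15)]⟩, ⟨0,
  0, 1, 1, 0x1c26a26a158968ea266255, [([0x1c26a26a15c16a26a26c25a15a26],
  0x1900c00604615c24c24a15a26)]⟩, ⟨1, 0, 2, 3, 0x1c0ea268a4c24c28266066,
  [([0x1a26a26c24a04a26c26a26a04c06], 0x1c10910a04c05a15615c24a04c05)]⟩, ⟨1, 0, 1, 3,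
  0x1a04a26c260ae068, [([0x1a04a26c26a26a04c06a26a26c24], 0x1910c10a04a15c15615604c25c25)]⟩, ⟨1, 0,
  1, 3, 0x1c2ea04c0608604a, [([0x1a26a04c06a26a26c24a04a26c26],
  0x1910c10a04a15c15615604c25c25a04a26c26)]⟩, ⟨1, 0, 1, 3, 0x1c26a26a048868ea266244,
  [([0x1c26a26a04c06a26a26c24a04a26], 0x1910c10a04a15c15615604c25c25a04a26)]⟩, ⟨0, 0, 1, 0,
  0x1615626615c256266156264a6c29266266, [([0x1a15a26a15a15], 0x1604615626c14), ([0x1a04a15a26a04],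
  0x1900c00a04a158e4a04)]⟩, ⟨2, 0, 1, 0, 0x1c162e6604485c09244244,
  [([0x1c16a26a04c05a15a26c24a04a15], 0x1920c20a04a15c16a26a04c05a15a26c24a04a15)]⟩, ⟨2, 0, 2, 0,
  0x18e0520604615486604c09244244, []⟩, ⟨0, 3, 2, 0, 0x1c10900a048a5a15a046042e6049, []⟩, ⟨1, 0, 1,
  2, 0x1910c10a04a15c15615604c250a50e8, []⟩, ⟨0, 3, 2, 0, 0x1c10900a048a5a15a04a042e6c09244244, []⟩,
  ⟨0, 0, 2, 0, 0x1c10900a04c05a15a048a4a04c096042e6044, []⟩, ⟨0, 0, 2, 0,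
  0x1c10900a04c05a15a04c04604615c248942550ea, []⟩, ⟨2, 4, 2, 0,
  0x18e0520604615486604615a04a04a15619604604c05244244, []⟩, ⟨1, 0, 2, 2,
  0x1c10910a04c05a15a15c14a04a15c15615a04c05c05a2e0a4084, []⟩, ⟨2, 4, 2, 0,
  0x18e0520604615c06a04a15a04a04604615604494615604a15255284, []⟩, ⟨1, 0, 2, 2,
  0x1c10910a04c05a15a15c14a04a15c15a15a04c05a15615c24a040850ae, []⟩, ⟨2, 4, 2, 2,
  0x18e0520604615c16a04a15615615604c15615604615485604615a04244295, []⟩, ⟨2, 4, 2, 2, 0x1a04244255,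
  [([0x1a04a04a15a15], 0x18e0520604615c16a04a15615615604c15615604615485604615a04a04a15a19)]⟩, ⟨2, 3,
  1, 2, 0x1615604604c05244244, [([0x1a15a04a04a15], 0x1295a04a15a15a08a04a15), ([0x1a15a04a15a15],
  0x19204e0604615c16a04a15a15)]⟩, ⟨0, 0, 1, 0, 0x1900c00a04a15c14a046044a5c290e4266, []⟩, ⟨0, 3, 2,
  0, 0x1c10900a048a5a15a04a04a264e9604604c06244244, []⟩, ⟨2, 0, 2, 1,
  0x18e0920a04a15a26626604615486604c09244244, []⟩, ⟨1, 0, 2, 2,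
  0x1c10910a04c05a15a15c14a04a15c15615604c25c25a0408e0a6, []⟩, ⟨0, 3, 2, 1,
  0x1c10900a048a5a15a04a04a26c29a04a04c06a26a04c04604a26c24c2426e066, []⟩, ⟨0, 0, 1, 0,
  0x1604c25a158948ea266255, [([0x1a04c05a15a04c04a04a15c14a04], 0x1900c00a04a15c14a04)]⟩, ⟨2, 3, 1,
  0, 0x1615604604c05244244, [([0x1a15a04a04a15],
  0x1920c20a04a15c162e6604c15615604615c05a04a15284a04a04a15a19a04a04a15)]⟩, ⟨0, 3, 2, 1,
  0x1604626626c24266266, [([0x1a04a26a26a04], 0x18e6a26a04), ([0x1c06a26a04c04a04a26c24a04a04],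
  0x1c10900a048a5a15a04a04a26c29a04a04)]⟩, ⟨1, 0, 2, 2,
  0x1c10910a04c05a15a15c14a04a158a5a15c18615626c250e5266, []⟩, ⟨0, 0, 1, 1,
  0x1900c006046154e44a4c29266266, []⟩, ⟨0, 3, 2, 2, 0x1c10900a04895615a04a048e526a244, []⟩, ⟨1, 0,
  2, 2, 0x1c10910a04c05a15615c24a040850ae, []⟩, ⟨1, 0, 2, 2,
  0x1c10910a04c05a15615c04604c25a040840ae, []⟩, ⟨1, 0, 2, 2,
  0x1c10910a04c05a15615c24a04885c0ec0a244044, []⟩, ⟨1, 3, 2, 2, 0x14e4604c042a6604284244,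
  [([0x1c04604], 0x1c10910a04c05a15615c04604c05604)]⟩, ⟨1, 0, 1, 2,
  0x1910c10a04a15c15a15a04c05a15615c04604c25a04c0408e04a, []⟩, ⟨1, 0, 1, 3,
  0x1910c10a04a15c156156044e54a5c28266266, []⟩, ⟨0, 3, 2, 0,
  0x1c10900a04c05a15a04c04a04a158e4a04604615626c14a152a6615295255, []⟩, ⟨1, 0, 1, 2,
  0x1510c20a04c0588ec0ac04244044, []⟩, ⟨0, 4, 2, 2, 0x1490500604c25a04a04c0ac0e244044, []⟩, ⟨0, 3,
  2, 0, 0x1c10900604c25a158942e62a6255, []⟩, ⟨1, 0, 2, 2, 0x1c06a260a4084,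
  [([0x1c06a26c24c24a04c06], 0x1c10510604c25c25a04c0e)]⟩, ⟨2, 0, 1, 4,
  0x1920c20a04a15c16a26a040850e9, []⟩, ⟨0, 0, 1, 0, 0x1900c00604a15c14c14a2ec250a5069, []⟩, ⟨2, 3,
  2, 2, 0x1c10920a04895615a26a04c05608626c240e4266, []⟩, ⟨0, 3, 1, 1,
  0x1900c00604615c24c24a15a26c26a26a15c162a62e6c15255259, []⟩, ⟨0, 3, 2, 1,
  0x1c10900a048a5a15a04604626c290e4266, []⟩, ⟨0, 3, 2, 1, 0x1c10900a048a5a15a04604a26c29c2426e066,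
  []⟩, ⟨0, 3, 2, 1, 0x1a26266266, [([0x1a26a26], 0x1a26), ([0x1626626626c26],
  0x1c10900a048a5a15a046046264e9c24)]⟩, ⟨1, 0, 2, 2,
  0x1c10910a04c05a15615c24a04c05a26a26c24a0408e0a6, []⟩, ⟨1, 3, 2, 2,
  0x1c10910a04c05a15615c24a048a5626a26a04c06608626c240e4266, []⟩, ⟨0, 0, 1, 0,
  0x1604c25a15c14a26a26c25a15a26c260ae069, [([0x1a04c05a15a04c04a04a15c14a04],
  0x1900c00a04a15c14a04)]⟩, ⟨0, 0, 2, 0, 0x16046154e4c24a15a266266266154a6626c29266266,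
  [([0x1a04a15c14a04a04c05a15a04c04], 0x1c10900a04c05a15a04c04)]⟩]

/-- The lengths in `evenCodes`. -/
def evenLengths : List (Vec × List Vec) := [
  ((26, 11, 5), [(4, 2, 2), (4, 4, 0), (8, 0, 0), (4, 0, 0)]), ((16, 27, 17), [(12, 0, 6), (0, 4,
  4), (0, 6, 2), (0, 8, 0), (4, 2, 2), (0, 4, 0)]), ((26, 15, 11), [(20, 20, 0), (6, 14, 0), (14, 6,
  0), (8, 8, 0), (2, 2, 4), (6, 2, 0), (8, 0, 0), (4, 0, 0)]), ((26, 29, 9), [(6, 6, 6), (0, 8, 0),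
  (2, 2, 4), (4, 4, 0), (6, 2, 0), (0, 4, 0)]), ((14, 27, 17), [(0, 6, 14), (12, 6, 0), (0, 8, 8),
  (0, 2, 6), (0, 4, 4), (0, 8, 0), (4, 2, 2), (0, 4, 0)]), ((36, 23, 9), [(6, 14, 0), (6, 6, 6), (8,
  8, 0), (2, 2, 4), (2, 6, 0), (4, 4, 0), (6, 2, 0), (8, 0, 0), (4, 0, 0)]), ((28, 15, 3), [(4, 2,
  2), (4, 4, 0), (8, 0, 0), (4, 0, 0)]), ((18, 19, 13), [(0, 14, 6), (12, 0, 6), (0, 8, 8), (0, 6,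
  2), (0, 8, 0), (4, 2, 2), (0, 4, 0)]), ((26, 13, 13), [(20, 20, 0), (14, 6, 0), (6, 6, 6), (8, 8,
  0), (2, 2, 4), (6, 2, 0), (8, 0, 0), (4, 0, 0)]), ((14, 19, 11), [(0, 14, 6), (12, 0, 6), (0, 8,
  8), (0, 6, 2), (0, 8, 0), (4, 2, 2), (0, 4, 0)]), ((36, 25, 9), [(12, 12, 0), (6, 14, 0), (6, 6,
  6), (2, 2, 4), (2, 6, 0), (4, 4, 0), (6, 2, 0), (8, 0, 0), (4, 0, 0)]), ((28, 13, 9), [(12, 12,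
  0), (14, 6, 0), (6, 6, 6), (2, 2, 4), (6, 2, 0), (8, 0, 0), (4, 0, 0)]), ((16, 23, 17), [(12, 0,
  6), (0, 4, 4), (0, 6, 2), (4, 2, 2)]), ((16, 25, 15), [(12, 6, 0), (0, 2, 6), (0, 8, 0), (4, 2,
  2), (0, 4, 0)]), ((16, 23, 3), [(0, 8, 0), (4, 2, 2), (4, 4, 0), (0, 4, 0)]), ((22, 25, 9), [(6,
  6, 6), (0, 8, 0), (2, 2, 4), (6, 2, 0), (0, 4, 0)]), ((14, 23, 17), [(0, 6, 14), (0, 14, 6), (12,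
  6, 0), (0, 8, 8), (0, 2, 6), (0, 4, 4), (0, 6, 2), (4, 2, 2)]), ((18, 21, 3), [(0, 8, 0), (4, 2,
  2), (4, 4, 0), (0, 4, 0)]), ((14, 23, 19), [(0, 12, 12), (12, 6, 0), (0, 2, 6), (0, 4, 4), (4, 2,
  2)]), ((28, 19, 13), [(6, 14, 0), (14, 6, 0), (6, 6, 6), (8, 8, 0), (2, 2, 4), (2, 6, 0), (6, 2,
  0), (8, 0, 0), (4, 0, 0)]), ((16, 21, 11), [(20, 20, 0), (14, 6, 0), (8, 8, 0), (0, 8, 0), (2, 2,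
  4), (6, 2, 0), (0, 4, 0)]), ((20, 23, 19), [(12, 0, 6), (0, 4, 4), (0, 6, 2), (4, 2, 2)]), ((24,
  15, 11), [(6, 14, 0), (14, 6, 0), (8, 8, 0), (2, 2, 4), (2, 6, 0), (6, 2, 0), (8, 0, 0), (4, 0,
  0)]), ((14, 13, 7), [(12, 0, 6), (0, 8, 0), (4, 2, 2), (0, 4, 0)]), ((16, 25, 19), [(12, 6, 0),
  (0, 2, 6), (0, 4, 4), (4, 2, 2)]), ((18, 11, 7), [(2, 4, 2), (8, 0, 0), (4, 0, 0)]), ((28, 17, 9),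
  [(6, 14, 0), (14, 6, 0), (6, 6, 6), (2, 2, 4), (6, 2, 0), (8, 0, 0), (4, 0, 0)]), ((10, 17, 9),
  [(0, 20, 0), (0, 18, 0), (12, 6, 0), (0, 16, 0), (0, 0, 4), (0, 4, 0)]), ((12, 15, 9), [(12, 0,
  6), (0, 8, 0), (4, 2, 2), (0, 4, 0)]), ((34, 21, 11), [(6, 14, 0), (8, 8, 0), (2, 2, 4), (2, 6,
  0), (4, 4, 0), (6, 2, 0), (8, 0, 0), (4, 0, 0)]), ((22, 13, 13), [(20, 20, 0), (14, 6, 0), (6, 6,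
  6), (8, 8, 0), (2, 2, 4), (6, 2, 0)]), ((24, 13, 7), [(6, 6, 6), (4, 4, 0), (8, 0, 0), (4, 0,
  0)]), ((10, 15, 13), [(12, 0, 6), (0, 4, 4), (0, 8, 0), (0, 4, 0)]), ((30, 15, 5), [(6, 6, 6), (4,
  4, 0), (6, 2, 0), (8, 0, 0), (4, 0, 0)]), ((20, 9, 9), [(6, 6, 6), (2, 4, 2), (8, 0, 0), (4, 0,
  0)]), ((22, 15, 11), [(20, 20, 0), (6, 14, 0), (14, 6, 0), (8, 8, 0), (2, 2, 4), (2, 6, 0), (6, 2,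
  0)]), ((18, 21, 17), [(0, 6, 14), (0, 14, 6), (0, 20, 0), (12, 6, 0), (0, 8, 8), (0, 16, 0), (0,
  0, 8), (0, 2, 6), (0, 0, 4), (0, 4, 0)]), ((16, 11, 7), [(2, 4, 2), (8, 0, 0), (4, 0, 0)]), ((12,
  21, 11), [(0, 20, 0), (0, 18, 0), (12, 6, 0), (0, 16, 0), (0, 0, 4), (0, 4, 0)]), ((16, 23, 11),
  [(0, 20, 0), (12, 6, 0), (0, 16, 0), (0, 0, 4), (0, 4, 0)]), ((22, 11, 9), [(14, 0, 6), (8, 0, 8),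
  (2, 4, 2), (6, 0, 2), (8, 0, 0), (4, 0, 0)]), ((12, 19, 11), [(0, 6, 14), (12, 6, 0), (0, 8, 8),
  (0, 2, 6), (0, 6, 2), (4, 2, 2)]), ((14, 15, 11), [(0, 14, 6), (12, 0, 6), (0, 8, 8), (0, 6, 2),
  (4, 2, 2)]), ((14, 25, 19), [(0, 14, 6), (12, 0, 6), (0, 4, 4), (0, 6, 2), (4, 2, 2)]), ((18, 15,
  13), [(0, 14, 6), (12, 0, 6), (0, 8, 8), (0, 6, 2), (4, 2, 2)]), ((20, 25, 9), [(12, 12, 0), (14,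
  6, 0), (6, 6, 6), (0, 8, 0), (2, 2, 4), (6, 2, 0), (0, 4, 0)]), ((22, 11, 5), [(4, 2, 2), (4, 4,
  0)]), ((32, 23, 9), [(6, 14, 0), (6, 6, 6), (8, 8, 0), (2, 2, 4), (2, 6, 0), (4, 4, 0), (6, 2,
  0)]), ((24, 11, 9), [(14, 6, 0), (6, 6, 6), (8, 8, 0), (6, 2, 0), (8, 0, 0), (4, 0, 0)]), ((16,
  15, 13), [(0, 14, 6), (12, 6, 0), (0, 8, 8), (0, 6, 2), (4, 2, 2)]), ((20, 21, 11), [(20, 20, 0),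
  (6, 14, 0), (14, 6, 0), (8, 8, 0), (2, 2, 4), (2, 6, 0), (4, 4, 0), (6, 2, 0)]), ((16, 25, 13),
  [(0, 20, 20), (0, 14, 6), (12, 6, 0), (0, 8, 8), (0, 0, 8), (0, 8, 0), (0, 0, 4), (0, 4, 0)]),
  ((20, 13, 11), [(20, 20, 0), (6, 14, 0), (8, 8, 0), (2, 2, 4), (2, 6, 0), (8, 0, 0), (4, 0, 0)]),
  ((16, 19, 3), [(4, 2, 2), (4, 4, 0)]), ((6, 15, 9), [(0, 20, 0), (0, 18, 0), (0, 16, 0), (0, 0,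
  4), (0, 4, 0)]), ((16, 23, 13), [(0, 14, 6), (12, 0, 6), (0, 6, 2), (0, 8, 0), (4, 2, 2), (0, 4,
  0)]), ((24, 15, 3), [(4, 2, 2), (4, 4, 0)]), ((20, 25, 3), [(0, 8, 0), (4, 2, 2), (4, 4, 0), (0,
  4, 0)]), ((14, 17, 11), [(20, 20, 0), (14, 6, 0), (8, 8, 0), (2, 2, 4), (2, 6, 0), (6, 2, 0)]),
  ((12, 23, 15), [(0, 14, 6), (12, 6, 0), (0, 8, 8), (0, 0, 8), (0, 6, 2), (0, 0, 4), (0, 4, 0)]),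
  ((14, 21, 15), [(0, 14, 6), (12, 0, 6), (0, 2, 6), (0, 6, 2), (0, 8, 0), (4, 2, 2), (0, 4, 0)]),
  ((16, 17, 7), [(12, 0, 6), (0, 8, 0), (4, 4, 0), (0, 4, 0)]), ((14, 19, 9), [(0, 20, 0), (0, 18,
  0), (12, 6, 0), (0, 16, 0), (0, 0, 4), (0, 4, 0)]), ((10, 17, 11), [(0, 20, 0), (0, 18, 0), (12,
  6, 0), (0, 16, 0), (0, 0, 8), (0, 0, 4), (0, 4, 0)]), ((14, 19, 11), [(0, 20, 0), (0, 18, 0), (12,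
  6, 0), (0, 16, 0), (0, 0, 8), (0, 0, 4), (0, 4, 0)]), ((10, 23, 11), [(0, 0, 18), (12, 6, 0), (0,
  0, 16), (0, 16, 0), (0, 8, 0), (0, 0, 4), (0, 4, 0)]), ((14, 17, 13), [(0, 12, 12), (0, 14, 6),
  (12, 6, 0), (0, 2, 6), (0, 6, 2), (4, 2, 2)]), ((20, 21, 13), [(0, 14, 6), (0, 20, 0), (12, 6, 0),
  (0, 8, 8), (0, 0, 8), (0, 0, 4), (0, 4, 0)]), ((12, 23, 13), [(0, 14, 6), (0, 20, 0), (12, 6, 0),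
  (0, 8, 8), (0, 0, 8), (0, 8, 0), (0, 0, 4), (0, 4, 0)]), ((16, 19, 13), [(0, 12, 12), (12, 6, 0),
  (0, 2, 6), (0, 6, 2), (4, 2, 2)]), ((24, 17, 9), [(20, 20, 0), (6, 14, 0), (14, 6, 0), (6, 6, 6),
  (8, 8, 0), (2, 2, 4), (2, 6, 0), (6, 2, 0)]), ((18, 15, 7), [(12, 0, 6), (0, 8, 0), (4, 4, 0), (0,
  4, 0)]), ((12, 19, 3), [(0, 8, 0), (4, 2, 2), (0, 4, 0)]), ((22, 23, 3), [(0, 8, 0), (4, 2, 2),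
  (4, 4, 0), (0, 4, 0)]), ((18, 15, 11), [(0, 14, 6), (12, 0, 6), (0, 8, 8), (0, 8, 0), (0, 4, 0)]),
  ((18, 9, 5), [(4, 4, 0), (8, 0, 0), (4, 0, 0)]), ((20, 9, 7), [(6, 6, 6), (12, 6, 0), (8, 0, 0),
  (4, 0, 0)]), ((18, 17, 3), [(4, 2, 2), (4, 4, 0)]), ((8, 15, 13), [(0, 14, 6), (0, 20, 0), (0, 8,
  8), (0, 16, 0), (0, 0, 8), (0, 0, 4), (0, 4, 0)]), ((16, 17, 15), [(12, 0, 6), (0, 8, 8), (0, 8,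
  0), (4, 2, 2), (0, 4, 0)]), ((20, 19, 15), [(0, 14, 6), (12, 0, 6), (0, 6, 2), (4, 2, 2)]), ((14,
  17, 3), [(0, 8, 0), (4, 2, 2), (0, 4, 0)]), ((8, 19, 11), [(0, 20, 0), (0, 18, 0), (0, 16, 0), (0,
  0, 4), (0, 4, 0)]), ((22, 15, 9), [(6, 14, 0), (6, 6, 6), (8, 8, 0), (2, 2, 4), (2, 6, 0), (8, 0,
  0), (4, 0, 0)]), ((14, 27, 11), [(14, 6, 0), (8, 8, 0), (2, 2, 4), (6, 2, 0), (0, 4, 0)]), ((16,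
  15, 15), [(0, 14, 6), (12, 6, 0), (0, 8, 8), (0, 0, 8), (0, 6, 2), (0, 0, 4)]), ((4, 17, 11), [(0,
  20, 0), (0, 18, 0), (0, 16, 0), (0, 0, 4), (0, 4, 0)]), ((6, 15, 11), [(0, 20, 0), (0, 18, 0), (0,
  16, 0), (0, 0, 8), (0, 0, 4), (0, 4, 0)]), ((12, 17, 13), [(0, 14, 6), (0, 18, 0), (12, 6, 0), (0,
  8, 8), (0, 16, 0), (0, 0, 8), (0, 0, 4), (0, 4, 0)]), ((18, 9, 9), [(6, 6, 6), (8, 0, 0), (4, 0,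
  0)]), ((22, 17, 9), [(12, 12, 0), (6, 14, 0), (6, 6, 6), (2, 6, 0), (8, 0, 0), (4, 0, 0)]), ((10,
  11, 7), [(12, 6, 0), (0, 4, 4)]), ((14, 17, 9), [(12, 6, 0), (0, 8, 8), (0, 6, 2), (4, 2, 2)]),
  ((2, 15, 9), [(0, 4, 4), (0, 8, 0), (0, 4, 0)]), ((2, 17, 11), [(0, 20, 0), (0, 16, 0), (0, 0, 8),
  (0, 0, 4), (0, 4, 0)]), ((10, 21, 7), [(0, 12, 12), (0, 6, 2), (4, 2, 2), (0, 4, 0)]), ((22, 9,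
  3), [(4, 4, 0), (8, 0, 0), (4, 0, 0)]), ((20, 7, 5), [(4, 4, 0), (8, 0, 0), (4, 0, 0)]), ((16, 9,
  7), [(6, 6, 6), (12, 6, 0), (8, 0, 0)]), ((20, 17, 7), [(12, 0, 6), (12, 6, 0), (4, 4, 0)]), ((10,
  11, 5), [(0, 14, 6), (0, 8, 8), (0, 6, 2), (4, 2, 2)]), ((12, 15, 11), [(0, 12, 6), (12, 6, 0),
  (0, 0, 4)]), ((14, 15, 11), [(20, 20, 0), (14, 6, 0), (8, 8, 0), (2, 2, 4), (6, 2, 0)]), ((4, 13,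
  9), [(0, 4, 4), (2, 4, 2)]), ((16, 7, 7), [(6, 6, 6), (8, 0, 0), (4, 0, 0)]), ((20, 11, 9), [(14,
  6, 0), (6, 6, 6), (8, 8, 0), (6, 2, 0)]), ((18, 19, 3), [(0, 8, 0), (4, 2, 2), (0, 4, 0)]), ((10,
  13, 5), [(0, 8, 0), (4, 2, 2), (0, 4, 0)]), ((14, 19, 5), [(0, 8, 0), (4, 2, 2), (0, 4, 0)]),
  ((14, 15, 7), [(0, 20, 20), (12, 6, 0), (0, 8, 8), (0, 6, 2), (4, 2, 2)]), ((12, 17, 11), [(0, 12,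
  12), (12, 6, 0), (0, 2, 6), (0, 6, 2)]), ((16, 13, 11), [(20, 20, 0), (6, 14, 0), (8, 8, 0), (2,
  2, 4), (2, 6, 0)]), ((4, 23, 9), [(0, 16, 0), (0, 8, 0), (0, 0, 4), (0, 4, 0)]), ((8, 19, 11),
  [(0, 8, 8), (0, 2, 6), (0, 8, 0), (4, 2, 2), (0, 4, 0)]), ((18, 11, 7), [(6, 14, 0), (8, 8, 0),
  (2, 6, 0), (8, 0, 0), (4, 0, 0)]), ((22, 15, 7), [(12, 12, 0), (6, 14, 0), (6, 6, 6), (2, 6, 0),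
  (8, 0, 0), (4, 0, 0)]), ((18, 17, 15), [(0, 6, 12), (12, 6, 0), (0, 4, 4)]), ((2, 19, 11), [(0, 4,
  4), (0, 8, 0), (0, 4, 0)]), ((6, 21, 9), [(0, 16, 0), (0, 8, 0), (0, 0, 4), (0, 4, 0)]), ((10, 13,
  7), [(0, 14, 6), (0, 8, 8), (0, 6, 2), (4, 2, 2)]), ((14, 17, 17), [(12, 0, 6), (0, 8, 0), (4, 2,
  2), (0, 4, 0)]), ((24, 9, 5), [(12, 6, 0), (4, 4, 0), (8, 0, 0), (4, 0, 0)]), ((22, 7, 7), [(6, 6,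
  6), (8, 0, 0), (4, 0, 0)]), ((22, 9, 7), [(12, 12, 0), (14, 6, 0), (6, 6, 6), (6, 2, 0), (8, 0,
  0), (4, 0, 0)]), ((18, 17, 7), [(6, 6, 6), (12, 6, 0), (4, 4, 0)]), ((16, 17, 9), [(0, 20, 0),
  (12, 6, 0), (0, 8, 0), (0, 0, 4)]), ((2, 17, 9), [(0, 16, 0), (0, 0, 4), (0, 4, 0)]), ((8, 13,
  11), [(0, 8, 8), (0, 8, 0), (0, 4, 0)]), ((12, 9, 7), [(12, 0, 6), (0, 4, 0)]), ((26, 11, 3), [(4,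
  4, 0), (6, 2, 0), (4, 0, 0)]), ((26, 15, 5), [(6, 6, 6), (4, 4, 0), (6, 2, 0)]), ((20, 13, 7),
  [(6, 6, 6), (4, 4, 0)]), ((32, 25, 9), [(6, 6, 6), (2, 6, 0), (4, 4, 0), (6, 2, 0)]), ((18, 11,
  9), [(14, 0, 6), (8, 0, 8), (2, 4, 2), (6, 0, 2)]), ((14, 13, 3), [(4, 2, 2)]), ((16, 21, 3), [(0,
  8, 0), (4, 2, 2), (0, 4, 0)]), ((10, 9, 5), [(4, 2, 2)]), ((12, 15, 5), [(12, 6, 0), (0, 6, 2),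
  (4, 2, 2)]), ((16, 23, 7), [(6, 6, 6), (12, 6, 0), (0, 4, 0)]), ((20, 17, 13), [(0, 14, 6), (12,
  6, 0), (0, 8, 8), (0, 0, 4)]), ((4, 11, 9), [(0, 20, 0), (0, 18, 0), (0, 8, 0), (0, 0, 4)]), ((4,
  17, 9), [(0, 8, 8), (0, 2, 6), (0, 8, 0), (0, 4, 0)]), ((4, 13, 13), [(0, 14, 6), (0, 8, 8), (0,
  16, 0), (0, 0, 4), (0, 4, 0)]), ((8, 13, 5), [(0, 6, 2), (4, 2, 2)]), ((8, 11, 7), [(4, 2, 2)]),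
  ((8, 25, 9), [(0, 8, 0), (0, 0, 4), (0, 4, 0)]), ((10, 15, 7), [(0, 14, 6), (0, 8, 8), (0, 8, 0),
  (0, 4, 0)]), ((10, 11, 9), [(12, 0, 6), (0, 8, 0), (0, 4, 0)]), ((12, 23, 21), [(0, 4, 4), (4, 2,
  2)]), ((14, 13, 11), [(0, 14, 6), (12, 0, 6), (0, 8, 8), (0, 6, 2)]), ((16, 9, 9), [(6, 6, 6), (2,
  4, 2)]), ((16, 9, 3), [(8, 8, 0), (8, 0, 0), (4, 0, 0)]), ((20, 13, 5), [(6, 14, 0), (6, 6, 6),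
  (2, 6, 0), (4, 0, 0)]), ((34, 23, 7), [(6, 6, 6), (4, 4, 0), (8, 0, 0), (4, 0, 0)]), ((22, 21, 7),
  [(4, 4, 0), (6, 2, 0)]), ((22, 11, 11), [(2, 4, 2), (6, 0, 2)]), ((12, 15, 3), [(4, 2, 2)]), ((20,
  21, 3), [(4, 2, 2), (4, 4, 0)]), ((12, 19, 5), [(12, 6, 0), (0, 6, 2), (4, 2, 2)]), ((10, 13, 9),
  [(12, 6, 0), (0, 0, 4)]), ((12, 13, 11), [(0, 14, 6), (12, 6, 0), (0, 8, 8), (0, 6, 2)]), ((4, 9,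
  5), [(2, 4, 2)]), ((4, 19, 15), [(0, 14, 6), (0, 6, 2), (0, 0, 4), (0, 4, 0)]), ((6, 17, 7), [(0,
  4, 4), (0, 4, 0)]), ((8, 15, 9), [(0, 14, 6), (0, 8, 8), (0, 4, 0)]), ((8, 15, 11), [(0, 8, 8),
  (0, 2, 6), (4, 2, 2)]), ((8, 15, 15), [(4, 2, 2)]), ((8, 13, 15), [(0, 8, 8), (0, 8, 0), (0, 0,
  4), (0, 4, 0)]), ((10, 15, 13), [(0, 14, 6), (4, 2, 2)]), ((12, 17, 15), [(0, 6, 2), (4, 2, 2)]),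
  ((16, 9, 9), [(12, 0, 6), (0, 4, 0)]), ((16, 11, 9), [(12, 0, 6), (0, 8, 0), (0, 4, 0)]), ((16,
  11, 3), [(2, 6, 0), (8, 0, 0), (4, 0, 0)]), ((14, 7, 5), [(8, 0, 0), (4, 0, 0)]), ((14, 13, 5),
  [(12, 6, 0), (0, 8, 0), (0, 4, 0)]), ((18, 17, 5), [(12, 6, 0), (0, 8, 0), (4, 4, 0), (0, 4, 0)]),
  ((20, 15, 7), [(12, 12, 0), (6, 14, 0), (6, 6, 6), (2, 6, 0), (4, 0, 0)]), ((6, 11, 5), [(4, 4,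
  0)]), ((10, 15, 9), [(0, 12, 12), (0, 14, 6), (12, 6, 0), (0, 2, 6)]), ((12, 17, 9), [(0, 14, 6),
  (12, 6, 0), (0, 8, 8), (0, 4, 0)]), ((14, 15, 11), [(12, 6, 0), (0, 0, 8), (0, 0, 4)]), ((4, 11,
  11), [(0, 4, 0)]), ((6, 15, 5), [(0, 14, 6), (0, 8, 8), (0, 8, 0), (0, 4, 0)]), ((6, 13, 11), [(0,
  12, 6), (0, 4, 4)]), ((8, 15, 7), [(0, 6, 2), (4, 2, 2)]), ((8, 15, 7), [(0, 8, 0), (4, 2, 2), (0,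
  4, 0)]), ((8, 23, 23), [(0, 4, 4), (4, 2, 2)]), ((12, 11, 7), [(12, 0, 6), (0, 4, 0)]), ((12, 3,
  3), [(8, 0, 0), (4, 0, 0)]), ((18, 5, 3), [(14, 6, 0), (8, 0, 0), (4, 0, 0)]), ((20, 7, 3), [(12,
  6, 0), (8, 0, 0), (4, 0, 0)]), ((16, 17, 3), [(4, 4, 0), (6, 2, 0)]), ((14, 5, 5), [(8, 0, 0), (4,
  0, 0)]), ((14, 9, 5), [(4, 4, 0)]), ((18, 9, 7), [(12, 12, 0), (6, 6, 6), (8, 8, 0), (6, 2, 0)]),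
  ((18, 13, 7), [(2, 6, 0), (4, 0, 0)]), ((26, 11, 11), [(8, 0, 0), (4, 0, 0)]), ((16, 13, 19),
  [(12, 6, 0), (4, 2, 2)]), ((10, 11, 3), [(6, 14, 0), (2, 6, 0)]), ((10, 13, 3), [(0, 12, 12), (0,
  6, 2)]), ((10, 17, 3), [(0, 6, 2), (0, 4, 0)]), ((16, 15, 5), [(0, 4, 0)]), ((16, 19, 7), [(12, 6,
  0), (4, 2, 2)]), ((14, 15, 9), [(0, 6, 12), (12, 6, 0)]), ((2, 9, 5), [(0, 4, 0)]), ((2, 11, 5),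
  [(0, 8, 0), (0, 4, 0)]), ((2, 7, 7), [(0, 4, 4)]), ((2, 9, 7), [(0, 4, 4)]), ((2, 11, 7), [(0, 4,
  4)]), ((2, 9, 9), [(0, 4, 0)]), ((4, 9, 3), [(0, 4, 0)]), ((4, 11, 5), [(2, 4, 2)]), ((4, 9, 7),
  [(0, 4, 4)]), ((6, 7, 7), [(6, 6, 6)]), ((6, 9, 7), [(6, 6, 6)]), ((6, 17, 9), [(0, 8, 0), (0, 0,
  4)]), ((6, 11, 11), [(0, 8, 0), (0, 4, 0)]), ((8, 11, 5), [(0, 4, 0)]), ((8, 9, 7), [(6, 6, 6)]),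
  ((8, 13, 7), [(0, 8, 0), (0, 4, 0)]), ((8, 13, 9), [(0, 4, 4)]), ((8, 21, 21), [(0, 4, 4), (4, 2,
  2)]), ((12, 7, 7), [(6, 6, 6)]), ((14, 25, 9), [(0, 6, 14), (12, 6, 0), (0, 2, 6), (0, 4, 0)]),
  ((14, 11, 25), [(0, 20, 0), (0, 18, 0), (12, 0, 6), (0, 0, 4), (0, 4, 0)]), ((20, 11, 11), [(0, 4,
  0)]), ((14, 3, 3), [(8, 0, 0), (4, 0, 0)]), ((16, 5, 3), [(8, 0, 0), (4, 0, 0)]), ((22, 7, 3),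
  [(6, 2, 0), (4, 0, 0)]), ((22, 11, 3), [(4, 4, 0), (6, 2, 0)]), ((18, 15, 3), [(4, 2, 2)]), ((20,
  19, 3), [(4, 4, 0), (6, 2, 0)]), ((20, 5, 5), [(8, 0, 0), (4, 0, 0)]), ((14, 11, 5), [(12, 6, 0),
  (0, 4, 0)]), ((20, 17, 5), [(12, 6, 0), (4, 4, 0)]), ((14, 7, 7), [(6, 6, 6)]), ((16, 13, 7),
  [(12, 0, 6), (12, 6, 0)]), ((12, 9, 9), [(0, 6, 12), (12, 6, 0)]), ((14, 11, 9), [(12, 6, 0), (0,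
  0, 8)]), ((22, 19, 3), [(4, 2, 2), (4, 4, 0)]), ((18, 11, 11), [(12, 6, 0), (0, 8, 8)]), ((12, 11,
  11), [(12, 6, 0)]), ((14, 11, 11), [(12, 6, 0)]), ((6, 11, 3), [(0, 8, 0), (0, 4, 0)]), ((6, 13,
  3), [(0, 4, 0)]), ((8, 15, 3), [(0, 4, 0)]), ((10, 15, 3), [(0, 4, 0)]), ((12, 21, 3), [(2, 6, 0),
  (0, 4, 0)]), ((12, 17, 5), [(0, 4, 0)]), ((12, 19, 5), [(12, 6, 0), (0, 4, 0)]), ((20, 27, 9),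
  [(12, 6, 0), (0, 4, 0)]), ((2, 15, 7), [(0, 8, 0), (0, 4, 0)]), ((2, 17, 7), [(0, 8, 0), (0, 4,
  0)]), ((2, 11, 9), [(0, 4, 4)]), ((4, 11, 3), [(0, 8, 0), (0, 4, 0)]), ((4, 13, 5), [(0, 8, 0),
  (0, 4, 0)]), ((4, 15, 5), [(0, 4, 0)]), ((4, 15, 7), [(0, 4, 0)]), ((4, 17, 7), [(0, 4, 0)]), ((6,
  17, 5), [(0, 6, 2), (0, 4, 0)]), ((8, 17, 5), [(4, 2, 2)]), ((8, 7, 7), [(6, 6, 6)]), ((8, 13,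
  11), [(6, 14, 0), (2, 2, 4), (2, 6, 0)]), ((12, 11, 9), [(4, 2, 2)]), ((8, 25, 9), [(4, 2, 2), (0,
  4, 0)]), ((12, 7, 9), [(0, 12, 6), (12, 0, 6)]), ((14, 9, 9), [(6, 6, 6)]), ((12, 11, 11), [(6, 6,
  6)]), ((10, 7, 3), [(12, 6, 0)]), ((12, 7, 3), [(12, 6, 0)]), ((16, 7, 3), [(12, 6, 0)]), ((18, 7,
  3), [(12, 6, 0)]), ((14, 9, 3), [(12, 6, 0)]), ((14, 11, 3), [(12, 6, 0)]), ((18, 11, 3), [(2, 6,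
  0)]), ((10, 9, 3), [(12, 6, 0)]), ((12, 11, 3), [(12, 6, 0)]), ((26, 19, 3), [(4, 4, 0), (6, 2,
  0)]), ((16, 15, 3), [(14, 6, 0), (4, 4, 0)]), ((16, 7, 5), [(4, 4, 0)]), ((16, 9, 5), [(12, 6,
  0)]), ((20, 9, 5), [(12, 6, 0)]), ((12, 9, 5), [(12, 6, 0)]), ((12, 11, 5), [(12, 6, 0)]), ((12,
  13, 5), [(12, 6, 0)]), ((16, 13, 5), [(12, 6, 0)]), ((16, 15, 7), [(12, 6, 0)]), ((22, 13, 9),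
  [(12, 6, 0)]), ((12, 7, 9), [(12, 6, 0)]), ((20, 13, 9), [(12, 6, 0)]), ((10, 9, 9), [(12, 6,
  0)]), ((6, 11, 3), [(12, 12, 0), (2, 6, 0)]), ((12, 13, 3), [(2, 6, 0)]), ((12, 11, 5), [(4, 4,
  0)]), ((14, 9, 7), [(4, 2, 2)]), ((20, 17, 9), [(0, 6, 12)]), ((2, 15, 3), [(0, 4, 0)]), ((2, 17,
  3), [(0, 4, 0)]), ((2, 13, 7), [(0, 12, 6)]), ((2, 9, 9), [(0, 4, 4)]), ((4, 7, 7), [(0, 12, 6)]),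
  ((4, 11, 7), [(0, 12, 6)]), ((4, 13, 7), [(0, 12, 6)]), ((4, 9, 9), [(0, 6, 6)]), ((4, 15, 9),
  [(0, 12, 6)]), ((6, 9, 5), [(0, 12, 6)]), ((6, 13, 5), [(0, 6, 2)]), ((6, 11, 7), [(0, 12, 6)]),
  ((6, 11, 9), [(0, 12, 6)]), ((6, 13, 9), [(0, 12, 6)]), ((8, 11, 11), [(0, 12, 6)]), ((10, 9, 7),
  [(0, 12, 6)]), ((10, 11, 11), [(0, 12, 6)]), ((10, 13, 11), [(0, 12, 6)]), ((10, 13, 17), [(0, 6,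
  2), (4, 2, 2)]), ((16, 11, 11), [(6, 6, 6)]), ((10, 3, 3), []), ((8, 5, 3), []), ((10, 5, 3), []),
  ((12, 5, 3), []), ((14, 5, 3), []), ((12, 9, 3), []), ((18, 9, 3), []), ((16, 13, 3), []), ((18,
  13, 3), []), ((20, 13, 3), []), ((20, 15, 3), []), ((24, 19, 3), [(4, 4, 0)]), ((18, 19, 3), [(4,
  4, 0), (6, 2, 0)]), ((10, 5, 5), []), ((16, 5, 5), []), ((12, 7, 5), []), ((16, 11, 5), []), ((20,
  15, 5), []), ((10, 9, 5), [(12, 6, 0)]), ((28, 21, 5), [(4, 4, 0)]), ((16, 17, 5), [(12, 6, 0),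
  (4, 4, 0)]), ((18, 7, 7), []), ((6, 7, 3), []), ((6, 9, 3), []), ((8, 7, 3), []), ((8, 11, 3),
  []), ((8, 13, 3), []), ((8, 21, 3), [(0, 4, 0)]), ((14, 15, 3), []), ((10, 7, 5), []), ((16, 17,
  5), []), ((2, 11, 3), []), ((2, 13, 3), []), ((4, 7, 5), []), ((4, 9, 7), [(0, 6, 6)]), ((6, 5,
  5), []), ((6, 7, 5), []), ((6, 9, 9), []), ((6, 13, 13), []), ((8, 7, 5), []), ((8, 9, 5), []),
  ((8, 13, 5), [(0, 8, 0), (0, 4, 0)]), ((8, 11, 9), []), ((8, 13, 13), []), ((10, 11, 13), [(12, 6,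
  0)]), ((12, 11, 17), [(12, 6, 0)])]

/-- Colours and legs of small labelings with an even number of edges. -/
def evenExplicit : List (List ℕ × List ℕ × List ℕ × List ℕ) := [
  ([6, 7, 8, 10], [1, 6], [5, 2, 8], [4, 3, 7]), ([8, 9, 10, 12], [1, 9], [6, 3, 7, 2, 10], [5, 4,
  8]), ([9, 11, 12, 14], [2, 12], [7, 4, 10, 1, 11], [3, 8, 6, 5, 9]), ([7, 11, 12, 14], [1, 11],
  [3, 9, 5, 6, 8, 4, 7], [10, 2, 12]), ([7, 13, 14, 16], [2, 14], [11, 5, 8, 6, 10, 3, 13], [1, 12,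
  4, 9, 7]), ([8, 13, 14, 16], [2, 14], [1, 12, 4, 9, 7, 6, 10, 3, 13], [11, 5, 8]), ([6, 9, 10,
  14], [2, 8, 1, 9], [5, 4, 10], [7, 3, 6]), ([8, 11, 12, 14], [1, 10, 2, 12], [6, 5, 9, 3, 11], [7,
  4, 8]), ([9, 13, 14, 16], [1, 12, 2, 14], [8, 5, 11, 3, 13], [7, 6, 10, 4, 9]), ([7, 13, 14, 16],
  [3, 11, 2, 14], [8, 6, 10, 4, 12, 1, 13], [5, 9, 7]), ([7, 11, 12, 15], [1, 10, 2, 9, 3, 12], [8,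
  4, 11], [6, 5, 7]), ([11, 12, 14, 17], [6, 8, 4, 13, 1, 11], [2, 10, 7, 5, 12], [9, 3, 14]), ([2,
  13, 14, 17], [5, 9, 8, 6, 7, 10, 4, 13], [11, 3, 14], [1, 12, 2]), ([10, 17, 18, 20], [1, 16, 4,
  13, 5, 15, 2, 18], [12, 6, 14, 3, 17], [7, 11, 9, 8, 10]), ([10, 19, 20, 22], [3, 16, 6, 14, 5,
  17, 2, 20], [11, 9, 13, 7, 15, 4, 18, 1, 19], [8, 12, 10]), ([14, 25, 26, 28], [3, 22, 6, 20, 5,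
  23, 2, 26], [17, 9, 19, 7, 21, 4, 24, 1, 25], [8, 18, 10, 16, 12, 13, 15, 11, 14]), ([12, 23, 24,
  26], [1, 22, 4, 19, 7, 17, 6, 20, 3, 23], [16, 8, 18, 5, 21, 2, 24], [9, 15, 11, 13, 10, 14, 12]),
  ([20, 21, 22, 25], [1, 19, 6, 14, 8, 12, 10, 15, 5, 17, 3, 22], [13, 7, 18, 2, 20], [11, 9, 16, 4,
  21]), ([14, 22, 24, 27], [2, 20, 4, 23, 1, 21, 6, 18, 9, 15, 7, 17, 5, 22], [13, 11, 16, 8, 19, 3,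
  24], [12, 10, 14]), ([24, 35, 36, 38], [1, 34, 4, 31, 7, 28, 10, 26, 9, 29, 6, 32, 3, 35], [21,
  14, 22, 13, 25, 11, 27, 8, 30, 5, 33, 2, 36], [16, 19, 17, 18, 20, 15, 23, 12, 24]), ([25, 41, 42,
  44], [1, 40, 4, 37, 7, 34, 10, 31, 11, 33, 8, 36, 5, 39, 2, 42], [24, 17, 27, 14, 30, 12, 32, 9,
  35, 6, 38, 3, 41], [19, 22, 20, 21, 23, 18, 26, 15, 29, 13, 28, 16, 25]), ([18, 33, 34, 36], [1,
  32, 4, 29, 7, 26, 10, 23, 13, 21, 12, 24, 9, 27, 6, 30, 3, 33], [20, 14, 22, 11, 25, 8, 28, 5, 31,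
  2, 34], [15, 19, 17, 16, 18]), ([32, 51, 52, 54], [1, 50, 4, 47, 7, 44, 10, 41, 13, 38, 16, 35,
  17, 37, 14, 40, 11, 43, 8, 46, 5, 49, 2, 52], [27, 24, 28, 23, 31, 20, 34, 18, 36, 15, 39, 12, 42,
  9, 45, 6, 48, 3, 51], [26, 25, 29, 22, 30, 21, 33, 19, 32])]

/-- The lengths in `evenExplicit`. -/
def evenSmall : List Vec := [
  (2, 3, 3), (2, 5, 3), (2, 5, 5), (2, 7, 3), (2, 7, 5), (2, 9, 3), (4, 3, 3), (4, 5, 3), (4, 5, 5),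
  (4, 7, 3), (6, 3, 3), (6, 5, 3), (8, 3, 3), (8, 5, 5), (8, 9, 3), (8, 9, 9), (10, 7, 7), (12, 5,
  5), (14, 7, 3), (14, 13, 9), (16, 13, 13), (18, 11, 5), (24, 19, 9)]

/-- For even q, parity calls for A = 3; the colours are q + 3, q, q - 1 and a leaf label. -/
theorem valid_evenLengths : ∀ p ∈ evenLengths, Valid p :=
  valid_of_checkCodes (A := 3) (l := evenCodes) (by decide +kernel)

theorem valid_evenSmall : ∀ p ∈ evenSmall.map fun v => (v, ([] : List Vec)), Valid p :=
  valid_of_checkExplicit (l := evenExplicit) (by decide +kernel)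

def evenAll : List (Vec × List Vec) := evenLengths ++ evenSmall.map fun v => (v, [])

theorem valid_evenAll : ∀ p ∈ evenAll, Valid p := fun p hp =>
  (List.mem_append.1 hp).elim (valid_evenLengths p) (valid_evenSmall p)

/-! ### Covering one odd and two even legs. -/

/-- Indices for the sector `oddNear`. -/
def oddNearTable : List (List ℕ) := [
  [0x19019019019019019019019019019019019, 0, 0, 0, 0, 0, 0, 0, 0, 0, 0],
  [0x1c01c01c01c03801c03801c03801c03803f, 0x1d01d01d01d01d01d01d01d01d01d01d04f, 0, 0, 0, 0, 0, 0,
    0, 0, 0],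
  [0xa00a00b00b00a00a00b01c00a04700b033, 0x600601000600601e01000600601e010006,
    0x7007011007007007011007007016011007, 0, 0, 0, 0, 0, 0, 0, 0],
  [0xa00a00b00b00a01c00b00b00a03f00b033, 0x600601000600601e01001e006022010006,
    0x7007011007007016011007016016011007, 0x8014014008008014014008008014048008, 0, 0, 0, 0, 0, 0, 0],
  [0xa00a00b01c00a00a00b00b00a039039039, 0x603401000601e03401e02201e034034040,
    0x701601100700701601601600702203a007, 0x800802800800800d02800800800d04900d,
    0x300d00900300300d00900300d00d00d03b, 0, 0, 0, 0, 0, 0],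
  [0xa01c00b00b00a00a00b03f00a02300b033, 0x600601000601e02201e006006040010006,
    0x701601101601601601102203a030030030, 0x8014014008008014014008022014028008,
    0x300300900300300300900300303b009050, 0x500500e00500500500e00500504800e005, 0, 0, 0, 0, 0],
  [0xa00a00b00b00a00a00b02300a02300b033, 0x600601002200601e01001e00602404a006,
    0x701601101600702203a030030030042041, 0x8008028008008008022008008049028008,
    0x300d00900300300d00903b02200c00d02c, 0x500d00e00500500d00e00d00d00f00d04b,
    0xd00d00900300d00d00d00d00d00c03b029, 0, 0, 0, 0],
  [0xa00a00b00b00a02300b02300a02300b033, 0x600601000600600601002400602401001a,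
    0x7007011007007007011007007024011007, 0x801401400800801401400800801402802a,
    0x300300900300300300900c00300c009003, 0x500500e00500500500e00f00500f00e005,
    0x300300900300300300900c00300c009003, 0x500500e00500500500e00f00500f00e005,
    0x300300900300300300900c00300c009003, 0x500500e00500500500e00f00500f00e005,
    0x300300900300300300900c00300c009003],
  [0xa00a00b02300a02300b02300a02300b025, 0x600601000600602401002400602401001a,
    0x700701100700700701102400702401101a, 0x800802800800800802800802402a02802a,
    0x300300900300300c00900c00c00c00901a, 0x500500e00500500f00e00f00f00f00e005,
    0x300300900300300c00900c00c00c009003, 0x500500e00500500f00e00f00f00f00e005,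
    0x300300900300300c00900c00c00c009003, 0x500500e00500500f00e00f00f00f00e005,
    0x300300900300300c00900c00c00c009003]]

/-- Lengths `(x, y, z)` with `y, z` even and `z + 14 ≤ 2 * x`, `z ≤ y`. -/
def oddNear : Sector where
  len := fun i j k => (k + j + 8, 2 * i + 2, 2 * j + 2)
  -- The first condition is the parity of the odd leg; it fixes k modulo 2, hence `stride = 2`. The
  -- condition i < j, violating z ≤ y, may discard a cell only for i < 7, where i is not reduced;
  -- translating i could otherwise restore z ≤ y.
  skip := fun i j k => ((k + j) % 2).beq 0 || (i.blt 7 && i.blt j)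
  v₁ := (0, 4, 0)
  v₂ := (2, 0, 4)
  v₃ := (6, 0, 0)
  μ₁ := 2
  μ₂ := 2
  μ₃ := 6
  θ₁ := 7
  θ₂ := 9
  θ₃ := 18
  stride := 2

theorem oddNear_periodic : oddNear.Periodic := by
  refine ⟨by decide, by decide, by decide, ?_, ?_⟩
  · intro i j k a b c
    simp only [oddNear, Prod.smul_mk, Prod.mk_add_mk, Prod.mk.injEq, smul_eq_mul]
    refine ⟨?_, ?_, ?_⟩ <;> ring
  · intro i j k a b c ha hb hc
    simp only [oddNear, Bool.or_eq_true, Bool.and_eq_true, Nat.beq_eq, Nat.blt_eq] at *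
    omega

theorem oddNear_table : checkTable oddAll oddNear oddNearTable = true := by
  decide +kernel

/-- Indices for the sector `oddFar`. -/
def oddFarTable : List (List ℕ) := [
  [0x31031031031031031065063062000, 0x2d02d02d02d02d02d02d064000, 0x43053043052043067051066000000,
    0x44056044055044068054000000, 0x1803201803c01804c057000000000, 0x1f03501f04501f069000000000,
    0x1803204c03c01806a000000000000, 0x1f03501f04501f000000000000, 0x1803201803c018000000000000000,
    0x1f03501f045000000000000000, 0x1803201803c000000000000000000, 0x1f03501f000000000000000000,
    0x18032018000000000000000000000, 0x1f035000000000000000000000, 0x18032000000000000000000000000],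
  [0x2502502502502504d05806c06b, 0x1501501501501505a04003d059000, 0x2e02e02e02e02e04202e02e000,
    0x2b02b02b02b02b02b02b02b000000, 0x200200200201702002c000000, 0x400400400400402604e000000000,
    0x2002002002017020000000000, 0x400400404e004026000000000000, 0x2002002002017000000000000,
    0x4004004004004000000000000000, 0x2002002002000000000000000, 0x4004004004000000000000000000,
    0x2002002000000000000000000, 0x4004004000000000000000000000, 0x2002000000000000000000000],
  [0x2502502502504d03905c04705b06d, 0x1a01a01a01a01a03405e04a05d, 0x1501501501501502f03603d041000,
    0x2a02a02a02a02a02f02905f000, 0x1202f036000000, 0x100100102900102102f000000,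
    0x2900000001203e000000000, 0x1001001001001021000000000, 0x3e000012000000000000,
    0x1001001001001000000000000, 0, 0x1001001001000000000000000, 0, 0x1001001000000000000000000, 0],
  [0, 0, 0x1a01a01a02f03604204103a060, 0x1501501501501503603703d061000, 0x200200000201702002c046000,
    0x4004001001004026036037000000, 0x200200000201702002c000000, 0x400400100100402602f000000000,
    0x2002000002017020000000000, 0x4004001001004026000000000000, 0x2002000002017000000000000,
    0x4004001001004000000000000000, 0x2002000002000000000000000, 0x4004001001000000000000000000,
    0x2002000000000000000000000],
  [0, 0, 0, 0, 0x1b01b01202701b03d029000, 0x100101302f02101302906e000, 0x1b00d01202701b046000000,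
    0x1001013029021013037000000, 0x1b00001202701b000000000, 0x1001001001021013000000000,
    0x1b03e012027000000000000, 0x1001001001001000000000000, 0x1b000000000000000000000,
    0x1001001001000000000000000, 0],
  [0, 0, 0, 0, 0, 0, 0x200200000201702002c046000, 0x100400400100402601304b000000,
    0x200200000201702002c000000, 0x1004004001004026037000000000, 0x2002000002017020000000000,
    0x1004004001004026000000000000, 0x2002000002017000000000000, 0x1004004001004000000000000000,
    0x2002000002000000000000000],
  [0, 0, 0, 0, 0, 0, 0, 0, 0x1b01200002701b01b000000, 0x1001013021037013013000000,
    0x2901200002703e000000000, 0x1001013021001013000000000, 0x27012000027000000000000,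
    0x1001013021001000000000000, 0x12000000000000000000],
  [0, 0, 0, 0, 0, 0, 0, 0, 0, 0, 0x200200200201702002c000000, 0x1004004004004026013000000000,
    0x2002002002017020000000000, 0x1004004004004026000000000000, 0x2002002002017020000000000],
  [0, 0, 0, 0, 0, 0, 0, 0, 0, 0, 0, 0x1001021013001013000000000, 0x12012000027027000000000,
    0x1001021021001013000000000, 0x12012000012000000000000]]

/-- Lengths `(x, y, z)` with `y, z` even and `2 * x < z + 14`, `z ≤ y`. -/
def oddFar : Sector where
  -- The coordinate k = y - i - j is chosen so that raising i or j at fixed k gives the periods (4,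
  -- 2, 0) and (0, 4, 8), which the families can supply.
  len := fun i j k => (2 * i + 3, k + i + j, 2 * j + 2)
  -- Besides parity, these are the failures of 2 * x < z + 14, of z ≤ y, and of their consequence j
  -- ≤ 2 * k, which does not involve i and so remains usable when i is reduced. Each is imposed only
  -- where the coordinates that could repair it are not reduced.
  skip := fun i j k => ((k + i + j) % 2).beq 1 || (j.blt 11 && (j + 5).ble (2 * i)) ||
    (k.blt 15 && i.blt 7 && (k + i).blt (j + 2)) || (k.blt 15 && (2 * k).blt j)
  v₁ := (4, 2, 0)
  v₂ := (0, 4, 8)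
  v₃ := (0, 4, 0)
  μ₁ := 2
  μ₂ := 4
  μ₃ := 4
  θ₁ := 7
  θ₂ := 11
  θ₃ := 15
  stride := 2

theorem oddFar_periodic : oddFar.Periodic := by
  refine ⟨by decide, by decide, by decide, ?_, ?_⟩
  · intro i j k a b c
    simp only [oddFar, Prod.smul_mk, Prod.mk_add_mk, Prod.mk.injEq, smul_eq_mul]
    refine ⟨?_, ?_, ?_⟩ <;> ring
  · intro i j k a b c ha hb hc
    simp only [oddFar, Bool.or_eq_true, Bool.and_eq_true, Nat.beq_eq, Nat.blt_eq, Nat.ble_eq] at *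
    omega

theorem oddFar_table : checkTable oddAll oddFar oddFarTable = true := by
  decide +kernel

/-! ### Covering one even and two odd legs. -/

/-- Indices for the sector `evenLong`. -/
def evenLongTable : List (List ℕ) := [
  [0xbc0e20bc0e20bc0e20bc13c176174, 0xbd0e30bd0e30bd0e314013f13e13d,
    0xbe0e40be0e40be10f10e17c10d10c, 0x600e4060097060097142097110141,
    0xbd0810ac0810ac0e50ac1120ac111, 0x600be10f10e06010d10c145144143,
    0x60810060810061100381131460e6, 0x600970600970600971111140ac112, 0x60810060810060e50381151470bf,
    0x600810600e50601151160bf0e7148],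
  [0xe80c00e80c00e80c014a0c017b149, 0xad0610ad0610ad0610ad1170ad14b,
    0x7904b07904b07904b11904b1180c1, 0x6100006100006102e11717f14c, 0x7904b07904b07904b09804b0980c1,
    0x7902111902111808211a14e14d, 0x604b02104b00604b0380e911b0c1, 0x7902106102106108211d0ae11c,
    0x604b02104b00604b03804b14f0c1, 0x610210610210610820ea0af150],
  [0x6807a06807a06807a0681510680eb, 0x7b04c07b04c07b06207b04c0c2062,
    0x25019025019025019025019025072, 0x1f00001f00001f02e01f0c3083, 0x4c07307b07304c0730620730b0073,
    0x1f00001f00001f02e01f0c2083, 0x60720060720060720380720ec072, 0x4c00006200001f07b01f0c211e,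
    0x609900609900609903809906307c, 0x1f00001f00001f02e01f09a083],
  [0x22059022059022059022059022059, 0x28030028030028030028030028069, 0xb03000b03000b03000b06912011f,
    0x2501900001900001902e0190250ed, 0xb03000b03001a06901a05a01a0ee, 0x3000b06900012011f121046069,
    0x60300060300060300381220530e6, 0x5a00000501a05a04600505302f, 0x600500600500600503802f00a0ef,
    0x500000500000502e00508402f],
  [0x280c40280c40280c40280c408509b, 0x22034022034022034022034022034,
    0x28002028002028002028002028002, 0x200000200000202e0020f0023, 0x25019025019025019025019025019,
    0x2100002100000201602101d082, 0x60210060210060210380f20f1002, 0x2101602100002102e02101d082,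
    0x602100602100602103808201d0ef, 0x2100002100002102e02101d082],
  [0x7a06807a06807a06807a06807a008, 0x4c00804c00806200804c00804707b,
    0x2200802200802200802207b0630c2, 0x801f00800000801f01e047013, 0xb04c00b04c00b06207304c063062,
    0x2501901f01900006301f01901f019, 0x60080ec01e006005038013063005,
    0x4c01306200804c00806201e00b031, 0x6005063005006005038005063005, 0x501f00500006301f00501f005],
  [0x59022059022059022059022059017, 0x16002016002016002016002030002,
    0x1600201600201600201600b03000b, 0x5300005300005302e00b069053, 0x5a03405a002030034030002069023,
    0x200000203000202e02301d01a, 0x6019025019006019038019025019, 0x3403003406903402e01a005046,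
    0x600a00600a00600a03800a00500a, 0xa00000a00000a02e00a01d00a],
  [0xb00800b00800b00800b00800b017, 0xb00800b00800b00800b00800b01e, 0x1a00801a00801a00801a00801a01e,
    0x800000800000802e01e01a013, 0xb00800b00800b01e01a01301a013, 0x800000800001e02e00501a013,
    0x600800601e00601303800800b01e, 0x1300001300001302e01e00b031, 0x600500600500600503802f00a0ef,
    0x500000500002f02e00500a005],
  [0x28002028002028002028002028017, 0x1600201600201600201600b01600b, 0x800b00800b00800b00800b00800b,
    0x200000200000202e002008002, 0x1d00201d00201d00200800201e023, 0x200000200000202e02301d01a,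
    0x601a00601a0060230380230c50e6, 0x200000200000202e00201d002, 0x600a00600a00600a03800a00500a,
    0xa00000a00000a02e00a02f00a]]

/-- Lengths `(x, y, z)` with `y, z` odd and `y + z ≤ x`, `z ≤ y`. -/
def evenLong : Sector where
  -- Here 2 * k = x - y - z and 2 * j = y - z, so every triple of parameters is admissible.
  len := fun i j k => (4 * i + 2 * j + 2 * k + 6, 2 * i + 2 * j + 3, 2 * i + 3)
  skip := fun _ _ _ => false
  v₁ := (8, 4, 4)
  v₂ := (4, 4, 0)
  v₃ := (4, 0, 0)
  μ₁ := 2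
  μ₂ := 2
  μ₃ := 2
  θ₁ := 7
  θ₂ := 8
  θ₃ := 8
  stride := 1

theorem evenLong_periodic : evenLong.Periodic := by
  refine ⟨by decide, by decide, by decide, ?_, ?_⟩
  · intro i j k a b c
    simp only [evenLong, Prod.smul_mk, Prod.mk_add_mk, Prod.mk.injEq, smul_eq_mul]
    refine ⟨?_, ?_, ?_⟩ <;> ring
  · intro i j k a b c ha hb hc
    simp [evenLong]

theorem evenLong_table : checkTable evenAll evenLong evenLongTable = true := by
  decide +kernel

/-- Indices for the sector `evenMiddle`. -/
def evenMiddleTable : List (List ℕ) := [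
  [0xf40f30f40f30f40f3153152175, 0xf51570f51230f5156155178154, 0xc80f60c80f60c80f60c70c6113,
    0x480f70480f70480c609c124114, 0x510f70510c6051124051158086, 0xe08700e0c600e0870350bf116,
    0x1106a01106a01112301106a04d, 0xe03900e03900e03903509d0e7, 0x1104901104901104901104904d,
    0xe03900e03900e0390350bf0e7],
  [0xc806b0c706b0b106b064088159, 0xf80f90f80f90f808911c11b11a, 0x6c0ae06c0ae06c0ae0e90ae0e9,
    0x480c90480c90480c915a0c911d, 0x510af0510af0b10af0510af086, 0xe08700e08700e0870351250ea,
    0x1106a01106a0b106a01106a04d, 0xe0390f903900e03909e09d089, 0x110490110490b104901104904d,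
    0xe03900e03900e0390351250ea],
  [0x1706b01706b01706d017088126, 0x8a03d08a09e0ca03d11e0ec025, 0x6c04706c04706c04707c0470c3,
    0x4803d04803d04803d09c0630b0, 0x510470510470c307209a04705b, 0xe08709e08700e0720350630c3,
    0x1106a0110720b007309a06a04d, 0xe0390b008a00e0730350ca09a, 0x1104901104901104909a04904d,
    0xe03d00e03900e03903506309a],
  [0x1706b01706b01706b025088085, 0x2d0fa02d09e0ca089127019121, 0x6c00f01b00f01b0b209f05a053,
    0x480b30480b304805a09c180046, 0x2d00305100306d03e05c0cb086, 0xe00f09e05a05300f03507d053,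
    0x1100301100304605a01106a04d, 0xfa00302d0030fa0030350ca084, 0x1100301100301104908402f04d,
    0xe00300e00308400303509d084],
  [0x1706b03a03f05b019017023022, 0x2601402602906e0650a00f1016, 0x6c05405c0340400320b40980f2,
    0x4805404802301609803a034025, 0x5101405101401601405c023086, 0xe01409e098089002035098016,
    0x1104103a06603f02303f03204d, 0xe01401602301606f03a06e065, 0x1104901103201103201d03204d,
    0xe03900e03201d03201d09d01d],
  [0x1701701701704201708308804c, 0x3d00303d07c03d01903101303d, 0x4700f04700f04701304701e01f,
    0x3d00304607c03d04309c08b03d, 0x8a00308a01305301b08309f01f, 0x3d00f02904401a00f07c01303d,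
    0x4700305300303e0b008304201f, 0x3d00304602f033013073045099, 0x4700304700300a00508302f01f,
    0x3d00300a02f00a00507c005099],
  [0x1701705a01703a074022088030, 0x3014016014025023031053069, 0xf04100f05b03f01901601a022,
    0x302603b02601603206500201d, 0x301400306f03a08402f0b4086, 0xf00d01600d05a031035034055,
    0x305400300201d03402f00a005, 0x301402f03400302300504501d, 0x304900300a01d08401d00a04d,
    0x303902f03200500a03500a005],
  [0x17017017017042017028088126, 0x2d00302902904502f03100801a, 0x6c00f02d02f06c01302801e01a,
    0x4800304601304801e09c005046, 0x2d00305101301a00505102f086, 0xe00d02900d01a01e03500800b,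
    0x1100300a00500a01301a04204d, 0xe00302d02f04602903500800a, 0x1100300a00500a00501102f04d,
    0xe00300a00500a00503509d00a],
  [0x1706b017032017002017088017, 0x301403a04501d0230130c501e, 0xf01400f00201602301d01a01e,
    0x305401d02302f00a09c06601d, 0x305400302300500203a046086, 0xf00d01d00d01e014035002013,
    0x301400506601200204200a04d, 0x301403106601802300804503a, 0x304900500a00503201d00a04d,
    0x303900503200500a03509d01d]]

/-- Lengths `(x, y, z)` with `y, z` odd and `2 * z ≤ x < y + z`. -/
def evenMiddle : Sector where
  -- Here 2 * j = x - 2 * z and 2 * k + 2 = y + z - x, so again there is no constraint.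
  len := fun i j k => (4 * i + 2 * j + 6, 2 * i + 2 * j + 2 * k + 5, 2 * i + 3)
  skip := fun _ _ _ => false
  v₁ := (8, 4, 4)
  v₂ := (4, 4, 0)
  v₃ := (0, 4, 0)
  μ₁ := 2
  μ₂ := 2
  μ₃ := 2
  θ₁ := 7
  θ₂ := 8
  θ₃ := 7
  stride := 1

theorem evenMiddle_periodic : evenMiddle.Periodic := by
  refine ⟨by decide, by decide, by decide, ?_, ?_⟩
  · intro i j k a b c
    simp only [evenMiddle, Prod.smul_mk, Prod.mk_add_mk, Prod.mk.injEq, smul_eq_mul]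
    refine ⟨?_, ?_, ?_⟩ <;> ring
  · intro i j k a b c ha hb hc
    simp [evenMiddle]

theorem evenMiddle_table : checkTable evenAll evenMiddle evenMiddleTable = true := by
  decide +kernel

/-- Indices for the sector `evenShort`. -/
def evenShortTable : List (List ℕ) := [
  [0, 0x12912812912815c15b16f16d16b16a, 0, 0xcd0cc0cd0cc0cd0cc0cd0cc16e16c, 0,
    0xfc0fb0fc0fb0fc0fb12a0d00cf0ce, 0, 0x5d0d105d0d105d07e05d0d10fd0d1, 0,
    0x5e07505e07505e07505e0d00cf0ce, 0, 0x5d07e05d12a05d07e05d07e0fd12b, 0,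
    0x5e07505e07505e07505e0d00cf0ce, 0, 0x5d07e05d07e05d07e05d07e0fd12b, 0,
    0x5e07505e07505e07505e0d00cf0ce, 0],
  [0xd20fe0d20fe0d20fe0d2173171170, 0, 0x1000ff1000ff1000ff0d30a115d172, 0,
    0x10210110210110210112e12d0d412c, 0, 0x7008d07008d08c08d13006708c12f, 0,
    0x560b50560b50560b50560b50d40b5, 0, 0x7008e08c12e12d08e12c06715e08e, 0,
    0x5608d05613005608d0560a20d412f, 0, 0x7008d08c08c08c08d07006708c08e, 0,
    0x5605605608e05608e0560a20d40a2, 0, 0x700a20700a20700a207006707008e],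
  [0, 0xb61030b61030b61320b113116015f, 0, 0xa31030a31320a30d30a11330d60d5, 0,
    0x360760360760360d7036135134161, 0, 0xb60d80a30d81310d80670570b70d8, 0,
    0x360760b60d71330760360d7036162, 0, 0x570570a30571351340670570b7057, 0,
    0x360360360760360b70360760360d7, 0, 0x570570570570a30570670570b7057, 0,
    0x360760360360360b7036076036076, 0],
  [0xd91650d91040d908f0d9164163177, 0, 0xdb0b90db08f0db0b80db0900da105, 0,
    0xa40910a40b80d30a10a40dc166179, 0, 0x7f05207f05207f07107f0a507f136, 0,
    0x4e09104e09104e06704e0dc04e167, 0, 0xa40520a40520a70520a70520a70a6, 0,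
    0x4e09104e0710a40911360dc04e0a5, 0, 0x5205207f07104e07107f0a507f052, 0,
    0x4e09104e09104e06704e0dc04e0dd, 0, 0xa705205205204e0520a70520a70ba],
  [0, 0x5f09205f09206409207705b13717a, 0, 0x9301b09301b09301b0b209f093122, 0,
    0x3f0410640410a110603f05b139138, 0, 0x2009207701b02013706401b02009f, 0,
    0x3f0920b20920c709207705b03f106, 0, 0x2001b0c701b02013913801b02001b, 0,
    0x3f03f05f0410a804103f05b03f13a, 0, 0x2001b02001b02001b02001b02001b, 0,
    0x3f04103f03f06704103f05b03f041, 0],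
  [0x800bb08910408008f0800bb0800de, 0, 0x1c0b901c08f01c0b301c0901070ed, 0,
    0x261080260b802602906e0650a00f1, 0, 0x440710d30a10440710a00580d60d5, 0,
    0x260b306e03b0a003b0261090a9065, 0, 0x5805804403b0650b30a902906e0a6, 0,
    0x260580a00580a902906e0710a00a5, 0, 0x4403b0a9029109071065058094058, 0,
    0x2602602605802603b02603b0260dd, 0, 0x4403b04406704403b04403b0940ba],
  [0, 0x3e0df05f06d03e05c0cb17d0ee10a, 0, 0x5f05406405c07700903a02a0950f2, 0,
    0x3e00906400903e02a03e0420da105, 0, 0x3c0090a102a09506d03c0400a80b4, 0,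
    0x3e00900402a00405c01007803e078, 0, 0x4004009504201000902b012095040, 0,
    0x3e03e03c0090040df01004203c0cb, 0, 0x404001004000404002b012010040, 0,
    0x403e02b03e0040e00100e003e012, 0],
  [0xab0aa0891040ab07d0ab0aa0ab0aa, 0, 0x1c0b901c0270140b801c09006f13b, 0,
    0x3710803703303702904507d03117e, 0, 0xd02703702700d02703103a04f055, 0,
    0x103300103300107d00c0550a907d, 0, 0x370270010270310550180270450a6, 0,
    0x103300d03300105500c0710310a5, 0, 0x102700105500c0710180a5094055, 0,
    0x103300103300103300c0330180dd, 0, 0x102700102700c027018027094027],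
  [0, 0x5f04a05f04a06406f07704a0960f0, 0, 0x5f00900705c07700900702a02c0de, 0,
    0x701406400900701402c04207406f, 0, 0x704a00704a02c06d0640240a810b, 0,
    0x700900710602c05c07704a0d60d5, 0, 0x702402c04200700900702a02c042, 0,
    0x5f02405f0240a802402c042074024, 0, 0x402401002400402402b012010024, 0,
    0x402402b024004024010024074012, 0],
  [0x540e10890e10320250660e10340e1, 0, 0x1c0b901c08f01c04301c08b1070eb, 0,
    0x371080370b803702906f05003110a, 0, 0xd04300d04300d05003104304f08b, 0,
    0x104301408b00103a00c0150da105, 0, 0x3704300105003101501808b127043, 0,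
    0xd04300d01500108b00c01503103a, 0, 0x4f04304f02904f01501804309408b, 0,
    0x104300101500104300c0150180dd, 0, 0x104300104300c015018043094043],
  [0, 0x1b08a02d06d02505c09f16806201e, 0, 0x5f09304109305b03203a09302c096, 0,
    0x700901b00900702a01b04209f13b, 0, 0x4102007702005b02003c0200a8020, 0,
    0x70090070b202c05c01b0b201b078, 0, 0x702002c02005b02000702002c020, 0,
    0x1b01b03c00902b02a01b04203c13a, 0, 0x402001002005b020004020041020, 0,
    0x1b04101b04100404101004101b041, 0],
  [0xbb08000f08007c0800bb0220bb080, 0, 0x1401c03b02506601c06509002301c, 0,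
    0x3b02d05802d02906e045050096169, 0, 0xd02602906e00d02603203a0650de, 0,
    0x3704403b06500104400c0150580ed, 0, 0x3702605806e03101502906e04510b, 0,
    0xd04400d01503b0650290150d60d5, 0, 0x4f04405802602901503b10904f026, 0,
    0x3b04403b01500104400c015018044, 0, 0x3b02600104400c015058026094026],
  [0, 0x4002d04201904006f0b409b069022, 0, 0x900402501000903e00702a0090ee, 0,
    0x901404006f0120660090960b40eb, 0, 0x2d0040df01000903c0cb0950a810a, 0,
    0x90040df00400901002a095078066, 0, 0x700400901004209501203e0da02b, 0,
    0x4003c06d00401203c04002b04003c, 0, 0x3e00401000400400401201001002b, 0,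
    0x4000404000401202b0e00100120e0, 0],
  [0xaa00f0340ab0aa05a0530ab0aa059, 0, 0x3301c01901c05501c09b09002201c, 0,
    0x2708a01401802704506f037062068, 0, 0xf00d05500d03303709604f07d096, 0,
    0x2700102701806f00102700103400c, 0, 0x3700103304505501807d00c0550a6, 0,
    0x3300d05500102700d02900102700c, 0, 0x3300107d00102900105500c03304f, 0,
    0x2700103300102700102700102700c, 0, 0x3300100100100c00103300c0330ba],
  [0, 0x4a00302506d02405c04a01304a01e, 0, 0xf00400f03407c0740f0022009007, 0,
    0x2400702400701200700900702a059, 0, 0x4a02d04a02d04a07404a02c09603c, 0,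
    0x7800707800400900702a02c04a0de, 0, 0x900400900702a02c012007074007, 0,
    0x4a00704a02c01203c02402b02410b, 0, 0x2400402400402407402401007402b, 0,
    0x2400402b00401202b024010012012, 0],
  [0xf00d00f03101308f01e01a09b00b, 0, 0x5401c02301c01401c06609010701c, 0,
    0x302d00301809b0450450370130c5, 0, 0xd00d02900f00d03703204f05004f, 0,
    0x370010450180010010500010a900c, 0, 0x2d00102d04502d01805000c0150a6, 0,
    0xf00d05000d05000d02900103100c, 0, 0x5400105000c01501803200c01504f, 0,
    0x100101500100100c01501801800c, 0, 0x100100100c01501801800c0150ba],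
  [0, 0x301401601406402301309b01e002, 0, 0x5f00f05c01000900700901e009007, 0,
    0x905406402301200703a06602a02c, 0, 0x2d00407700304200702a02c08501e, 0,
    0x7800707800700f00702a02c078066, 0, 0x900700900702a02c012007009007, 0,
    0x900706d02c01203c00902b02a02c, 0, 0x400401000400402b01201001002b, 0,
    0x400402b00401202b010010012012, 0],
  [0x5400f00201303201601a08500b085, 0, 0x1c0b901c08f01c04601c09001c01c, 0,
    0x140030140160140450230130310c5, 0, 0xf00d00f00d00f03701304f05004f, 0,
    0x5400105401802300105003a04600c, 0, 0x303700304503101805000c0150a6, 0,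
    0xd00d03200d05000d01500103200c, 0, 0x100105002901501801800c01504f, 0,
    0x100101501800100c01501801800c, 0, 0x100100100c01501801800c0150ba],
  [0, 0x2d00304606d02802f08500808501e, 0, 0x400400f00201300901e00900900b, 0,
    0x9003046012012009046007028008, 0, 0x401400301401601403c00901302a, 0,
    0x400f00400f00900702a00903c02a, 0, 0x400700400701002c01202a03a007, 0,
    0x400701000902d02a03c00703c02c, 0, 0x400400400401001201201002b02b, 0,
    0x400400401200402b01001002b012, 0]]

/-- Lengths `(x, y, z)` with `y, z` odd and `x < 2 * z`, `z ≤ y`. -/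
def evenShort : Sector where
  -- Here 2 * j + 2 = 2 * z - x and 2 * k = y - z. The only constraint left is that z = i + j + 2 be
  -- odd.
  len := fun i j k => (2 * i + 2, i + j + 2 * k + 2, i + j + 2)
  skip := fun i j _ => ((i + j) % 2).beq 0
  v₁ := (8, 4, 4)
  v₂ := (0, 4, 4)
  v₃ := (0, 4, 0)
  μ₁ := 4
  μ₂ := 4
  μ₃ := 2
  θ₁ := 15
  θ₂ := 15
  θ₃ := 8
  stride := 1

theorem evenShort_periodic : evenShort.Periodic := by
  refine ⟨by decide, by decide, by decide, ?_, ?_⟩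
  · intro i j k a b c
    simp only [evenShort, Prod.smul_mk, Prod.mk_add_mk, Prod.mk.injEq, smul_eq_mul]
    refine ⟨?_, ?_, ?_⟩ <;> ring
  · intro i j k a b c ha hb hc
    simp only [evenShort, Nat.beq_eq] at *
    omega

theorem evenShort_table : checkTable evenAll evenShort evenShortTable = true := by
  decide +kernel

/-! ### From the sectors to all lengths. -/

theorem fourColorable_odd {x y z : ℕ} (hx : 2 ≤ x) (hy : 2 ≤ y) (hz : 2 ≤ z) (hx' : Odd x)
    (hy' : Even y) (hz' : Even z) (hzy : z ≤ y) : FourColorable x y z := by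
  obtain ⟨p, rfl⟩ := hx'
  obtain ⟨q, rfl⟩ := hy'
  obtain ⟨r, rfl⟩ := hz'
  by_cases h : r + r + 14 ≤ 2 * (2 * p + 1)
  -- With z = 2 * r, the third coordinate x - r - 7 is half the distance 2 * x - z - 14 to the
  -- boundary of the sector.
  · have hs : oddNear.skip (q - 1) (r - 1) (2 * p + 1 - r - 7) = false := by
      rw [Bool.eq_false_iff]
      simp only [oddNear, ne_eq, Bool.or_eq_true, Bool.and_eq_true, Nat.beq_eq, Nat.blt_eq]
      omega
    convert oddNear_periodic.fourColorable valid_oddAll oddNear_table hs using 1 <;>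
      simp only [oddNear] <;> omega
  -- The truncated subtraction giving k is exact: z ≤ y and 2 * x < z + 14 force (p - 1) + (r - 1) ≤
  -- 2 * q.
  · have hs : oddFar.skip (p - 1) (r - 1) (2 * q - (p - 1) - (r - 1)) = false := by
      rw [Bool.eq_false_iff]
      simp only [oddFar, ne_eq, Bool.or_eq_true, Bool.and_eq_true, Nat.beq_eq, Nat.blt_eq,
        Nat.ble_eq]
      omega
    convert oddFar_periodic.fourColorable valid_oddAll oddFar_table hs using 1 <;>
      simp only [oddFar] <;> omega

/-- The planes x = y + z and x = 2 * z divide the region z ≤ y into the three sectors. -/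
theorem fourColorable_even {x y z : ℕ} (hx : 2 ≤ x) (hy : 2 ≤ y) (hz : 2 ≤ z) (hx' : Even x)
    (hy' : Odd y) (hz' : Odd z) (hzy : z ≤ y) : FourColorable x y z := by
  obtain ⟨p, rfl⟩ := hx'
  obtain ⟨q, rfl⟩ := hy'
  obtain ⟨r, rfl⟩ := hz'
  by_cases h : q + r + 1 ≤ p
  · convert evenLong_periodic.fourColorable valid_evenAll evenLong_table (i := r - 1)
      (j := q - r) (k := p - q - r - 1) rfl using 1 <;> simp only [evenLong] <;> omega
  by_cases h' : 2 * r + 1 ≤ p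
  · convert evenMiddle_periodic.fourColorable valid_evenAll evenMiddle_table (i := r - 1)
      (j := p - 2 * r - 1) (k := q + r - p) rfl using 1 <;> simp only [evenMiddle] <;> omega
  · have hs : evenShort.skip (p - 1) (2 * r - p) (q - r) = false := by
      rw [Bool.eq_false_iff]
      simp only [evenShort, ne_eq, Nat.beq_eq]
      omega
    convert evenShort_periodic.fourColorable valid_evenAll evenShort_table hs using 1 <;>
      simp only [evenShort] <;> omega

end Spider

theorem mainTheorem2 (a b c : ℕ) (ha : 2 ≤ a) (hb : 2 ≤ b) (hc : 2 ≤ c)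
    (ha_even : Even a) (hb_odd : Odd b) :
    localAntimagicChromaticNumber (spider ![a, b, c]) = 4 := by
  refine localAntimagicChromaticNumber_spider_eq_four ha hb hc ?_
  -- The leg whose parity differs from that of the other two goes first: b if c is even, a if c is
  -- odd. The other two are ordered by length.
  rcases Nat.even_or_odd c with h | h
  · rcases le_total a c with h' | h'
    · exact (Spider.fourColorable_odd hb hc ha hb_odd h ha_even h').swap_right.swap_left
    · exact (Spider.fourColorable_odd hb ha hc hb_odd ha_even h h').swap_left
  · rcases le_total b c with h' | h'
    · exact (Spider.fourColorable_even ha hc hb ha_even h hb_odd h').swap_right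
    · exact Spider.fourColorable_even ha hb hc ha_even hb_odd h h'
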